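/- All graphs are simple and undirected. An edge-colouring (not necessarily proper) of a connected graph $G$ is *rainbow connected* if any two vertices of $G$ are joined by a path whose edges have pairwise distinct colours. The *rainbow connection number* $rc(G)$ is the least integer $r\ge 1$ such that $G$ has a rainbow connected edge-colouring $E(G)\to\{1,\dots,r\}$. The *list rainbow connection number* $rc^\ell(G)$ is the least integer $r\ge 1$ such that, for every assignment to each edge $e$ of a set $L(e)\subseteq\mathbb N$ with $|L(e)|\ge r$, there is a rainbow connected edge-colouring $c$ of $G$ with $c(e)\in L(e)$ for every edge $e$. A *degree $2$ vertex duplication* of a graph takes a vertex $v$ of degree $2$ and adds a new vertex joined to exactly the two neighbours of $v$. Let $G_7$ be the graph obtained from $K_4$ by subdividing once each of the three edges at one vertex. Let $\mathcal G$ be the smallest family of graphs, closed under isomorphism, that contains the cycle $C_5$, the graph $G_7$ and the Petersen graph $\mathsf P_{10}$, and is closed under degree $2$ vertex duplications. For $p\ge q\ge 1$, let $G_{p,q}$ be the graph with vertices $u_1,\dots,u_p,v_1,\dots,v_q,x_1,x_2,y$ and edges $u_iy,\ u_ix_1,\ v_jy,\ v_jx_2$ (for all $i,j$) and $x_1x_2$.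 For $p\ge q\ge r\ge 1$, let $G_{p,q,r}$ be the graph with vertices $u_1,\dots,u_p,v_1,\dots,v_q,w_1,\dots,w_r,x_1,x_2,x_3,y$ and edges $u_iy,\ u_ix_1,\ v_jy,\ v_jx_2,\ w_ky,\ w_kx_3$ (for all $i,j,k$) and $x_1x_2,\ x_1x_3,\ x_2x_3$. **Theorem.** For every $G\in\mathcal G$ we have $rc(G)=rc^\ell(G)\in\{3,4\}$. More precisely, up to isomorphism $\mathcal G$ consists exactly of $\mathsf P_{10}$, the graphs $G_{p,q}$ with $p\ge q\ge 1$, and the graphs $G_{p,q,r}$ with $p\ge q\ge r\ge 1$, and the values are as follows. - $rc(\mathsf P_{10})=rc^\ell(\mathsf P_{10})=3$. - For $p\ge q\ge 1$, $$rc(G_{p,q})=rc^\ell(G_{p,q})=\begin{cases}3,&\text{if } p+q\le 7\text{ or }(p,q)\in\{(6,2),(5,3),(4,4),(6,3)\},\\ 4,&\text{if } p+q\ge 10\text{ or }(p,q)\in\{(7,1),(8,1),(7,2),(5,4)\}.\end{cases}$$ - For $p\ge q\ge r\ge 1$, $$rc(G_{p,q,r})=rc^\ell(G_{p,q,r})=\begin{cases}3,&\text{if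 } p+q+r\le 8\text{ or }(p,q,r)\in\{(7,1,1),(4,4,1),(5,2,2),(3,3,3)\},\\ 4,&\text{if } p+q+r\ge 10\text{ or }(p,q,r)\in\{(6,2,1),(5,3,1),(4,3,2)\}.\end{cases}$$ -/

import Mathlib

universe u

namespace RainbowConnection

/-! ### Rainbow connection numbers -/

section Parameters

variable {V : Type*} (G : SimpleGraph V)

/-- A (not necessarily proper) edge-colouring `c` of `G` is rainbow connected if any two vertices
are joined by a path on which no two distinct edges have the same colour. -/
def IsRainbowConnected {K : Type*} (c : G.EdgeLabeling K) : Prop :=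
  ∀ a b : V, ∃ p : G.Walk a b, p.IsPath ∧ Set.InjOn c {e : G.edgeSet | (e : Sym2 V) ∈ p.edges}

/-- The rainbow connection number: the least positive integer `r` such that `G` has a rainbow
connected edge-colouring with `r` colours. -/
noncomputable def rc : ℕ :=
  sInf {r : ℕ | 0 < r ∧ ∃ c : G.EdgeLabeling (Fin r), IsRainbowConnected G c}

/-- The list rainbow connection number: the least positive integer `r` such that, whenever every
edge `e` is given a list `L e ⊆ ℕ` of at least `r` colours, one can choose a colour `c e ∈ L e` for
every edge `e` so that `c` is rainbow connected. -/
noncomputable def rcList : ℕ :=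
  sInf {r : ℕ | 0 < r ∧ ∀ L : G.EdgeLabeling (Set ℕ), (∀ e, (r : ℕ∞) ≤ (L e).encard) →
    ∃ c : G.EdgeLabeling ℕ, (∀ e, c e ∈ L e) ∧ IsRainbowConnected G c}

end Parameters

/-! ### The family of graphs -/

/-- The graph obtained from `G` by adding a new vertex `none` joined to the neighbours of `v`. -/
def duplicate {V : Type*} (G : SimpleGraph V) (v : V) : SimpleGraph (Option V) where
  Adj
    | some a, some b => G.Adj a b
    | some a, none => G.Adj v a
    | none, some b => G.Adj v b
    | none, none => False
  symm := ⟨by rintro (_ | a) (_ | b) h <;> first | exact h | exact SimpleGraph.Adj.symm h⟩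
  loopless := ⟨by rintro (_ | a) h <;> first | exact h | exact G.loopless.irrefl a h⟩

/-- The Petersen graph: an outer 5-cycle `inl i`, an inner pentagram `inr i`, and spokes. -/
def petersen : SimpleGraph (ZMod 5 ⊕ ZMod 5) :=
  SimpleGraph.fromRel fun
    | .inl i, .inl j => j = i + 1
    | .inr i, .inr j => j = i + 2
    | .inl i, .inr j => i = j
    | .inr _, .inl _ => False

/-- The graph obtained from `K₄`, with vertices `inl 0, …, inl 3`, by subdividing once each of the
three edges at `inl 0`; the vertex `inr i` subdivides the edge between `inl 0` and
`inl (i + 1)`. -/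
def G7 : SimpleGraph (Fin 4 ⊕ Fin 3) :=
  SimpleGraph.fromRel fun
    | .inl a, .inl b => a ≠ 0 ∧ b ≠ 0
    | .inr i, .inl a => a = 0 ∨ a = i.succ
    | _, _ => False

/-- The smallest isomorphism-closed family of graphs that contains `C₅`, `G7` and the Petersen
graph and is closed under degree 2 vertex duplications. -/
inductive Family : ∀ {V : Type u}, SimpleGraph V → Prop
  | base_C5 {V : Type u} {G : SimpleGraph V} (e : G ≃g SimpleGraph.cycleGraph 5) : Family G
  | base_G7 {V : Type u} {G : SimpleGraph V} (e : G ≃g G7) : Family G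
  | base_petersen {V : Type u} {G : SimpleGraph V} (e : G ≃g petersen) : Family G
  | dup {V W : Type u} {G : SimpleGraph V} {H : SimpleGraph W} (v : V)
      (hG : Family G) (hv : (G.neighborSet v).encard = 2) (e : H ≃g duplicate G v) : Family H

/-- The vertices of `G_{p,q}`. -/
inductive Vertex₂ (p q : ℕ) : Type
  | u (i : Fin p)
  | v (j : Fin q)
  | x₁
  | x₂
  | y
  deriving DecidableEq

/-- The graph `G_{p,q}`. -/
def G₂ (p q : ℕ) : SimpleGraph (Vertex₂ p q) :=
  SimpleGraph.fromRel fun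
    | .u _, .y => True
    | .u _, .x₁ => True
    | .v _, .y => True
    | .v _, .x₂ => True
    | .x₁, .x₂ => True
    | _, _ => False

/-- The vertices of `G_{p,q,r}`. -/
inductive Vertex₃ (p q r : ℕ) : Type
  | u (i : Fin p)
  | v (j : Fin q)
  | w (k : Fin r)
  | x₁
  | x₂
  | x₃
  | y
  deriving DecidableEq

/-- The graph `G_{p,q,r}`. -/
def G₃ (p q r : ℕ) : SimpleGraph (Vertex₃ p q r) :=
  SimpleGraph.fromRel fun
    | .u _, .y => True
    | .u _, .x₁ => True
    | .v _, .y => True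
    | .v _, .x₂ => True
    | .w _, .y => True
    | .w _, .x₃ => True
    | .x₁, .x₂ => True
    | .x₁, .x₃ => True
    | .x₂, .x₃ => True
    | _, _ => False

end RainbowConnection

namespace RainbowConnection

/-! ### Rainbow paths for colourings of unordered pairs -/

section Joined

variable {V W K : Type*} {G : SimpleGraph V}

/-! Apart from the Petersen graph, the members of the family are hub graphs: a hub, a complete rim
on two or three vertices, and middle vertices of degree 2, each attached to the hub and to one rim
vertex. Up to isomorphism only the sizes of the parts (the fibres of `π`) matter. `C₅` and `G7` have
one middle vertex per part, and duplicating a middle vertex enlarges its part. Other vertices of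
degree 2 exist only for two parts, one of them a singleton, and there the automorphism `hubSwap`
turns the duplication into that of a middle vertex. This gives `family_iff`.

For the values, constant lists show `rc ≤ rcList`, so it suffices to bound ordinary colourings from
below and list colourings from above (`rc_eq_and_rcList_eq`).

Lower bounds. With three colours, rainbow paths have at most three edges, so two middle vertices
with the same colour at the hub must be joined across the rim. Hence the pairs (colour at the hub,
colour at the rim) are distinct and there are at most nine middle vertices. If there are exactly
nine, each class of a hub colour shows all three rim colours. A class meeting exactly two parts
would then contain a vertex with the colour of the rim edge between them, which blocks its path. So
every class lies in one part or meets all three parts once, and the part sizes are congruent modulo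
3 (divisible by 3 for two parts). Only `(7, 1)` needs a separate count, `hub_two_card_fiber_le_six`.

Upper bounds. Lists of four colours leave room for one privileged middle vertex per part through
which all detours run (`hub_joined_of_special`). With lists of three colours, Hall's theorem tries
to use every hub colour at most twice, because a class of two can always be completed at the rim.
This fails only if one list occurs at least seven times, or if nine lists live on four colours; then
classes of three are needed (`exists_top`). For three parts the rim colours are chosen distinct, and
the 3-choosability of the octahedron colours a transversal triple. For two parts the colour of the
rim edge is avoided at all middle vertices where possible, and the remaining cases are coloured
explicitly (`hub_two_coloring_of_plain`, `hub_two_coloring_of_constant`).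

For the Petersen graph, a graph of 30 conflicts between the 15 edges is coloured from lists by the
Combinatorial Nullstellensatz; the conflicts already force rainbow paths of length at most 3. -/

/-- Two vertices are joined by a path of `G` on which the colours given by `f` are distinct. -/
def Joined (G : SimpleGraph V) (f : Sym2 V → K) (a b : V) : Prop :=
  ∃ p : G.Walk a b, p.IsPath ∧ (p.edges.map f).Nodup

theorem isRainbowConnected_iff_joined (f : Sym2 V → K) :
    IsRainbowConnected G (fun e : G.edgeSet => f e) ↔ ∀ a b, Joined G f a b := by
  refine forall₂_congr fun a b => exists_congr fun p => and_congr_right fun hp => ?_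
  have hn : p.edges.Nodup := hp.isTrail.edges_nodup
  rw [List.nodup_map_iff_inj_on hn]
  constructor
  · intro h x hx y hy hxy
    have := @h ⟨x, p.edges_subset_edgeSet hx⟩ hx ⟨y, p.edges_subset_edgeSet hy⟩ hy hxy
    exact congrArg Subtype.val this
  · intro h x hx y hy hxy
    exact Subtype.ext (h x hx y hy hxy)

theorem exists_eq_restrict [Nonempty K] (c : G.EdgeLabeling K) :
    ∃ f : Sym2 V → K, c = fun e : G.edgeSet => f e := by
  classical
  refine ⟨fun s => if h : s ∈ G.edgeSet then c ⟨s, h⟩ else Classical.arbitrary K, ?_⟩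
  funext e
  simp

theorem Joined.refl (f : Sym2 V → K) (a : V) : Joined G f a a := ⟨.nil, by simp, by simp⟩

theorem Joined.symm {f : Sym2 V → K} {a b : V} (h : Joined G f a b) : Joined G f b a := by
  obtain ⟨p, hp, hn⟩ := h
  exact ⟨p.reverse, hp.reverse, by simpa using hn⟩

theorem Joined.of_adj (f : Sym2 V → K) {a b : V} (h : G.Adj a b) : Joined G f a b :=
  ⟨.cons h .nil, by simp [h.ne], by simp⟩

theorem Joined.two {f : Sym2 V → K} {a m b : V} (h₁ : G.Adj a m) (h₂ : G.Adj m b) (hab : a ≠ b)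
    (hf : f s(a, m) ≠ f s(m, b)) : Joined G f a b :=
  ⟨.cons h₁ (.cons h₂ .nil), by simp [h₁.ne, h₂.ne, hab], by simp [hf]⟩

theorem Joined.three {f : Sym2 V → K} {a m n b : V} (h₁ : G.Adj a m) (h₂ : G.Adj m n)
    (h₃ : G.Adj n b) (han : a ≠ n) (hmb : m ≠ b) (hab : a ≠ b)
    (hf : [f s(a, m), f s(m, n), f s(n, b)].Nodup) : Joined G f a b :=
  ⟨.cons h₁ (.cons h₂ (.cons h₃ .nil)), by
    simp [h₁.ne, h₂.ne, h₃.ne, han, hmb, hab], by simpa using hf⟩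

theorem Joined.four {f : Sym2 V → K} {a m n o b : V} (h₁ : G.Adj a m) (h₂ : G.Adj m n)
    (h₃ : G.Adj n o) (h₄ : G.Adj o b) (hv : [a, m, n, o, b].Nodup)
    (hf : [f s(a, m), f s(m, n), f s(n, o), f s(o, b)].Nodup) : Joined G f a b :=
  ⟨.cons h₁ (.cons h₂ (.cons h₃ (.cons h₄ .nil))), by
    rw [SimpleGraph.Walk.isPath_def]; simpa using hv, by simpa using hf⟩

/-- A rainbow path with few colours is short. -/
theorem Joined.exists_short [Fintype K] {f : Sym2 V → K} {a b : V} (h : Joined G f a b)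
    (hK : Fintype.card K ≤ 3) :
    a = b ∨ G.Adj a b ∨ (∃ m, G.Adj a m ∧ G.Adj m b ∧ f s(a, m) ≠ f s(m, b)) ∨
      (3 ≤ Fintype.card K ∧ ∃ m n, G.Adj a m ∧ G.Adj m n ∧ G.Adj n b ∧ a ≠ n ∧ m ≠ b ∧
        f s(a, m) ≠ f s(m, n) ∧ f s(a, m) ≠ f s(n, b) ∧ f s(m, n) ≠ f s(n, b)) := by
  obtain ⟨p, hp, hn⟩ := h
  have hl := hn.length_le_card
  simp only [List.length_map, SimpleGraph.Walk.length_edges] at hl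
  match p, hp, hn, hl with
  | .nil, _, _, _ => exact Or.inl rfl
  | .cons h₁ .nil, _, _, _ => exact Or.inr (Or.inl h₁)
  | .cons (v := m) h₁ (.cons h₂ .nil), _, hn, _ =>
    refine Or.inr (Or.inr (Or.inl ⟨m, h₁, h₂, by simpa using hn⟩))
  | .cons (v := m) h₁ (.cons (v := n) h₂ (.cons h₃ .nil)), hp, hn, hl =>
    refine Or.inr (Or.inr (Or.inr ⟨by simpa using hl, m, n, h₁, h₂, h₃, ?_⟩))
    rw [SimpleGraph.Walk.isPath_def] at hp
    simp only [SimpleGraph.Walk.support_cons, SimpleGraph.Walk.support_nil,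
      SimpleGraph.Walk.edges_cons, SimpleGraph.Walk.edges_nil, List.map_cons, List.map_nil,
      List.nodup_cons, List.mem_cons, List.not_mem_nil, or_false, not_or] at hp hn
    tauto
  | .cons h₁ (.cons h₂ (.cons h₃ (.cons h₄ p))), _, _, hl =>
    simp only [SimpleGraph.Walk.length_cons] at hl
    omega

end Joined

/-! ### Comparing the two parameters -/

section Parameters

variable {V W : Type*} {G : SimpleGraph V} {H : SimpleGraph W}

/-- Larger or infinite lists can be cut down to exactly `r` colours, so finite lists of that size
are enough. -/
theorem mem_rcList_of_joined {r : ℕ} (hr : 0 < r)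
    (h : ∀ L : Sym2 V → Finset ℕ, (∀ s ∈ G.edgeSet, (L s).card = r) →
      ∃ f : Sym2 V → ℕ, (∀ s ∈ G.edgeSet, f s ∈ L s) ∧ ∀ a b, Joined G f a b) :
    r ∈ {r : ℕ | 0 < r ∧ ∀ L : G.EdgeLabeling (Set ℕ), (∀ e, (r : ℕ∞) ≤ (L e).encard) →
      ∃ c : G.EdgeLabeling ℕ, (∀ e, c e ∈ L e) ∧ IsRainbowConnected G c} := by
  classical
  refine ⟨hr, fun L hL => ?_⟩
  have hex : ∀ e : G.edgeSet, ∃ t : Finset ℕ, (t : Set ℕ) ⊆ L e ∧ t.card = r := by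
    intro e
    obtain ⟨t, ht, htc⟩ := Set.exists_subset_encard_eq (hL e)
    have hfin : t.Finite := Set.finite_of_encard_eq_coe htc
    refine ⟨hfin.toFinset, by simpa using ht, ?_⟩
    rw [hfin.encard_eq_coe_toFinset_card] at htc
    exact_mod_cast htc
  choose t ht htc using hex
  obtain ⟨f, hf, hJ⟩ := h (fun s => if hs : s ∈ G.edgeSet then t ⟨s, hs⟩ else ∅) (by
    intro s hs
    simp [hs, htc])
  refine ⟨fun e => f e, fun e => ht e ?_, (isRainbowConnected_iff_joined f).2 hJ⟩
  simpa using hf e e.2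

/-- The constant list `{0, …, r - 1}` turns a list colouring into an ordinary one. -/
theorem rc_le_of_mem_rcList {r : ℕ}
    (h : r ∈ {r : ℕ | 0 < r ∧ ∀ L : G.EdgeLabeling (Set ℕ), (∀ e, (r : ℕ∞) ≤ (L e).encard) →
      ∃ c : G.EdgeLabeling ℕ, (∀ e, c e ∈ L e) ∧ IsRainbowConnected G c}) :
    r ∈ {r : ℕ | 0 < r ∧ ∃ c : G.EdgeLabeling (Fin r), IsRainbowConnected G c} := by
  obtain ⟨hr, h⟩ := h
  obtain ⟨c, hc, hR⟩ := h (fun _ => {i | i < r}) (fun e => by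
    have : {i | i < r} = ((Finset.range r : Finset ℕ) : Set ℕ) := by ext; simp
    rw [this, Set.encard_coe_eq_coe_finsetCard, Finset.card_range])
  refine ⟨hr, fun e => ⟨c e, hc e⟩, fun a b => ?_⟩
  obtain ⟨p, hp, hi⟩ := hR a b
  exact ⟨p, hp, fun x hx y hy hxy => hi hx hy (by simpa using hxy)⟩

/-- The list bound also bounds `rc` from above, and the failure of `r` colours also excludes fewer
colours, since `Fin k` embeds in `Fin r`. Both infima are thus squeezed to `r + 1`. -/
theorem rc_eq_and_rcList_eq {r : ℕ}
    (hlow : ∀ f : Sym2 V → Fin r, ¬ ∀ a b, Joined G f a b)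
    (hup : ∀ L : Sym2 V → Finset ℕ, (∀ s ∈ G.edgeSet, (L s).card = r + 1) →
      ∃ f : Sym2 V → ℕ, (∀ s ∈ G.edgeSet, f s ∈ L s) ∧ ∀ a b, Joined G f a b) :
    rc G = r + 1 ∧ rcList G = r + 1 := by
  have hlow' : ∀ k ∈ {r : ℕ | 0 < r ∧ ∃ c : G.EdgeLabeling (Fin r), IsRainbowConnected G c},
      r + 1 ≤ k := by
    rintro k ⟨hk, c, hc⟩
    by_contra hlt
    have hle : k ≤ r := by omega
    have : Nonempty (Fin k) := ⟨⟨0, hk⟩⟩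
    obtain ⟨f, rfl⟩ := exists_eq_restrict c
    rw [isRainbowConnected_iff_joined] at hc
    refine hlow (fun s => Fin.castLE hle (f s)) fun a b => ?_
    obtain ⟨p, hp, hn⟩ := hc a b
    refine ⟨p, hp, ?_⟩
    have := hn.map (Fin.castLE_injective hle)
    rwa [List.map_map] at this
  have hmem := mem_rcList_of_joined (Nat.succ_pos r) hup
  have hmem' := rc_le_of_mem_rcList hmem
  refine ⟨le_antisymm (Nat.sInf_le hmem') (hlow' _ (Nat.sInf_mem ⟨_, hmem'⟩)),
    le_antisymm (Nat.sInf_le hmem) (hlow' _ (rc_le_of_mem_rcList (Nat.sInf_mem ⟨_, hmem⟩)))⟩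

theorem IsRainbowConnected.comp_iso (φ : G ≃g H) {K : Type*} {c : H.EdgeLabeling K}
    (hc : IsRainbowConnected H c) :
    IsRainbowConnected G (fun e : G.edgeSet => c (φ.mapEdgeSet e)) := by
  intro a b
  obtain ⟨p, hp, hi⟩ := hc (φ a) (φ b)
  have hpath : (p.map φ.symm.toHom).IsPath :=
    hp.map φ.symm.injective
  refine ⟨(p.map φ.symm.toHom).copy (by simp) (by simp), by simpa using hpath, ?_⟩
  intro x hx y hy hxy
  have key : ∀ e : G.edgeSet, (e : Sym2 V) ∈ ((p.map φ.symm.toHom).copy (by simp) (by simp) :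
      G.Walk a b).edges → ((φ.mapEdgeSet e : H.edgeSet) : Sym2 W) ∈ p.edges := by
    intro e he
    simp only [SimpleGraph.Walk.edges_copy, SimpleGraph.Walk.edges_map, List.mem_map] at he
    obtain ⟨s, hs, hse⟩ := he
    have : ((φ.mapEdgeSet e : H.edgeSet) : Sym2 W) = Sym2.map φ (e : Sym2 V) := rfl
    rw [this, ← hse, Sym2.map_map]
    have hid : (φ ∘ φ.symm.toHom : W → W) = id := by
      funext w
      exact φ.apply_symm_apply w
    rw [hid, Sym2.map_id]
    exact hs
  exact φ.mapEdgeSet.injective (hi (key x hx) (key y hy) hxy)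

theorem rc_congr (φ : G ≃g H) : rc G = rc H := by
  unfold rc
  congr 1
  ext r
  exact ⟨fun h => ⟨h.1, h.2.elim fun c hc => ⟨_, hc.comp_iso φ.symm⟩⟩,
    fun h => ⟨h.1, h.2.elim fun c hc => ⟨_, hc.comp_iso φ⟩⟩⟩

theorem exists_list_coloring_of_iso (φ : G ≃g H) {r : ℕ}
    (h : ∀ L : H.EdgeLabeling (Set ℕ), (∀ e, (r : ℕ∞) ≤ (L e).encard) →
      ∃ c : H.EdgeLabeling ℕ, (∀ e, c e ∈ L e) ∧ IsRainbowConnected H c)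
    (L : G.EdgeLabeling (Set ℕ)) (hL : ∀ e, (r : ℕ∞) ≤ (L e).encard) :
    ∃ c : G.EdgeLabeling ℕ, (∀ e, c e ∈ L e) ∧ IsRainbowConnected G c := by
  obtain ⟨c, hc, hR⟩ := h (fun e => L (φ.mapEdgeSet.symm e)) (fun e => hL _)
  refine ⟨_, fun e => ?_, hR.comp_iso φ⟩
  have := hc (φ.mapEdgeSet e)
  rwa [Equiv.symm_apply_apply] at this

theorem rcList_congr (φ : G ≃g H) : rcList G = rcList H := by
  unfold rcList
  congr 1
  ext r
  exact ⟨fun h => ⟨h.1, exists_list_coloring_of_iso φ.symm h.2⟩,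
    fun h => ⟨h.1, exists_list_coloring_of_iso φ h.2⟩⟩

end Parameters

/-! ### The Petersen graph -/

section Petersen

open MvPolynomial

/-! ### Graph polynomials and the Combinatorial Nullstellensatz -/

/-- The product of the differences `X a - X b` over a list of pairs. -/
noncomputable def graphPolynomial {n : ℕ} (es : List (Fin n × Fin n)) : MvPolynomial (Fin n) ℤ :=
  (es.map fun e => X e.1 - X e.2).prod

theorem coeff_X_mul_equivFun {n : ℕ} (a : Fin n) (m : Fin n → ℕ) (P : MvPolynomial (Fin n) ℤ) :
    coeff (Finsupp.equivFunOnFinite.symm m) (X a * P) =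
      if m a = 0 then 0 else
        coeff (Finsupp.equivFunOnFinite.symm (Function.update m a (m a - 1))) P := by
  rw [coeff_X_mul']
  by_cases h : m a = 0
  · simp [h]
  · rw [if_pos (by simpa using h), if_neg h]
    congr 1
    ext i
    by_cases hi : i = a
    · subst hi; simp
    · simp [hi]

theorem coeff_graphPolynomial_cons {n : ℕ} (a b : Fin n) (es : List (Fin n × Fin n))
    (m : Fin n → ℕ) :
    coeff (Finsupp.equivFunOnFinite.symm m) (graphPolynomial ((a, b) :: es)) =
      (if m a = 0 then 0 else
        coeff (Finsupp.equivFunOnFinite.symm (Function.update m a (m a - 1)))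
          (graphPolynomial es)) -
      (if m b = 0 then 0 else
        coeff (Finsupp.equivFunOnFinite.symm (Function.update m b (m b - 1)))
          (graphPolynomial es)) := by
  rw [← coeff_X_mul_equivFun, ← coeff_X_mul_equivFun, ← coeff_sub, ← sub_mul]
  simp [graphPolynomial]

/-- The degree in `X v` is at most the number of factors containing `X v`. This justifies the
pruning in `graphCode`. -/
theorem coeff_graphPolynomial_eq_zero {n : ℕ} (v : Fin n) (es : List (Fin n × Fin n))
    (m : Fin n → ℕ) (h : (es.countP fun e => e.1 = v ∨ e.2 = v) < m v) :
    coeff (Finsupp.equivFunOnFinite.symm m) (graphPolynomial es) = 0 := by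
  induction es generalizing m with
  | nil =>
    have : (Finsupp.equivFunOnFinite.symm m) ≠ 0 := by
      intro h0
      have := DFunLike.congr_fun h0 v
      simp at this
      omega
    simp [graphPolynomial, coeff_one, this.symm]
  | cons e es ih =>
    obtain ⟨a, b⟩ := e
    rw [coeff_graphPolynomial_cons]
    have key : ∀ c, (c = a ∨ c = b) → (if m c = 0 then (0 : ℤ) else
        coeff (Finsupp.equivFunOnFinite.symm (Function.update m c (m c - 1)))
          (graphPolynomial es)) = 0 := by
      intro c hc
      split_ifs with h0
      · rfl
      · apply ih
        rw [List.countP_cons] at h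
        by_cases hcv : v = c
        · subst hcv
          have : (decide (a = v ∨ b = v)) = true := by
            rcases hc with rfl | rfl <;> simp
          simp only [this, if_true] at h
          simp only [Function.update_self]
          omega
        · rw [Function.update_of_ne hcv]
          omega
    rw [key a (Or.inl rfl), key b (Or.inr rfl), sub_zero]

/-- The digits in base `4` of a natural number, as an exponent vector. -/
def digitVec (n M : ℕ) (i : Fin n) : ℕ := M / 4 ^ (i : ℕ) % 4

/-- Subtracting `4 ^ a` causes no borrow when the digit at `a` is nonzero, so lowering one exponent
is one subtraction on the code. -/
theorem digitVec_sub {n M : ℕ} {a : Fin n} (h : digitVec n M a ≠ 0) :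
    digitVec n (M - 4 ^ (a : ℕ)) = Function.update (digitVec n M) a (digitVec n M a - 1) := by
  funext i
  obtain ⟨a, ha⟩ := a
  obtain ⟨i, hi⟩ := i
  simp only [digitVec] at h
  have hpos : 0 < 4 ^ a := by positivity
  have hM := Nat.div_add_mod M (4 ^ a)
  have hlt := Nat.mod_lt M hpos
  set q := M / 4 ^ a with hq
  set r := M % 4 ^ a
  obtain ⟨q', hq'⟩ : ∃ q', q = q' + 1 :=
    Nat.exists_eq_succ_of_ne_zero fun h0 => h (by rw [h0])
  have hsub : M - 4 ^ a = 4 ^ a * q' + r := by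
    rw [← hM, hq', mul_add, mul_one]
    omega
  rcases lt_trichotomy i a with hia | rfl | hia
  · rw [Function.update_of_ne (by simp [Fin.ext_iff]; omega)]
    simp only [digitVec]
    obtain ⟨k, rfl⟩ : ∃ k, a = i + 1 + k := ⟨a - (i + 1), by omega⟩
    have hle : 4 ^ (i + 1 + k) ≤ M := by
      rw [← hM, hq', mul_add, mul_one]
      omega
    have hp : 0 < 4 ^ i := by positivity
    obtain ⟨N, rfl⟩ : ∃ N, M = N + 4 ^ i * (4 * 4 ^ k) :=
      ⟨M - 4 ^ (i + 1 + k), by rw [← mul_assoc, ← pow_succ, ← pow_add]; omega⟩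
    rw [show 4 ^ (i + 1 + k) = 4 ^ i * (4 * 4 ^ k) by ring, Nat.add_sub_cancel,
      Nat.add_mul_div_left _ _ hp, Nat.add_mul_mod_self_left]
  · simp only [Function.update_self, digitVec]
    rw [← hq, hsub, Nat.mul_add_div hpos, Nat.div_eq_of_lt hlt, add_zero]
    omega
  · rw [Function.update_of_ne (by simp [Fin.ext_iff]; omega)]
    simp only [digitVec]
    obtain ⟨k, rfl⟩ : ∃ k, i = a + 1 + k := ⟨i - (a + 1), by omega⟩
    have hpow : 4 ^ (a + 1 + k) = 4 ^ a * 4 * 4 ^ k := by ring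
    rw [hpow, ← Nat.div_div_eq_div_mul, ← Nat.div_div_eq_div_mul, ← Nat.div_div_eq_div_mul,
      ← Nat.div_div_eq_div_mul, ← hq, hsub, Nat.mul_add_div hpos, Nat.div_eq_of_lt hlt, add_zero]
    congr 2
    omega

/-- One step of `graphCode`. The recursor on the state `M + 1` makes the kernel evaluate it. -/
def graphCodeStep {n : ℕ} (e : (Fin n × Fin n) × ℕ × ℕ) (k : ℕ → ℕ) (N : ℕ) : ℕ :=
  N.rec 0 fun M _ =>
    cond (Nat.ble (M / 4 ^ (e.1.1 : ℕ) % 4) e.2.1)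
      (cond (Nat.ble (M / 4 ^ (e.1.2 : ℕ) % 4) e.2.2)
        ((M / 4 ^ (e.1.1 : ℕ) % 4).rec 0 (fun _ _ => k (M + 1 - 4 ^ (e.1.1 : ℕ))) +
          6 * (M / 4 ^ (e.1.2 : ℕ) % 4).rec 0 (fun _ _ => k (M + 1 - 4 ^ (e.1.2 : ℕ)))) 0) 0

/-- A natural number congruent modulo `7` to the coefficient of `graphPolynomial` at the exponent
vector whose base `4` code is `M`, at the argument `M + 1`. The pairs carry bounds for the
exponents of their two ends beyond which the coefficient vanishes. -/
def graphCode {n : ℕ} (es : List ((Fin n × Fin n) × ℕ × ℕ)) : ℕ → ℕ :=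
  es.foldr graphCodeStep fun _ => 1

/-- The bounds attached to the pairs are at least the numbers of remaining pairs at their ends. -/
def BoundsValid {n : ℕ} : List ((Fin n × Fin n) × ℕ × ℕ) → Prop
  | [] => True
  | e :: es =>
    ((e :: es).map Prod.fst).countP (fun f => f.1 = e.1.1 ∨ f.2 = e.1.1) ≤ e.2.1 ∧
    ((e :: es).map Prod.fst).countP (fun f => f.1 = e.1.2 ∨ f.2 = e.1.2) ≤ e.2.2 ∧
    BoundsValid es

/-- Expanding the first factor `X a - X b` lowers the exponent of one of its ends. The code runs
this recursion in `ℕ`, with `6` in the role of `-1` modulo `7`. The hypothesis on the digit sum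
keeps total exponent and number of factors equal, so that after the last factor only the zero vector
remains, where the value is `1`. -/
theorem graphCode_eq_coeff {n : ℕ} (es : List ((Fin n × Fin n) × ℕ × ℕ)) (hv : BoundsValid es)
    (M : ℕ) (hM : ∑ i, digitVec n M i = es.length) :
    (graphCode es (M + 1) : ZMod 7) =
      (coeff (Finsupp.equivFunOnFinite.symm (digitVec n M)) (graphPolynomial (es.map Prod.fst)) :
        ℤ) := by
  induction es generalizing M with
  | nil =>
    have h0 : (Finsupp.equivFunOnFinite.symm (digitVec n M)) = 0 := by
      ext i
      simpa using Finset.sum_eq_zero_iff.1 hM i (Finset.mem_univ i)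
    simp [graphPolynomial, graphCode, h0]
  | cons e es ih =>
    obtain ⟨⟨a, b⟩, ca, cb⟩ := e
    obtain ⟨ha, hb, hv⟩ := hv
    have hstep : graphCode (((a, b), ca, cb) :: es) (M + 1) =
        cond (Nat.ble (digitVec n M a) ca) (cond (Nat.ble (digitVec n M b) cb)
          ((digitVec n M a).rec 0 (fun _ _ => graphCode es (M + 1 - 4 ^ (a : ℕ))) +
            6 * (digitVec n M b).rec 0 (fun _ _ => graphCode es (M + 1 - 4 ^ (b : ℕ)))) 0) 0 := rfl
    rw [hstep]
    by_cases hca : digitVec n M a ≤ ca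
    swap
    · rw [show Nat.ble (digitVec n M a) ca = false by
        rw [← Bool.not_eq_true, Nat.ble_eq]; exact hca]
      rw [coeff_graphPolynomial_eq_zero a _ _ (by simp only [] at ha; omega)]
      simp
    by_cases hcb : digitVec n M b ≤ cb
    swap
    · rw [show Nat.ble (digitVec n M b) cb = false by
        rw [← Bool.not_eq_true, Nat.ble_eq]; exact hcb]
      rw [coeff_graphPolynomial_eq_zero b _ _ (by simp only [] at hb; omega)]
      simp
    have key : ∀ c : Fin n, ((((digitVec n M c).rec 0
        (fun _ _ => graphCode es (M + 1 - 4 ^ (c : ℕ))) : ℕ) : ℕ) : ZMod 7) =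
        ((if digitVec n M c = 0 then 0 else
          coeff (Finsupp.equivFunOnFinite.symm
            (Function.update (digitVec n M) c (digitVec n M c - 1)))
            (graphPolynomial (es.map Prod.fst)) : ℤ) : ZMod 7) := by
      intro c
      by_cases h0 : digitVec n M c = 0
      · simp [h0]
      · have hle : 4 ^ (c : ℕ) ≤ M := by
          by_contra hlt
          apply h0
          rw [digitVec, Nat.div_eq_of_lt (by omega)]
        rw [if_neg h0, ← digitVec_sub h0]
        obtain ⟨k, hk⟩ := Nat.exists_eq_succ_of_ne_zero h0
        rw [← ih hv]
        -- The state is stored as code plus one; since `4 ^ c ≤ M`, the truncated subtraction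
        -- preserves this offset.
        · rw [hk, show M + 1 - 4 ^ (c : ℕ) = M - 4 ^ (c : ℕ) + 1 by omega]
        · rw [digitVec_sub h0]
          have h1 : digitVec n M c + ∑ i ∈ Finset.univ.erase c, digitVec n M i =
              ∑ i, digitVec n M i := Finset.add_sum_erase _ _ (Finset.mem_univ c)
          rw [← Finset.add_sum_erase Finset.univ _ (Finset.mem_univ c), Function.update_self,
            Finset.sum_congr rfl (g := fun i => digitVec n M i) (fun i hi => Function.update_of_ne
              (Finset.ne_of_mem_erase hi) _ _)]
          simp only [List.length_cons] at hM
          omega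
    rw [Nat.ble_eq_true_of_le hca, Nat.ble_eq_true_of_le hcb, List.map_cons,
      coeff_graphPolynomial_cons, Int.cast_sub, ← key, ← key]
    simp only [cond_true, Nat.cast_add, Nat.cast_mul]
    rw [sub_eq_add_neg]
    congr 1
    rw [show ((6 : ℕ) : ZMod 7) = -1 by decide, neg_one_mul]

theorem totalDegree_graphPolynomial_le {n : ℕ} (es : List (Fin n × Fin n)) :
    (graphPolynomial es).totalDegree ≤ es.length := by
  induction es with
  | nil => simp [graphPolynomial]
  | cons e es ih =>
    have : graphPolynomial (e :: es) = (X e.1 - X e.2) * graphPolynomial es := by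
      simp [graphPolynomial]
    rw [this]
    refine (totalDegree_mul _ _).trans ?_
    have h1 : (X e.1 - X e.2 : MvPolynomial (Fin n) ℤ).totalDegree ≤ 1 := by
      refine (totalDegree_sub _ _).trans ?_
      simp
    simp only [List.length_cons]
    omega

/-- If the coefficient of `∏ i, X i ^ m i` in the graph polynomial does not vanish, then the
graph can be coloured from lists of sizes exceeding the exponents. -/
theorem exists_list_coloring_of_coeff_ne_zero {n : ℕ} (es : List (Fin n × Fin n))
    (m : Fin n → ℕ) (hm : ∑ i, m i = es.length)
    (hc : coeff (Finsupp.equivFunOnFinite.symm m) (graphPolynomial es) ≠ 0)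
    (S : Fin n → Finset ℕ) (hS : ∀ i, m i < (S i).card) :
    ∃ x : Fin n → ℕ, (∀ i, x i ∈ S i) ∧ ∀ e ∈ es, x e.1 ≠ x e.2 := by
  have hdeg : (Finsupp.equivFunOnFinite.symm m).degree = es.length := by
    rw [Finsupp.degree_eq_sum, ← hm]
    simp
  have htot : (graphPolynomial es).totalDegree = (Finsupp.equivFunOnFinite.symm m).degree := by
    apply le_antisymm
    · rw [hdeg]; exact totalDegree_graphPolynomial_le es
    · exact le_totalDegree (by simpa using hc)
  obtain ⟨s, hs, he⟩ := combinatorial_nullstellensatz_exists_eval_nonzero _ _ hc htot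
    (fun i => (S i).map Nat.castEmbedding) (fun i => by simpa using hS i)
  have hx : ∀ i, ∃ k ∈ S i, (k : ℤ) = s i := fun i => by simpa using hs i
  choose x hx hxs using hx
  refine ⟨x, hx, fun e hel heq => he ?_⟩
  rw [graphPolynomial, map_list_prod, List.map_map]
  apply List.prod_eq_zero
  rw [List.mem_map]
  exact ⟨e, hel, by simp [← hxs, heq]⟩

/-! ### The conflict graph on the edges of the Petersen graph -/

/-- The index of an edge of the Petersen graph: outer edges, then spokes, then inner edges. -/
def petersenIndex : ZMod 5 ⊕ ZMod 5 → ZMod 5 ⊕ ZMod 5 → Option (Fin 15)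
  | .inl i, .inl j =>
    if j = i + 1 then some (Fin.castLE (by decide) (i : Fin 5))
    else if i = j + 1 then some (Fin.castLE (by decide) (j : Fin 5)) else none
  | .inl i, .inr j => if i = j then some (Fin.natAdd 5 (Fin.castAdd 5 (i : Fin 5))) else none
  | .inr i, .inl j => if i = j then some (Fin.natAdd 5 (Fin.castAdd 5 (i : Fin 5))) else none
  | .inr i, .inr j =>
    if j = i + 2 then some (Fin.natAdd 10 (i : Fin 5))
    else if i = j + 2 then some (Fin.natAdd 10 (j : Fin 5)) else none

theorem petersenIndex_comm (a b : ZMod 5 ⊕ ZMod 5) : petersenIndex a b = petersenIndex b a := by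
  revert a b; decide +kernel

/-- The edges of the Petersen graph in the order of `petersenIndex`. -/
def petersenEdge (k : Fin 15) : Sym2 (ZMod 5 ⊕ ZMod 5) :=
  let i : ZMod 5 := (k.val : ZMod 5)
  if k.val < 5 then s(.inl i, .inl (i + 1))
  else if k.val < 10 then s(.inl i, .inr i) else s(.inr i, .inr (i + 2))

theorem petersenEdge_of_index (a b : ZMod 5 ⊕ ZMod 5) (k : Fin 15)
    (h : petersenIndex a b = some k) : petersenEdge k = s(a, b) := by
  revert a b k; decide +kernel

theorem petersen_adj_iff (a b : ZMod 5 ⊕ ZMod 5) :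
    petersen.Adj a b ↔ petersenIndex a b ≠ none := by
  rcases a with a | a <;> rcases b with b | b <;>
    simp only [petersen, SimpleGraph.fromRel_adj] <;> revert a b <;> decide

/-- Pairs of edges of the Petersen graph on which a colouring is required to differ, with the
numbers of remaining pairs at both ends. -/
def petersenBounds : List ((Fin 15 × Fin 15) × ℕ × ℕ) :=
  [((1, 6), 3, 3), ((6, 14), 2, 4), ((0, 6), 4, 1), ((1, 2), 2, 3), ((1, 7), 1, 6),
   ((2, 8), 2, 4), ((2, 7), 1, 5), ((9, 14), 5, 3), ((11, 14), 3, 2), ((12, 14), 4, 1),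
   ((8, 11), 3, 2), ((11, 13), 1, 5), ((3, 8), 3, 2), ((8, 13), 1, 4), ((3, 4), 2, 4),
   ((3, 9), 1, 4), ((0, 5), 3, 5), ((0, 4), 2, 3), ((0, 13), 1, 3), ((4, 9), 2, 3),
   ((4, 5), 1, 4), ((5, 13), 3, 2), ((10, 13), 4, 1), ((7, 9), 4, 2), ((9, 12), 1, 3),
   ((5, 7), 2, 3), ((5, 10), 1, 3), ((7, 10), 2, 2), ((7, 12), 1, 2), ((10, 12), 1, 1)]

/-- Pairs of edges of the Petersen graph on which a colouring is required to differ. -/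
def petersenConstraints : List (Fin 15 × Fin 15) := petersenBounds.map Prod.fst

/-- There are 30 conflicts on 15 edges, so the monomial with all exponents 2 has the right degree.
Its coefficient is nonzero modulo 7, and lists of size 3 exceed every exponent. -/
theorem petersen_exists_list_coloring (S : Fin 15 → Finset ℕ) (hS : ∀ i, (S i).card = 3) :
    ∃ x : Fin 15 → ℕ, (∀ i, x i ∈ S i) ∧ ∀ e ∈ petersenConstraints, x e.1 ≠ x e.2 := by
  have hv : BoundsValid petersenBounds := by
    simp only [petersenBounds, BoundsValid, and_true]
    decide +kernel
  -- `715827882 = 2 * (4 ^ 15 - 1) / 3` is the number with fifteen base 4 digits equal to 2.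
  have hd : ∀ i, digitVec 15 715827882 i = 2 := by decide +kernel
  refine exists_list_coloring_of_coeff_ne_zero _ (digitVec 15 715827882) (by simp [hd]; rfl) ?_ S
    fun i => by rw [hd, hS]; decide
  intro h0
  have h := graphCode_eq_coeff petersenBounds hv 715827882 (by simp [hd]; rfl)
  rw [show petersenBounds.map Prod.fst = petersenConstraints from rfl, h0, Int.cast_zero,
    ZMod.natCast_eq_zero_iff, Nat.dvd_iff_mod_eq_zero] at h
  have hne : graphCode petersenBounds 715827883 % 7 ≠ 0 := by decide +kernel
  exact hne h

/-- Whether two edges are required to have different colours. -/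
def petersenApart (o₁ o₂ : Option (Fin 15)) : Prop :=
  ∃ k ∈ o₁, ∃ l ∈ o₂, (k, l) ∈ petersenConstraints ∨ (l, k) ∈ petersenConstraints

instance : DecidableRel petersenApart := fun o₁ o₂ =>
  match o₁, o₂ with
  | some k, some l =>
    decidable_of_iff ((k, l) ∈ petersenConstraints ∨ (l, k) ∈ petersenConstraints)
      (by simp [petersenApart])
  | none, _ => isFalse (by simp [petersenApart])
  | some _, none => isFalse (by simp [petersenApart])

/-- The conflicts were chosen so that this finite check succeeds: every pair of vertices has a path
of length at most 3 whose edges are pairwise in conflict. -/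
theorem petersen_short_path (a b : ZMod 5 ⊕ ZMod 5) :
    a = b ∨ petersenIndex a b ≠ none ∨
    (∃ m, a ≠ b ∧ petersenApart (petersenIndex a m) (petersenIndex m b)) ∨
    (∃ m, m ≠ b ∧ a ≠ b ∧ ∃ n, a ≠ n ∧ petersenApart (petersenIndex a m) (petersenIndex m n) ∧
      petersenApart (petersenIndex m n) (petersenIndex n b) ∧
      petersenApart (petersenIndex a m) (petersenIndex n b)) := by
  revert a b; decide +kernel

theorem petersen_list_coloring (L : Sym2 (ZMod 5 ⊕ ZMod 5) → Finset ℕ)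
    (hL : ∀ s ∈ petersen.edgeSet, (L s).card = 3) :
    ∃ f : Sym2 (ZMod 5 ⊕ ZMod 5) → ℕ, (∀ s ∈ petersen.edgeSet, f s ∈ L s) ∧
      ∀ a b, Joined petersen f a b := by
  have hedge : ∀ k, petersenEdge k ∈ petersen.edgeSet := by
    have : ∀ k, ∃ a b, petersenIndex a b = some k := by decide +kernel
    intro k
    obtain ⟨a, b, h⟩ := this k
    rw [petersenEdge_of_index a b k h, SimpleGraph.mem_edgeSet, petersen_adj_iff, h]
    simp
  obtain ⟨x, hx, hne⟩ := petersen_exists_list_coloring (fun k => L (petersenEdge k))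
    fun k => hL _ (hedge k)
  let f : Sym2 (ZMod 5 ⊕ ZMod 5) → ℕ := Sym2.lift
    ⟨fun a b => (petersenIndex a b).elim 0 x, fun a b => by simp only [petersenIndex_comm a b]⟩
  have hapart : ∀ {a b c d}, petersenApart (petersenIndex a b) (petersenIndex c d) →
      petersen.Adj a b ∧ petersen.Adj c d ∧ f s(a, b) ≠ f s(c, d) := by
    rintro a b c d ⟨k, hk, l, hl, h⟩
    rw [Option.mem_def] at hk hl
    refine ⟨(petersen_adj_iff _ _).2 (by simp [hk]), (petersen_adj_iff _ _).2 (by simp [hl]), ?_⟩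
    simp only [f, Sym2.lift_mk, hk, hl, Option.elim_some]
    rcases h with h | h
    · exact hne _ h
    · exact (hne _ h).symm
  refine ⟨f, fun s => ?_, fun a b => ?_⟩
  · induction s with
    | h a b =>
      intro h
      rw [SimpleGraph.mem_edgeSet, petersen_adj_iff] at h
      obtain ⟨k, hk⟩ := Option.ne_none_iff_exists'.1 h
      rw [← petersenEdge_of_index a b k hk]
      have : f (petersenEdge k) = x k := by
        rw [petersenEdge_of_index a b k hk]
        simp [f, hk]
      rw [this]
      exact hx k
  · rcases petersen_short_path a b with rfl | h | ⟨m, hab, h⟩ | ⟨m, hmb, hab, n, han, h₁, h₂, h₃⟩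
    · exact Joined.refl _ _
    · exact Joined.of_adj _ ((petersen_adj_iff _ _).2 h)
    · obtain ⟨h₁, h₂, h₃⟩ := hapart h
      exact Joined.two h₁ h₂ hab h₃
    · have e₁ := hapart h₁
      have e₂ := hapart h₂
      have e₃ := hapart h₃
      exact Joined.three e₁.1 e₁.2.1 e₂.2.1 han hmb hab (by simp [e₁.2.2, e₂.2.2, e₃.2.2])

/-- This expresses girth 5 around an outer vertex: there are no triangles or 4-cycles through it. -/
theorem petersen_common_neighbor_unique (i : ZMod 5) (a b m : ZMod 5 ⊕ ZMod 5)
    (ha : petersen.Adj (.inl i) a) (hb : petersen.Adj (.inl i) b) (hab : a ≠ b) :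
    ¬ petersen.Adj a b ∧ (petersen.Adj a m → petersen.Adj m b → m = .inl i) := by
  simp only [petersen_adj_iff] at *
  revert i a b m
  decide +kernel

/-- With two colours, rainbow paths have at most two edges. Two neighbours of `inl 0` can then be
joined only through `inl 0`, so the three edges there would need three colours. -/
theorem petersen_not_joined (f : Sym2 (ZMod 5 ⊕ ZMod 5) → Fin 2) :
    ¬ ∀ a b, Joined petersen f a b := by
  intro h
  have hne : ∀ a b, petersen.Adj (.inl 0) a → petersen.Adj (.inl 0) b → a ≠ b →
      f s(a, .inl 0) ≠ f s(.inl 0, b) := by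
    intro a b ha hb hab
    rcases (h a b).exists_short (by simp) with h | h | ⟨m, h₁, h₂, h₃⟩ | ⟨h, -⟩
    · exact absurd h hab
    · exact absurd h (petersen_common_neighbor_unique 0 a b a ha hb hab).1
    · obtain rfl := (petersen_common_neighbor_unique 0 a b m ha hb hab).2 h₁ h₂
      exact h₃
    · simp at h
  have hadj : ∀ c ∈ [(.inl 1 : ZMod 5 ⊕ ZMod 5), .inl 4, .inr 0], petersen.Adj (.inl 0) c := by
    simp only [petersen_adj_iff]
    decide
  have h₁ := hne (.inl 1) (.inl 4) (hadj _ (by simp)) (hadj _ (by simp)) (by decide)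
  have h₂ := hne (.inl 1) (.inr 0) (hadj _ (by simp)) (hadj _ (by simp)) (by decide)
  have h₃ := hne (.inl 4) (.inr 0) (hadj _ (by simp)) (hadj _ (by simp)) (by decide)
  rw [Sym2.eq_swap] at h₁ h₂ h₃
  have e₁ : s((.inl 4 : ZMod 5 ⊕ ZMod 5), .inl 0) = s(.inl 0, .inl 4) := Sym2.eq_swap
  rw [e₁] at *
  omega

theorem petersen_values : rc petersen = 3 ∧ rcList petersen = 3 :=
  rc_eq_and_rcList_eq petersen_not_joined petersen_list_coloring

end Petersen

/-! ### Hub graphs -/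

/-- The vertices of a hub graph: a hub, a rim indexed by `P`, and middle vertices indexed by
`ι`. -/
inductive HubVertex (ι P : Type*) : Type _
  | mid (i : ι)
  | rim (p : P)
  | hub

open HubVertex

/-- The hub graph of `π : ι → P`: the rim is complete and the middle vertex `i` is joined to the hub
and to the rim vertex `π i`. -/
def hubGraph {ι P : Type*} (π : ι → P) : SimpleGraph (HubVertex ι P) :=
  SimpleGraph.fromRel fun
    | .mid _, .hub => True
    | .mid i, .rim p => π i = p
    | .rim _, .rim _ => True
    | _, _ => False

section HubGraph

variable {ι P K : Type*} {π : ι → P}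

@[simp] theorem hubGraph_mid_hub (i : ι) : (hubGraph π).Adj (mid i) hub := by simp [hubGraph]

@[simp] theorem hubGraph_hub_mid (i : ι) : (hubGraph π).Adj hub (mid i) := by simp [hubGraph]

@[simp] theorem hubGraph_mid_rim (i : ι) (p : P) :
    (hubGraph π).Adj (mid i) (rim p) ↔ π i = p := by simp [hubGraph]

@[simp] theorem hubGraph_rim_mid (i : ι) (p : P) :
    (hubGraph π).Adj (rim p) (mid i) ↔ π i = p := by simp [hubGraph]

@[simp] theorem hubGraph_rim_rim (p q : P) : (hubGraph π).Adj (rim p) (rim q) ↔ p ≠ q := by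
  simp [hubGraph]

@[simp] theorem hubGraph_mid_mid (i j : ι) : ¬ (hubGraph π).Adj (mid i) (mid j) := by
  simp [hubGraph]

@[simp] theorem hubGraph_hub_rim (p : P) : ¬ (hubGraph π).Adj hub (rim p) := by simp [hubGraph]

@[simp] theorem hubGraph_rim_hub (p : P) : ¬ (hubGraph π).Adj (rim p) hub := by simp [hubGraph]

/-- The colouring of the edges of a hub graph given by the colours `top i` and `bot i` of the edges
from the middle vertex `i` to the hub and to the rim, and the colours `e` of the rim. -/
def hubColor (top bot : ι → ℕ) (e : Sym2 P → ℕ) : Sym2 (HubVertex ι P) → ℕ :=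
  Sym2.lift ⟨fun
    | .mid i, .hub => top i
    | .hub, .mid i => top i
    | .mid i, .rim _ => bot i
    | .rim _, .mid i => bot i
    | .rim p, .rim q => e s(p, q)
    | _, _ => 0, by rintro (i | p | _) (j | q | _) <;> simp [Sym2.eq_swap]⟩

@[simp] theorem hubColor_mid_hub (top bot : ι → ℕ) (e : Sym2 P → ℕ) (i : ι) :
    hubColor top bot e s(mid i, hub) = top i := rfl

@[simp] theorem hubColor_hub_mid (top bot : ι → ℕ) (e : Sym2 P → ℕ) (i : ι) :
    hubColor top bot e s(hub, mid i) = top i := rfl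

@[simp] theorem hubColor_mid_rim (top bot : ι → ℕ) (e : Sym2 P → ℕ) (i : ι) (p : P) :
    hubColor top bot e s(mid i, rim p) = bot i := rfl

@[simp] theorem hubColor_rim_mid (top bot : ι → ℕ) (e : Sym2 P → ℕ) (i : ι) (p : P) :
    hubColor top bot e s(rim p, mid i) = bot i := rfl

@[simp] theorem hubColor_rim_rim (top bot : ι → ℕ) (e : Sym2 P → ℕ) (p q : P) :
    hubColor top bot e s(rim p, rim q) = e s(p, q) := rfl

/-- Reduction of list colourings of a hub graph to colours of middle vertices and of the rim. -/
theorem hub_exists_list_coloring {r : ℕ}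
    (h : ∀ (A B : ι → Finset ℕ) (E : Sym2 P → Finset ℕ), (∀ i, (A i).card = r) →
      (∀ i, (B i).card = r) → (∀ p q, p ≠ q → (E s(p, q)).card = r) →
      ∃ (top bot : ι → ℕ) (e : Sym2 P → ℕ), (∀ i, top i ∈ A i) ∧ (∀ i, bot i ∈ B i) ∧
        (∀ p q, p ≠ q → e s(p, q) ∈ E s(p, q)) ∧
        ∀ a b, Joined (hubGraph π) (hubColor top bot e) a b)
    (L : Sym2 (HubVertex ι P) → Finset ℕ) (hL : ∀ s ∈ (hubGraph π).edgeSet, (L s).card = r) :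
    ∃ f : Sym2 (HubVertex ι P) → ℕ, (∀ s ∈ (hubGraph π).edgeSet, f s ∈ L s) ∧
      ∀ a b, Joined (hubGraph π) f a b := by
  obtain ⟨top, bot, e, htop, hbot, he, hJ⟩ := h (fun i => L s(mid i, hub))
    (fun i => L s(mid i, rim (π i))) (fun s => L (s.map rim))
    (fun i => hL _ (by simp)) (fun i => hL _ (by simp))
    (fun p q hpq => hL _ (by simpa using hpq))
  refine ⟨hubColor top bot e, fun s => ?_, hJ⟩
  induction s with
  | h a b =>
    intro hs
    rcases a with i | p | _ <;> rcases b with j | q | _ <;>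
      simp only [SimpleGraph.mem_edgeSet, hubGraph_mid_hub, hubGraph_hub_mid, hubGraph_mid_rim,
        hubGraph_rim_mid, hubGraph_rim_rim, hubGraph_mid_mid, hubGraph_hub_rim, hubGraph_rim_hub,
        SimpleGraph.irrefl] at hs
    · subst hs; exact hbot i
    · exact htop i
    · subst hs; rw [Sym2.eq_swap]; exact hbot j
    · exact he p q hs
    · rw [Sym2.eq_swap]; exact htop j

/-- Two middle vertices of the same top colour are joined by a short rainbow path. -/
def Compat (π : ι → P) (e : Sym2 P → ℕ) (bot : ι → ℕ) (i j : ι) : Prop :=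
  bot i ≠ bot j ∧ (π i ≠ π j → bot i ≠ e s(π i, π j) ∧ bot j ≠ e s(π i, π j))

/-- A sufficient condition for rainbow connectedness of a hub graph, with paths of length at
most 3. -/
theorem hub_joined (hπ : Function.Surjective π) {top bot : ι → ℕ} {e : Sym2 P → ℕ}
    (hmm : ∀ i j, i ≠ j → top i = top j → Compat π e bot i j)
    (hmr : ∀ i p, π i ≠ p → bot i ≠ e s(π i, p) ∨
      (∃ q, q ≠ π i ∧ q ≠ p ∧ [bot i, e s(π i, q), e s(q, p)].Nodup) ∨
      ∃ j, π j = p ∧ [top i, top j, bot j].Nodup)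
    (hsing : ∀ i, top i = bot i → ∃ j, j ≠ i ∧ top j = top i) (a b : HubVertex ι P) :
    Joined (hubGraph π) (hubColor top bot e) a b := by
  have mm : ∀ i j, Joined (hubGraph π) (hubColor top bot e) (mid i) (mid j) := by
    intro i j
    by_cases hij : i = j
    · subst hij; exact Joined.refl _ _
    by_cases ht : top i = top j
    · obtain ⟨hb, he⟩ := hmm i j hij ht
      by_cases hp : π i = π j
      · exact Joined.two (m := rim (π i)) (by simp) (by simp [hp]) (by simpa using hij)
          (by simpa using hb)
      · obtain ⟨h1, h2⟩ := he hp
        exact Joined.three (m := rim (π i)) (n := rim (π j)) (by simp) (by simpa using hp)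
          (by simp) (by simp) (by simp) (by simpa using hij) (by simp [hb, h1, h2.symm])
    · exact Joined.two (m := hub) (by simp) (by simp) (by simpa using hij) (by simpa using ht)
  have mr : ∀ i p, Joined (hubGraph π) (hubColor top bot e) (mid i) (rim p) := by
    intro i p
    by_cases hp : π i = p
    · exact Joined.of_adj _ (by simpa using hp)
    rcases hmr i p hp with h | ⟨q, hq1, hq2, h⟩ | ⟨j, hj, h⟩
    · exact Joined.two (m := rim (π i)) (by simp) (by simpa using hp) (by simp) (by simpa using h)
    · exact Joined.three (m := rim (π i)) (n := rim q) (by simp) (by simpa using hq1.symm)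
        (by simpa using hq2) (by simp) (by simpa using hp) (by simp) (by simpa using h)
    · have hij : i ≠ j := by rintro rfl; exact hp hj
      exact Joined.three (m := hub) (n := mid j) (by simp) (by simp)
        (by simpa using hj) (by simpa using hij) (by simp) (by simp) (by simpa using h)
  have hr : ∀ p, Joined (hubGraph π) (hubColor top bot e) hub (rim p) := by
    intro p
    obtain ⟨i, rfl⟩ := hπ p
    -- If the two edges at `i` agree in colour, the detour uses a vertex `j` with the same colour at
    -- the hub: compatibility of `i` and `j` keeps the colour `top j = bot i` off the rest of the
    -- path from `j` to the rim vertex of `i`.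
    by_cases hi : top i = bot i
    · obtain ⟨j, hji, hjt⟩ := hsing i hi
      obtain ⟨hb, he⟩ := hmm j i hji hjt
      by_cases hp : π j = π i
      · refine Joined.two (m := mid j) (by simp) (by simpa using hp) (by simp) ?_
        simp only [hubColor_hub_mid, hubColor_mid_rim]
        rw [hjt, hi]; exact hb.symm
      · obtain ⟨h1, h2⟩ := he hp
        refine Joined.three (m := mid j) (n := rim (π j)) (by simp) (by simp)
          (by simpa using hp) (by simp) (by simp) (by simp) ?_
        simp [hjt, hi, hb.symm, h1, h2]
    · exact Joined.two (m := mid i) (by simp) (by simp) (by simp) (by simpa using hi)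
  rcases a with i | p | _ <;> rcases b with j | q | _
  · exact mm i j
  · exact mr i q
  · exact Joined.of_adj _ (by simp)
  · exact (mr j p).symm
  · by_cases hpq : p = q
    · subst hpq; exact Joined.refl _ _
    · exact Joined.of_adj _ (by simpa using hpq)
  · exact (hr p).symm
  · exact Joined.of_adj _ (by simp)
  · exact hr q
  · exact Joined.refl _ _

/-! ### Lists of four colours -/

theorem exists_mem_notMem_of_card_lt {S : Finset ℕ} {l : List ℕ} (h : l.length < S.card) :
    ∃ x ∈ S, x ∉ l := by
  have : l.toFinset.card < S.card := (List.toFinset_card_le l).trans_lt h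
  obtain ⟨x, hx, hxl⟩ := Finset.exists_mem_notMem_of_card_lt_card this
  exact ⟨x, hx, by simpa using hxl⟩

/-- Every part `p` has a special middle vertex `s p`; its colours `α p`, `β p` are avoided by the
other middle vertices of the part. -/
theorem hub_joined_of_special [DecidableEq ι] {top bot : ι → ℕ} {e : Sym2 P → ℕ} (s : P → ι)
    (hs : ∀ p, π (s p) = p)
    (htop : ∀ i, s (π i) ≠ i → top i ≠ top (s (π i)) ∧ top i ≠ bot (s (π i)))
    (hbot : ∀ i, s (π i) ≠ i → bot i ≠ top (s (π i)) ∧ bot i ≠ bot (s (π i)))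
    (hne : ∀ i, top i ≠ bot i) (hα : ∀ p q, p ≠ q → top (s p) ≠ top (s q))
    (hβ : ∀ p q, p ≠ q → bot (s p) ≠ e s(p, q)) (a b : HubVertex ι P) :
    Joined (hubGraph π) (hubColor top bot e) a b := by
  have far : ∀ i j, i ≠ j → s (π i) ≠ i → top i = top j → bot i ≠ top j → s (π i) ≠ j →
      Joined (hubGraph π) (hubColor top bot e) (mid i) (mid j) := by
    intro i j hij hi ht hb hsj
    -- The detour from `i` descends to the rim, climbs through the special vertex of its part and
    -- leaves the hub towards `j`. The special colours are avoided by both edges at `i`, hence also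
    -- by the edge at `j`, which has the hub colour of `i`.
    refine Joined.four (m := rim (π i)) (n := mid (s (π i))) (o := hub) (by simp) (by simp [hs])
      (by simp) (by simp) (by simp [hij, hi.symm, hsj]) ?_
    have h1 := htop i hi
    have h2 := hbot i hi
    simp only [hubColor_mid_rim, hubColor_rim_mid, hubColor_mid_hub, hubColor_hub_mid,
      List.nodup_cons, List.mem_cons, List.not_mem_nil, or_false, not_or, not_false_eq_true,
      List.nodup_nil, and_true]
    exact ⟨⟨h2.2, h2.1, hb⟩, ⟨(hne _).symm, ht ▸ h1.2.symm⟩, ht ▸ h1.1.symm⟩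
  have mm : ∀ i j, Joined (hubGraph π) (hubColor top bot e) (mid i) (mid j) := by
    intro i j
    by_cases hij : i = j
    · subst hij; exact Joined.refl _ _
    by_cases ht : top i = top j
    · by_cases hi : s (π i) = i
      · by_cases hj : s (π j) = j
        · by_cases hp : π i = π j
          · exact absurd (hi.symm.trans ((congrArg s hp).trans hj)) hij
          · have := hα _ _ hp
            rw [hi, hj] at this
            exact absurd ht this
        · refine (far j i (Ne.symm hij) hj ht.symm (ht ▸ (hne j).symm) fun h => ?_).symm
          have := (htop j hj).1
          rw [h] at this
          exact this ht.symm
      · refine far i j hij hi ht (ht ▸ (hne i).symm) fun h => ?_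
        have := (htop i hi).1
        rw [h] at this
        exact this ht
    · exact Joined.two (m := hub) (by simp) (by simp) (by simpa using hij) (by simpa using ht)
  have mr : ∀ i p, Joined (hubGraph π) (hubColor top bot e) (mid i) (rim p) := by
    intro i p
    by_cases hp : π i = p
    · exact Joined.of_adj _ (by simpa using hp)
    by_cases hb : bot i = e s(π i, p)
    · by_cases hi : s (π i) = i
      · have := hβ _ _ hp
        rw [hi] at this
        exact absurd hb this
      · refine Joined.four (m := hub) (n := mid (s (π i))) (o := rim (π i)) (by simp) (by simp)
          (by simp [hs]) (by simpa using hp) (by simp [hp, Ne.symm hi]) ?_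
        have h1 := htop i hi
        have h2 := hbot i hi
        simp only [hubColor_mid_rim, hubColor_rim_rim, hubColor_mid_hub, hubColor_hub_mid,
          List.nodup_cons, List.mem_cons, List.not_mem_nil, or_false, not_or, not_false_eq_true,
          List.nodup_nil, and_true]
        rw [← hb]
        exact ⟨⟨h1.1, h1.2, hne i⟩, ⟨hne _, h2.1.symm⟩, h2.2.symm⟩
    · exact Joined.two (m := rim (π i)) (by simp) (by simpa using hp) (by simp) (by simpa using hb)
  have hr : ∀ p, Joined (hubGraph π) (hubColor top bot e) hub (rim p) := fun p =>
    Joined.two (m := mid (s p)) (by simp) (by simp [hs]) (by simp) (by simpa using hne _)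
  rcases a with i | p | _ <;> rcases b with j | q | _
  · exact mm i j
  · exact mr i q
  · exact Joined.of_adj _ (by simp)
  · exact (mr j p).symm
  · by_cases hpq : p = q
    · subst hpq; exact Joined.refl _ _
    · exact Joined.of_adj _ (by simpa using hpq)
  · exact (hr p).symm
  · exact Joined.of_adj _ (by simp)
  · exact hr q
  · exact Joined.refl _ _

/-- Greedy choice from lists: colours for `Fin k`-indexed lists of more than `k` colours that are
pairwise distinct and avoid one prescribed colour each. -/
theorem exists_injective_avoiding {k : ℕ} (S : Fin k → Finset ℕ) (hS : ∀ i, k < (S i).card)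
    (x : Fin k → ℕ) :
    ∃ y : Fin k → ℕ, Function.Injective y ∧ ∀ i, y i ∈ S i ∧ y i ≠ x i := by
  have hall : ∀ s : Finset (Fin k), s.card ≤ (s.biUnion fun i => (S i).erase (x i)).card := by
    intro s
    rcases s.eq_empty_or_nonempty with rfl | ⟨i, hi⟩
    · simp
    · calc s.card ≤ k := by simpa using s.card_le_univ
        _ ≤ ((S i).erase (x i)).card := by
          have := Finset.pred_card_le_card_erase (s := S i) (a := x i)
          have := hS i
          omega
        _ ≤ _ := Finset.card_le_card (Finset.subset_biUnion_of_mem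
          (fun i => (S i).erase (x i)) hi)
  obtain ⟨y, hy, hyS⟩ := (Finset.all_card_le_biUnion_card_iff_exists_injective _).1 hall
  exact ⟨y, hy, fun i => ⟨Finset.mem_of_mem_erase (hyS i), Finset.ne_of_mem_erase (hyS i)⟩⟩

/-- The choice is greedy: rim colours, then `β` avoiding at most three rim colours, then distinct
`α` avoiding `β`. The other middle vertices avoid two colours at the hub and three at the rim; four
colours are always enough. -/
theorem hub_four_list_coloring {k : ℕ} (hk : k ≤ 3) {π : ι → Fin k} (hπ : Function.Surjective π)
    (A B : ι → Finset ℕ) (E : Sym2 (Fin k) → Finset ℕ) (hA : ∀ i, (A i).card = 4)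
    (hB : ∀ i, (B i).card = 4) (hE : ∀ p q, p ≠ q → (E s(p, q)).card = 4) :
    ∃ (top bot : ι → ℕ) (e : Sym2 (Fin k) → ℕ), (∀ i, top i ∈ A i) ∧ (∀ i, bot i ∈ B i) ∧
      (∀ p q, p ≠ q → e s(p, q) ∈ E s(p, q)) ∧
      ∀ a b, Joined (hubGraph π) (hubColor top bot e) a b := by
  classical
  obtain ⟨s, hs⟩ := hπ.hasRightInverse
  -- Nothing is known about the lists of diagonal pairs, which are not edges, so they may be empty
  -- and receive the default `0`.
  have hE' : ∀ t : Sym2 (Fin k), ∃ c, (E t).Nonempty → c ∈ E t := fun t => by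
    by_cases h : (E t).Nonempty
    · exact ⟨h.choose, fun _ => h.choose_spec⟩
    · exact ⟨0, fun h' => absurd h' h⟩
  choose e he using hE'
  have hβ : ∀ p, ∃ c ∈ B (s p), c ∉ (List.finRange k).map fun q => e s(p, q) := fun p =>
    exists_mem_notMem_of_card_lt (by simp [hB]; omega)
  choose β hβB hβe using hβ
  obtain ⟨α, hα, hαA⟩ := exists_injective_avoiding (fun p => A (s p)) (fun p => by
    simp only [hA]; omega) β
  have htop : ∀ i, ∃ c ∈ A i, c ∉ [α (π i), β (π i)] := fun i =>
    exists_mem_notMem_of_card_lt (by simp [hA])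
  choose t htA ht using htop
  have hbot : ∀ i, ∃ c ∈ B i, c ∉ [α (π i), β (π i), t i] := fun i =>
    exists_mem_notMem_of_card_lt (by simp [hB])
  choose b hbB hb using hbot
  simp only [List.mem_cons, List.not_mem_nil, or_false, not_or] at ht hb
  refine ⟨fun i => if s (π i) = i then α (π i) else t i,
    fun i => if s (π i) = i then β (π i) else b i, e, fun i => ?_, fun i => ?_, fun p q hpq => ?_,
    hub_joined_of_special s hs (fun i hi => ?_) (fun i hi => ?_) (fun i => ?_)
      (fun p q hpq => ?_) (fun p q hpq => ?_)⟩
  · beta_reduce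
    split_ifs with h
    · have := (hαA (π i)).1; rwa [h] at this
    · exact htA i
  · beta_reduce
    split_ifs with h
    · have := hβB (π i); rwa [h] at this
    · exact hbB i
  · exact he _ (Finset.card_pos.1 (by rw [hE p q hpq]; decide))
  · have := hs (π i)
    simp only [hi, this, if_true, if_false]
    exact ht i
  · have := hs (π i)
    simp only [hi, this, if_true, if_false]
    exact ⟨(hb i).1, (hb i).2.1⟩
  · split_ifs with h
    · exact (hαA _).2
    · exact Ne.symm (hb i).2.2
  · simp only [hs p, hs q, if_true]
    exact fun h => hpq (hα h)
  · simp only [hs p, if_true]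
    intro h
    exact hβe p (List.mem_map.2 ⟨q, by simp, h.symm⟩)

end HubGraph

/-! ### Lower bounds for hub graphs -/

section LowerBounds

variable {ι P K : Type*} {π : ι → P} [Fintype K]

/-- A path of length at most 3 between two middle vertices that passes through the hub is the path
of length 2 over it, which is not rainbow if the top colours agree. So the path runs along the rim,
and crossing between parts uses three colours. -/
theorem Joined.compat {f : Sym2 (HubVertex ι P) → K} (hK : Fintype.card K ≤ 3) {i j : ι}
    (hij : i ≠ j) (ht : f s(mid i, hub) = f s(mid j, hub))
    (h : Joined (hubGraph π) f (mid i) (mid j)) :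
    f s(mid i, rim (π i)) ≠ f s(mid j, rim (π j)) ∧ (π i ≠ π j → 3 ≤ Fintype.card K ∧
      f s(mid i, rim (π i)) ≠ f s(rim (π i), rim (π j)) ∧
      f s(mid j, rim (π j)) ≠ f s(rim (π i), rim (π j))) := by
  rcases h.exists_short hK with h | h | ⟨m, h₁, h₂, h₃⟩ | ⟨hc, m, n, h₁, h₂, h₃, han, hmb, f₁, f₂, f₃⟩
  · exact absurd (by simpa using h) hij
  · simp at h
  · rcases m with l | p | _
    · simp at h₁
    · simp only [hubGraph_mid_rim, hubGraph_rim_mid] at h₁ h₂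
      subst h₁
      rw [Sym2.eq_swap (a := rim (π i)) (b := mid j)] at h₃
      rw [h₂]
      exact ⟨h₃, fun h => absurd rfl h⟩
    · rw [Sym2.eq_swap (a := hub) (b := mid j)] at h₃
      exact absurd ht h₃
  · rcases m with l | p | _
    · simp at h₁
    · rcases n with l | q | _
      · simp at h₃
      · simp only [hubGraph_mid_rim, hubGraph_rim_mid] at h₁ h₃
        subst h₁ h₃
        rw [Sym2.eq_swap (a := rim (π j)) (b := mid j)] at f₂ f₃
        exact ⟨f₂, fun _ => ⟨hc, f₁, f₃.symm⟩⟩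
      · simp at h₂
    · rcases n with l | q | _ <;> simp at h₂ h₃

/-- The alternative with a third rim vertex records no colours. The lemma is applied only to two
parts, where there is no third rim vertex. -/
theorem Joined.mid_rim {f : Sym2 (HubVertex ι P) → K} (hK : Fintype.card K ≤ 3) {i : ι} {p : P}
    (hp : π i ≠ p) (h : Joined (hubGraph π) f (mid i) (rim p)) :
    f s(mid i, rim (π i)) ≠ f s(rim (π i), rim p) ∨ (3 ≤ Fintype.card K ∧
      ((∃ q, q ≠ π i ∧ q ≠ p) ∨ ∃ j, π j = p ∧ f s(mid i, hub) ≠ f s(mid j, hub) ∧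
        f s(mid i, hub) ≠ f s(mid j, rim p) ∧ f s(mid j, hub) ≠ f s(mid j, rim p))) := by
  rcases h.exists_short hK with h | h | ⟨m, h₁, h₂, h₃⟩ | ⟨hc, m, n, h₁, h₂, h₃, han, hmb, f₁, f₂, f₃⟩
  · simp at h
  · exact absurd (by simpa using h) hp
  · rcases m with l | q | _
    · simp at h₁
    · simp only [hubGraph_mid_rim] at h₁
      subst h₁
      exact Or.inl h₃
    · simp at h₂
  · refine Or.inr ⟨hc, ?_⟩
    rcases m with l | q | _
    · simp at h₁
    · simp only [hubGraph_mid_rim] at h₁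
      subst h₁
      rcases n with l | r | _
      · simp only [hubGraph_rim_mid, hubGraph_mid_rim] at h₂ h₃
        exact absurd (h₂.symm.trans h₃) hp
      · simp only [hubGraph_rim_rim] at h₂ h₃
        exact Or.inl ⟨r, h₂.symm, h₃⟩
      · simp at h₂
    · rcases n with l | r | _
      · simp only [hubGraph_mid_rim] at h₃
        rw [Sym2.eq_swap (a := hub) (b := mid l)] at f₁ f₃
        exact Or.inr ⟨l, h₃, f₁, f₂, f₃⟩
      · simp at h₂
      · simp at h₃

theorem Joined.hub_rim {f : Sym2 (HubVertex ι P) → K} (hK : Fintype.card K ≤ 2) {p : P}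
    (h : Joined (hubGraph π) f hub (rim p)) :
    ∃ i, π i = p ∧ f s(mid i, hub) ≠ f s(mid i, rim p) := by
  rcases h.exists_short (by omega) with h | h | ⟨m, h₁, h₂, h₃⟩ | ⟨hc, -⟩
  · simp at h
  · simp at h
  · rcases m with l | q | _
    · rw [Sym2.eq_swap (a := hub) (b := mid l)] at h₃
      exact ⟨l, by simpa using h₂, h₃⟩
    · simp at h₁
    · simp at h₂
  · omega

/-- Choose in each part a middle vertex whose two edges differ in colour. Both rim ends must avoid
the colour of the rim edge, so they agree; then the hub ends agree as well, which two vertices of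
different parts cannot afford with two colours. -/
theorem hub_two_not_joined_two {π : ι → Fin 2} (f : Sym2 (HubVertex ι (Fin 2)) → Fin 2) :
    ¬ ∀ a b, Joined (hubGraph π) f a b := by
  intro h
  obtain ⟨i, hi, hi'⟩ := (h hub (rim 0)).hub_rim (by simp)
  obtain ⟨j, hj, hj'⟩ := (h hub (rim 1)).hub_rim (by simp)
  have hp : π i ≠ π j := by rw [hi, hj]; decide
  have hij : i ≠ j := fun h => hp (congrArg π h)
  have ht : f s(mid i, hub) ≠ f s(mid j, hub) := fun ht => by
    simpa using (((h (mid i) (mid j)).compat (by simp) hij ht).2 hp).1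
  have hbi : f s(mid i, rim 0) ≠ f s(rim 0, rim 1) := by
    rcases (h (mid i) (rim 1)).mid_rim (by simp) (by rw [hi]; decide) with h | ⟨h, -⟩
    · rwa [hi] at h
    · simp at h
  have hbj : f s(mid j, rim 1) ≠ f s(rim 0, rim 1) := by
    rcases (h (mid j) (rim 0)).mid_rim (by simp) (by rw [hj]; decide) with h | ⟨h, -⟩
    · rwa [hj, Sym2.eq_swap (a := rim 1) (b := rim 0)] at h
    · simp at h
  omega

/-- Middle vertices of different parts need different colours at the hub, and there are three parts.
-/
theorem hub_three_not_joined_two {π : ι → Fin 3} (hπ : Function.Surjective π)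
    (f : Sym2 (HubVertex ι (Fin 3)) → Fin 2) : ¬ ∀ a b, Joined (hubGraph π) f a b := by
  intro h
  obtain ⟨s, hs⟩ := hπ.hasRightInverse
  have ht : ∀ p q, p ≠ q → f s(mid (s p), hub) ≠ f s(mid (s q), hub) := fun p q hpq ht => by
    have hp : π (s p) ≠ π (s q) := by rwa [hs, hs]
    have hij : s p ≠ s q := fun h => hp (congrArg π h)
    simpa using (((h (mid (s p)) (mid (s q))).compat (by simp) hij ht).2 hp).1
  have h01 := ht 0 1 (by decide)
  have h02 := ht 0 2 (by decide)
  have h12 := ht 1 2 (by decide)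
  omega

/-- Two middle vertices with equal colours at both ends would violate `Joined.compat`. This is the
source of the bound nine. -/
theorem hub_injective_of_joined (f : Sym2 (HubVertex ι P) → Fin 3)
    (h : ∀ a b, Joined (hubGraph π) f a b) :
    Function.Injective fun i => (f s(mid i, hub), f s(mid i, rim (π i))) := by
  intro i j hij
  by_contra hne
  simp only [Prod.mk.injEq] at hij
  exact ((h (mid i) (mid j)).compat (by simp) hne hij.1).1 hij.2

theorem hub_card_le_nine [Fintype ι] (f : Sym2 (HubVertex ι P) → Fin 3)
    (h : ∀ a b, Joined (hubGraph π) f a b) : Fintype.card ι ≤ 9 := by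
  simpa using Fintype.card_le_of_injective _ (hub_injective_of_joined f h)

theorem card_fiber_eq_sum [Fintype ι] [DecidableEq P] (φ : Fin 3 × Fin 3 ≃ ι) (p : P) :
    (Finset.univ.filter fun i => π i = p).card =
      ∑ t, (Finset.univ.filter fun b => π (φ (t, b)) = p).card := by
  simp only [Finset.card_filter]
  rw [← Fintype.sum_prod_type' (f := fun t b => if π (φ (t, b)) = p then 1 else 0)]
  exact (Equiv.sum_comp φ fun i => if π i = p then 1 else 0).symm

/-- If all nine pairs of colours occur, the parts are balanced modulo 3. -/
theorem hub_exists_equiv_of_card_eq_nine [Fintype ι] (f : Sym2 (HubVertex ι P) → Fin 3)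
    (h : ∀ a b, Joined (hubGraph π) f a b) (hn : Fintype.card ι = 9) :
    ∃ φ : Fin 3 × Fin 3 ≃ ι, ∀ t b b', π (φ (t, b)) ≠ π (φ (t, b')) →
      b ≠ f s(rim (π (φ (t, b))), rim (π (φ (t, b')))) ∧
      b' ≠ f s(rim (π (φ (t, b))), rim (π (φ (t, b')))) := by
  have hbij := (Fintype.bijective_iff_injective_and_card _).2
    ⟨hub_injective_of_joined f h, by simpa using hn⟩
  let φ := (Equiv.ofBijective _ hbij).symm
  have hφ : ∀ t b, f s(mid (φ (t, b)), hub) = t ∧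
      f s(mid (φ (t, b)), rim (π (φ (t, b)))) = b := fun t b => by
    have := (Equiv.ofBijective _ hbij).apply_symm_apply (t, b)
    exact ⟨congrArg Prod.fst this, congrArg Prod.snd this⟩
  refine ⟨φ, fun t b b' hne => ?_⟩
  have hij : φ (t, b) ≠ φ (t, b') := fun h => hne (congrArg π h)
  have := ((h (mid (φ (t, b))) (mid (φ (t, b')))).compat (by simp) hij
    ((hφ t b).1.trans (hφ t b').1.symm)).2 hne
  rw [(hφ t b).2, (hφ t b').2] at this
  exact this.2

/-- Each hub colour occurs with all three rim colours, including that of the rim edge. A class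
meeting both parts could not contain that colour, so each class contributes 0 or 3 to a part. -/
theorem hub_two_card_fiber_mod_three [Fintype ι] {π : ι → Fin 2}
    (f : Sym2 (HubVertex ι (Fin 2)) → Fin 3)
    (h : ∀ a b, Joined (hubGraph π) f a b) (hn : Fintype.card ι = 9) :
    (Finset.univ.filter fun i => π i = 0).card % 3 = 0 := by
  obtain ⟨φ, hφ⟩ := hub_exists_equiv_of_card_eq_nine f h hn
  have key : ∀ (r : Fin 3 → Fin 2) (e : Fin 3), (∀ b b', r b = 0 → r b' = 1 → b ≠ e ∧ b' ≠ e) →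
      (Finset.univ.filter fun b => r b = 0).card % 3 = 0 := by decide
  rw [card_fiber_eq_sum φ, Fin.sum_univ_three]
  have := fun t => key (fun b => π (φ (t, b))) (f s(rim 0, rim 1)) fun b b' hb hb' => by
    have := hφ t b b' (by rw [hb, hb']; decide)
    rwa [hb, hb'] at this
  have h0 := this 0
  have h1 := this 1
  have h2 := this 2
  omega

/-- A class of three showing all rim colours cannot meet exactly two parts. Its distribution is
therefore `(1, 1, 1)` or a permutation of `(3, 0, 0)`, and the contributions to any two parts agree
modulo 3. -/
theorem hub_three_card_fiber_mod_three [Fintype ι] {π : ι → Fin 3}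
    (f : Sym2 (HubVertex ι (Fin 3)) → Fin 3)
    (h : ∀ a b, Joined (hubGraph π) f a b) (hn : Fintype.card ι = 9) :
    (Finset.univ.filter fun i => π i = 0).card % 3 =
      (Finset.univ.filter fun i => π i = 1).card % 3 := by
  obtain ⟨φ, hφ⟩ := hub_exists_equiv_of_card_eq_nine f h hn
  have key : ∀ r e : Fin 3 → Fin 3, (∀ b b', r b ≠ r b' → b ≠ e (r b + r b')) →
      (Finset.univ.filter fun b => r b = 0).card % 3 =
        (Finset.univ.filter fun b => r b = 1).card % 3 := by decide +kernel
  rw [card_fiber_eq_sum φ, card_fiber_eq_sum φ, Fin.sum_univ_three, Fin.sum_univ_three]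
  -- The sum `p + q` in `Fin 3` determines the edge of the triangle: `1 + 2 = 0`, `0 + 1 = 1`, `0 +
  -- 2 = 2`.
  have hrim : ∀ p q : Fin 3, p ≠ q → f s(rim p, rim q) =
      ![f s(rim 1, rim 2), f s(rim 0, rim 1), f s(rim 0, rim 2)] (p + q) := by
    intro p q hpq
    fin_cases p <;> fin_cases q <;> first | exact absurd rfl hpq | rfl | (rw [Sym2.eq_swap]; rfl)
  have := fun t => key (fun b => π (φ (t, b)))
      ![f s(rim 1, rim 2), f s(rim 0, rim 1), f s(rim 0, rim 2)] fun b b' hne => by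
    rw [← hrim _ _ hne]
    exact (hφ t b b' hne).1
  have h0 := this 0
  have h1 := this 1
  have h2 := this 2
  omega

/-- The single vertex `j` of the second part removes colour pairs. Vertices sharing its hub colour
must be compatible with it, and vertices with the colour of the rim edge can reach the other rim
vertex only over the hub and `j`. -/
theorem hub_two_card_fiber_le_six [Fintype ι] {π : ι → Fin 2} (j : ι) (hj : ∀ i, π i = 1 ↔ i = j)
    (f : Sym2 (HubVertex ι (Fin 2)) → Fin 3) (h : ∀ a b, Joined (hubGraph π) f a b) :
    (Finset.univ.filter fun i => π i = 0).card ≤ 6 := by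
  -- If `d = e` a whole row of three pairs is lost, and if `t₀ = d` a whole column. Otherwise one
  -- pair survives in the row `t₀`, one in the column `e`, and four elsewhere.
  have key : ∀ t₀ d e : Fin 3, ((Finset.univ : Finset (Fin 3 × Fin 3)).filter fun x =>
      (x.1 = t₀ → x.2 ≠ d ∧ x.2 ≠ e ∧ d ≠ e) ∧
      (x.2 = e → x.1 ≠ t₀ ∧ x.1 ≠ d ∧ t₀ ≠ d)).card ≤ 6 := by decide
  refine le_trans ?_ (key (f s(mid j, hub)) (f s(mid j, rim 1)) (f s(rim 0, rim 1)))
  refine Finset.card_le_card_of_injOn _ (fun i hi => ?_) (hub_injective_of_joined f h).injOn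
  have hi : π i = 0 := by simpa using hi
  have hπj : π j = 1 := (hj j).2 rfl
  simp only [Finset.mem_coe, Finset.mem_filter, Finset.mem_univ, true_and]
  refine ⟨fun ht => ?_, fun hb => ?_⟩
  · have hp : π i ≠ π j := by rw [hi, hπj]; decide
    have := (h (mid i) (mid j)).compat (by simp) (fun h => hp (congrArg π h)) ht
    have h2 := this.2 hp
    rw [hi, hπj] at this h2
    rw [hi]
    exact ⟨this.1, h2.2⟩
  · rcases (h (mid i) (rim 1)).mid_rim (by simp) (by rw [hi]; decide) with h' | ⟨-, ⟨q, hq⟩ |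
      ⟨l, hl, h'⟩⟩
    · rw [hi] at h' hb
      exact absurd hb h'
    · rw [hi] at hq
      omega
    · rw [hj] at hl
      subst hl
      exact h'

end LowerBounds

/-! ### The members of the family -/

section Isomorphisms

variable {ι ι' P P' : Type*} {π : ι → P} {π' : ι' → P'}

/-- Hub graphs of isomorphic maps are isomorphic. -/
def hubIso (σ : ι ≃ ι') (τ : P ≃ P') (h : ∀ i, π' (σ i) = τ (π i)) :
    hubGraph π ≃g hubGraph π' where
  toFun
    | .mid i => .mid (σ i)
    | .rim p => .rim (τ p)
    | .hub => .hub
  invFun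
    | .mid i => .mid (σ.symm i)
    | .rim p => .rim (τ.symm p)
    | .hub => .hub
  left_inv := by rintro (i | p | _) <;> simp
  right_inv := by rintro (i | p | _) <;> simp
  map_rel_iff' := by rintro (i | p | _) (j | q | _) <;> simp [h]

/-- Isomorphic graphs have isomorphic duplications. -/
def duplicateIso {V W : Type*} {G : SimpleGraph V} {H : SimpleGraph W} (φ : G ≃g H) (v : V) :
    duplicate G v ≃g duplicate H (φ v) where
  toEquiv := φ.toEquiv.optionCongr
  map_rel_iff' := by
    rintro (_ | a) (_ | b) <;> simp [duplicate] <;> exact φ.map_rel_iff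

/-- Duplicating a middle vertex of a hub graph. -/
def duplicateMidIso (π : ι → P) (i : ι) :
    duplicate (hubGraph π) (mid i) ≃g hubGraph (fun o : Option ι => o.elim (π i) π) where
  toFun
    | none => .mid none
    | some (.mid j) => .mid (some j)
    | some (.rim p) => .rim p
    | some .hub => .hub
  invFun
    | .mid none => none
    | .mid (some j) => some (.mid j)
    | .rim p => some (.rim p)
    | .hub => some .hub
  left_inv := by rintro (_ | (i | p | _)) <;> rfl
  right_inv := by rintro ((_ | i) | p | _) <;> rfl
  map_rel_iff' := by
    rintro (_ | (j | p | _)) (_ | (l | q | _)) <;> simp [duplicate]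

open Classical in
/-- If the hub graph has two parts and `i₀` is the only middle vertex of the part `p`, then the
hub can be exchanged with the other rim vertex and `rim p` with `mid i₀`. -/
noncomputable def hubSwapFun (p : Fin 2) (i₀ : ι) : HubVertex ι (Fin 2) → HubVertex ι (Fin 2)
  | .mid i => if i = i₀ then .rim p else .mid i
  | .rim q => if q = p then .mid i₀ else .hub
  | .hub => .rim (p + 1)

theorem hubSwapFun_involutive (p : Fin 2) (i₀ : ι) : Function.Involutive (hubSwapFun p i₀) := by
  have hp : p + 1 ≠ p := by revert p; decide
  rintro (i | q | _)
  · by_cases hi : i = i₀ <;> simp [hubSwapFun, hi]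
  · by_cases hq : q = p
    · simp [hubSwapFun, hq]
    · have : q = p + 1 := by omega
      simp [hubSwapFun, hq, ← this]
  · simp [hubSwapFun, hp]

theorem hubSwapFun_adj {π : ι → Fin 2} {p : Fin 2} {i₀ : ι} (h : ∀ i, π i = p ↔ i = i₀)
    (a b : HubVertex ι (Fin 2)) (hab : (hubGraph π).Adj a b) :
    (hubGraph π).Adj (hubSwapFun p i₀ a) (hubSwapFun p i₀ b) := by
  have hp : p + 1 ≠ p := by omega
  have hne : ∀ i, i ≠ i₀ → π i = p + 1 := fun i hi => by
    have := (h i).not.2 hi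
    omega
  have h0 : π i₀ = p := (h i₀).2 rfl
  have hq' : ∀ q, q ≠ p → q = p + 1 := fun q hq => by omega
  rcases a with i | q | _ <;> rcases b with j | r | _
  · simp at hab
  · by_cases hi : i = i₀
    · have : r = p := by
        subst hi
        rw [hubGraph_mid_rim] at hab
        exact hab.symm.trans h0
      simp [hubSwapFun, hi, this, h0]
    · have : r ≠ p := by
        rw [hubGraph_mid_rim, hne i hi] at hab
        exact hab ▸ hp
      simp [hubSwapFun, hi, this]
  · by_cases hi : i = i₀
    · simp [hubSwapFun, hi, hp.symm]
    · simp [hubSwapFun, hi, hne i hi]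
  · by_cases hi : j = i₀
    · have : q = p := by
        subst hi
        rw [hubGraph_rim_mid] at hab
        exact hab.symm.trans h0
      simp [hubSwapFun, hi, this, h0]
    · have : q ≠ p := by
        rw [hubGraph_rim_mid, hne j hi] at hab
        exact hab ▸ hp
      simp [hubSwapFun, hi, this]
  · rw [hubGraph_rim_rim] at hab
    by_cases hq : q = p
    · simp [hubSwapFun, hq, show r ≠ p from fun h => hab (hq.trans h.symm)]
    · have : r = p := by omega
      simp [hubSwapFun, hq, this]
  · simp at hab
  · by_cases hi : j = i₀
    · simp [hubSwapFun, hi, hp]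
    · simp [hubSwapFun, hi, hne j hi]
  · simp at hab
  · simp at hab

/-- The automorphism given by `hubSwapFun`. -/
noncomputable def hubSwap {π : ι → Fin 2} (p : Fin 2) (i₀ : ι) (h : ∀ i, π i = p ↔ i = i₀) :
    hubGraph π ≃g hubGraph π where
  toEquiv := (hubSwapFun_involutive p i₀).toPerm
  map_rel_iff' := by
    intro a b
    refine ⟨fun hab => ?_, hubSwapFun_adj h a b⟩
    have := hubSwapFun_adj h _ _ hab
    simpa [(hubSwapFun_involutive p i₀) a, (hubSwapFun_involutive p i₀) b] using this

theorem encard_neighborSet_mid (π : ι → P) (i : ι) :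
    ((hubGraph π).neighborSet (mid i)).encard = 2 := by
  have : (hubGraph π).neighborSet (mid i) = {hub, rim (π i)} := by
    ext a
    rcases a with j | q | _ <;> simp [eq_comm]
  rw [this, Set.encard_pair (by simp)]

theorem not_encard_two_of_three {V : Type*} {s : Set V} {a b c : V} (ha : a ∈ s) (hb : b ∈ s)
    (hc : c ∈ s) (hab : a ≠ b) (hac : a ≠ c) (hbc : b ≠ c) : s.encard ≠ 2 := by
  intro h
  obtain ⟨x, y, -, rfl⟩ := Set.encard_eq_two.1 h
  simp only [Set.mem_insert_iff, Set.mem_singleton_iff] at ha hb hc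
  grind

/-- The cycle of length five as a hub graph. -/
theorem cycleGraph_five_iso : Nonempty (SimpleGraph.cycleGraph 5 ≃g hubGraph (id : Fin 2 → Fin 2)) :=
  ⟨{  toFun := ![hub, mid 0, rim 0, rim 1, mid 1]
      invFun := fun
        | .hub => 0
        | .mid i => ![1, 4] i
        | .rim i => ![2, 3] i
      left_inv := by intro a; fin_cases a <;> rfl
      right_inv := by rintro (i | i | _) <;> first | rfl | (fin_cases i <;> rfl)
      map_rel_iff' := by
        intro a b
        rw [SimpleGraph.cycleGraph_adj]
        fin_cases a <;> fin_cases b <;> simp <;> decide }⟩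

theorem G7_iso : Nonempty (G7 ≃g hubGraph (id : Fin 3 → Fin 3)) :=
  ⟨{  toFun := fun
        | .inl a => Fin.cases hub rim a
        | .inr i => mid i
      invFun := fun
        | .hub => .inl 0
        | .mid i => .inr i
        | .rim i => .inl i.succ
      left_inv := by
        rintro (a | i)
        · induction a using Fin.cases <;> rfl
        · rfl
      right_inv := by rintro (i | i | _) <;> rfl
      map_rel_iff' := by
        rintro (a | i) (b | j)
        · induction a using Fin.cases <;> induction b using Fin.cases <;> simp [G7]
        · induction a using Fin.cases <;> simp [G7, eq_comm]
        · induction b using Fin.cases <;> simp [G7, eq_comm]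
        · simp [G7] }⟩

theorem encard_neighborSet_iso {V W : Type*} {G : SimpleGraph V} {H : SimpleGraph W} (φ : G ≃g H)
    (v : V) : (G.neighborSet v).encard = (H.neighborSet (φ v)).encard :=
  Set.encard_congr (φ.mapNeighborSet v)

end Isomorphisms

/-- `G` is the hub graph of a surjection from a finite type onto `Fin k`. -/
def IsHub (k : ℕ) {V : Type*} (G : SimpleGraph V) : Prop :=
  ∃ (ι : Type) (_ : Finite ι) (π : ι → Fin k), Function.Surjective π ∧ Nonempty (G ≃g hubGraph π)

theorem IsHub.congr {k : ℕ} {V W : Type*} {G : SimpleGraph V} {H : SimpleGraph W} (φ : G ≃g H)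
    (h : IsHub k H) : IsHub k G := by
  obtain ⟨ι, hι, π, hπ, ⟨ψ⟩⟩ := h
  exact ⟨ι, hι, π, hπ, ⟨φ.trans ψ⟩⟩

theorem isHub_duplicate_mid {k : ℕ} {ι : Type} [Finite ι] {π : ι → Fin k}
    (hπ : Function.Surjective π) (i : ι) : IsHub k (duplicate (hubGraph π) (mid i)) :=
  ⟨Option ι, inferInstance, _, fun p => (hπ p).elim fun j hj => ⟨some j, hj⟩,
    ⟨duplicateMidIso π i⟩⟩

theorem isHub_three_duplicate {ι : Type} [Finite ι] {π : ι → Fin 3} (hπ : Function.Surjective π)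
    (v : HubVertex ι (Fin 3)) (hv : ((hubGraph π).neighborSet v).encard = 2) :
    IsHub 3 (duplicate (hubGraph π) v) := by
  rcases v with i | p | _
  · exact isHub_duplicate_mid hπ i
  · obtain ⟨i, hi⟩ := hπ p
    refine absurd hv (not_encard_two_of_three (a := mid i) (b := rim (p + 1)) (c := rim (p + 2))
      (by simpa using hi) ?_ ?_ (by simp) (by simp) ?_) <;> simp
  · obtain ⟨s, hs⟩ := hπ.hasRightInverse
    exact absurd hv (not_encard_two_of_three (a := mid (s 0)) (b := mid (s 1)) (c := mid (s 2))
      (by simp) (by simp) (by simp) (by simp [hs.injective.eq_iff]) (by simp [hs.injective.eq_iff])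
      (by simp [hs.injective.eq_iff]))

/-- A rim vertex of degree 2 belongs to a singleton part, and `hubSwap` exchanges it with the middle
vertex of that part. A hub of degree 2 forces both parts to be singletons, and a swap makes it a rim
vertex of degree 2. -/
theorem isHub_two_duplicate {ι : Type} [Finite ι] {π : ι → Fin 2} (hπ : Function.Surjective π)
    (v : HubVertex ι (Fin 2)) (hv : ((hubGraph π).neighborSet v).encard = 2) :
    IsHub 2 (duplicate (hubGraph π) v) := by
  have rim_case : ∀ p, ((hubGraph π).neighborSet (rim p)).encard = 2 →
      IsHub 2 (duplicate (hubGraph π) (rim p)) := by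
    intro p hp
    obtain ⟨i, hi⟩ := hπ p
    have huniq : ∀ j, π j = p ↔ j = i := by
      refine fun j => ⟨fun hj => ?_, fun h => h ▸ hi⟩
      by_contra hne
      refine absurd hp (not_encard_two_of_three (a := mid i) (b := mid j) (c := rim (p + 1))
        (by simpa using hi) (by simpa using hj) ?_ ?_ (by simp) (by simp))
      · simp
      · simpa using Ne.symm hne
    refine (isHub_duplicate_mid hπ i).congr ((duplicateIso (hubSwap p i huniq) (rim p)).trans ?_)
    have : hubSwap p i huniq (rim p) = mid i := by simp [hubSwap, hubSwapFun]
    rw [this]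
  rcases v with i | p | _
  · exact isHub_duplicate_mid hπ i
  · exact rim_case p hv
  · obtain ⟨s, hs⟩ := hπ.hasRightInverse
    have huniq : ∀ j, π j = 0 ↔ j = s 0 := by
      refine fun j => ⟨fun hj => ?_, fun h => h ▸ hs 0⟩
      by_contra hne
      have h1 : j ≠ s 1 := by rintro rfl; rw [hs 1] at hj; simp at hj
      exact absurd hv (not_encard_two_of_three (a := mid (s 0)) (b := mid (s 1)) (c := mid j)
        (by simp) (by simp) (by simp) (by simp [hs.injective.eq_iff])
        (by simpa using Ne.symm hne) (by simpa using Ne.symm h1))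
    have h1 : hubSwap 0 (s 0) huniq hub = rim 1 := by simp [hubSwap, hubSwapFun]
    have h2 := rim_case 1 (by rw [← h1, ← encard_neighborSet_iso]; exact hv)
    rw [← h1] at h2
    exact h2.congr (duplicateIso _ _)

theorem petersen_neighborSet (v : ZMod 5 ⊕ ZMod 5) : (petersen.neighborSet v).encard ≠ 2 := by
  rcases v with i | i
  · refine not_encard_two_of_three (a := .inl (i + 1)) (b := .inl (i - 1)) (c := .inr i)
      ?_ ?_ ?_ (by revert i; decide) (by simp) (by simp) <;>
    simp only [SimpleGraph.mem_neighborSet, petersen, SimpleGraph.fromRel_adj] <;> revert i <;>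
      decide
  · refine not_encard_two_of_three (a := .inr (i + 2)) (b := .inr (i - 2)) (c := .inl i)
      ?_ ?_ ?_ (by revert i; decide) (by simp) (by simp) <;>
    simp only [SimpleGraph.mem_neighborSet, petersen, SimpleGraph.fromRel_adj] <;> revert i <;>
      decide

theorem Family.isHub {V : Type u} {G : SimpleGraph V} (h : Family G) :
    Nonempty (G ≃g petersen) ∨ IsHub 2 G ∨ IsHub 3 G := by
  induction h with
  | base_C5 e =>
    exact Or.inr (Or.inl ⟨Fin 2, inferInstance, id, Function.surjective_id,
      cycleGraph_five_iso.map e.trans⟩)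
  | base_G7 e =>
    exact Or.inr (Or.inr ⟨Fin 3, inferInstance, id, Function.surjective_id,
      G7_iso.map e.trans⟩)
  | base_petersen e => exact Or.inl ⟨e⟩
  | dup v hG hv e ih =>
    rcases ih with ⟨⟨φ⟩⟩ | ⟨ι, hι, π, hπ, ⟨φ⟩⟩ | ⟨ι, hι, π, hπ, ⟨φ⟩⟩
    · rw [encard_neighborSet_iso φ] at hv
      exact absurd hv (petersen_neighborSet _)
    · rw [encard_neighborSet_iso φ] at hv
      exact Or.inr (Or.inl ((isHub_two_duplicate hπ _ hv).congr (e.trans (duplicateIso φ v))))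
    · rw [encard_neighborSet_iso φ] at hv
      exact Or.inr (Or.inr ((isHub_three_duplicate hπ _ hv).congr (e.trans (duplicateIso φ v))))

/-- Moving the point added to the right summand to the outside. -/
def optionSumEquiv (α β : Type*) : Option (α ⊕ β) ≃ α ⊕ Option β where
  toFun
    | none => .inr none
    | some (.inl a) => .inl a
    | some (.inr b) => .inr (some b)
  invFun
    | .inr none => none
    | .inl a => some (.inl a)
    | .inr (some b) => some (.inr b)
  left_inv := by rintro (_ | (a | b)) <;> rfl
  right_inv := by rintro (a | (_ | b)) <;> rfl

/-- The left summand holds one middle vertex per part, which is the base graph. Each element of `κ`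
is then added as a duplicate of the base vertex of its part. -/
theorem family_of_sumElim {k : ℕ}
    (hbase : ∀ {V : Type u} (G : SimpleGraph V), G ≃g hubGraph (id : Fin k → Fin k) → Family G)
    (κ : Type) [Finite κ] : ∀ (ρ : κ → Fin k) {V : Type u} (G : SimpleGraph V),
      G ≃g hubGraph (Sum.elim id ρ : Fin k ⊕ κ → Fin k) → Family G := by
  induction κ using Finite.induction_empty_option with
  | @of_equiv α β e ih =>
    intro ρ V G φ
    refine ih (ρ ∘ e) G (φ.trans (hubIso ((Equiv.refl _).sumCongr e) (Equiv.refl _) ?_).symm)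
    rintro (i | i) <;> rfl
  | h_empty =>
    intro ρ V G φ
    refine hbase G (φ.trans (hubIso (Equiv.sumEmpty _ _) (Equiv.refl _) ?_))
    rintro (i | i)
    · rfl
    · exact i.elim
  | @h_option α _ ih =>
    intro ρ V G φ
    let π : Fin k ⊕ α → Fin k := Sum.elim id (fun a => ρ (some a))
    let v : HubVertex (Fin k ⊕ α) (Fin k) := mid (.inl (ρ none))
    -- The intermediate graph must live in the universe of `G`, since `Family` stays within one
    -- universe.
    let H : SimpleGraph (ULift.{u} (HubVertex (Fin k ⊕ α) (Fin k))) :=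
      (hubGraph π).comap Equiv.ulift
    let ψ : H ≃g hubGraph π := SimpleGraph.Iso.comap Equiv.ulift _
    have hH : Family H := ih (fun a => ρ (some a)) H ψ
    refine Family.dup (ULift.up v) hH ?_ (φ.trans ?_)
    · rw [encard_neighborSet_iso ψ]
      exact encard_neighborSet_mid π _
    · refine RelIso.trans ?_ (duplicateIso ψ.symm v)
      refine RelIso.trans ?_ (duplicateMidIso π _).symm
      refine (hubIso (optionSumEquiv _ _) (Equiv.refl _) ?_).symm
      rintro (_ | (i | i)) <;> rfl

/-- A section of `π` singles out the base middle vertices. -/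
theorem exists_sumElim {k : ℕ} {ι : Type} [Finite ι] {π : ι → Fin k}
    (hπ : Function.Surjective π) : ∃ (κ : Type) (_ : Finite κ) (ρ : κ → Fin k),
      Nonempty (hubGraph π ≃g hubGraph (Sum.elim id ρ : Fin k ⊕ κ → Fin k)) := by
  classical
  obtain ⟨s, hs⟩ := hπ.hasRightInverse
  let σ : Fin k ⊕ ((Set.range s)ᶜ : Set ι) ≃ ι :=
    ((Equiv.ofInjective s hs.injective).sumCongr (Equiv.refl _)).trans (Equiv.Set.sumCompl _)
  refine ⟨((Set.range s)ᶜ : Set ι), inferInstance, fun i => π i, ⟨(hubIso σ (Equiv.refl _) ?_).symm⟩⟩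
  rintro (p | i)
  · exact hs p
  · rfl

theorem IsHub.family {V : Type u} {G : SimpleGraph V} (h : IsHub 2 G ∨ IsHub 3 G) : Family G := by
  rcases h with ⟨ι, hι, π, hπ, ⟨φ⟩⟩ | ⟨ι, hι, π, hπ, ⟨φ⟩⟩
  · obtain ⟨κ, hκ, ρ, ⟨ψ⟩⟩ := exists_sumElim hπ
    exact family_of_sumElim (fun G χ => cycleGraph_five_iso.elim fun θ =>
      Family.base_C5 (χ.trans θ.symm)) κ ρ G (φ.trans ψ)
  · obtain ⟨κ, hκ, ρ, ⟨ψ⟩⟩ := exists_sumElim hπ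
    exact family_of_sumElim (fun G χ => G7_iso.elim fun θ =>
      Family.base_G7 (χ.trans θ.symm)) κ ρ G (φ.trans ψ)

/-- The hub graph with `n p` middle vertices in the part `p`. -/
def stdHub {k : ℕ} (n : Fin k → ℕ) :
    SimpleGraph (HubVertex (Σ p : Fin k, Fin (n p)) (Fin k)) := hubGraph Sigma.fst

/-- The rim is complete, so every permutation of the parts extends to an isomorphism and the parts
can be sorted by size. -/
theorem hub_iso_stdHub {k : ℕ} {ι : Type} [Finite ι] (π : ι → Fin k)
    (hπ : Function.Surjective π) : ∃ n : Fin k → ℕ, Antitone n ∧ (∀ p, 1 ≤ n p) ∧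
      Nonempty (hubGraph π ≃g stdHub n) := by
  let c : Fin k → ℕ := fun p => Nat.card {i // π i = p}
  let τ : Equiv.Perm (Fin k) := Tuple.sort (fun p => OrderDual.toDual (c p))
  refine ⟨fun p => c (τ p), fun p q hpq => ?_, fun p => ?_, ⟨?_⟩⟩
  · exact Tuple.monotone_sort (fun p => OrderDual.toDual (c p)) hpq
  · obtain ⟨i, hi⟩ := hπ (τ p)
    have : Nonempty {i // π i = τ p} := ⟨⟨i, hi⟩⟩
    exact Nat.card_pos
  · let σ : (Σ p : Fin k, Fin (c (τ p))) ≃ ι :=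
      (Equiv.sigmaCongr τ fun p => (Finite.equivFin {i // π i = τ p}).symm).trans
        (Equiv.sigmaFiberEquiv π)
    refine (hubIso σ τ ?_).symm
    rintro ⟨p, i⟩
    exact ((Finite.equivFin {i // π i = τ p}).symm i).2

theorem G₂_iso (p q : ℕ) : Nonempty (G₂ p q ≃g stdHub ![p, q]) :=
  ⟨{  toFun := fun
        | .u i => .mid ⟨0, i⟩
        | .v i => .mid ⟨1, i⟩
        | .x₁ => .rim 0
        | .x₂ => .rim 1
        | .y => .hub
      invFun := fun
        | .mid ⟨0, i⟩ => .u i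
        | .mid ⟨1, i⟩ => .v i
        | .rim 0 => .x₁
        | .rim 1 => .x₂
        | .hub => .y
      left_inv := by rintro (i | i | _) <;> rfl
      right_inv := by rintro (⟨a, i⟩ | a | _) <;> first | rfl | (fin_cases a <;> rfl)
      map_rel_iff' := by
        rintro (i | i | _) (j | j | _) <;> simp [stdHub, G₂] }⟩

theorem G₃_iso (p q r : ℕ) : Nonempty (G₃ p q r ≃g stdHub ![p, q, r]) :=
  ⟨{  toFun := fun
        | .u i => .mid ⟨0, i⟩
        | .v i => .mid ⟨1, i⟩
        | .w i => .mid ⟨2, i⟩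
        | .x₁ => .rim 0
        | .x₂ => .rim 1
        | .x₃ => .rim 2
        | .y => .hub
      invFun := fun
        | .mid ⟨0, i⟩ => .u i
        | .mid ⟨1, i⟩ => .v i
        | .mid ⟨2, i⟩ => .w i
        | .rim 0 => .x₁
        | .rim 1 => .x₂
        | .rim 2 => .x₃
        | .hub => .y
      left_inv := by rintro (i | i | i | _) <;> rfl
      right_inv := by rintro (⟨a, i⟩ | a | _) <;> first | rfl | (fin_cases a <;> rfl)
      map_rel_iff' := by
        rintro (i | i | i | _) (j | j | j | _) <;> simp [stdHub, G₃] }⟩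

theorem isHub_stdHub {k : ℕ} (n : Fin k → ℕ) (hn : ∀ p, 1 ≤ n p) : IsHub k (stdHub n) :=
  ⟨_, inferInstance, Sigma.fst, fun p => ⟨⟨p, ⟨0, hn p⟩⟩, rfl⟩, ⟨RelIso.refl _⟩⟩

theorem isHub_two_iff {V : Type*} (G : SimpleGraph V) :
    IsHub 2 G ↔ ∃ p q : ℕ, p ≥ q ∧ q ≥ 1 ∧ Nonempty (G ≃g G₂ p q) := by
  constructor
  · rintro ⟨ι, hι, π, hπ, ⟨φ⟩⟩
    obtain ⟨n, hn, h1, ⟨ψ⟩⟩ := hub_iso_stdHub π hπ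
    obtain ⟨χ⟩ := G₂_iso (n 0) (n 1)
    refine ⟨n 0, n 1, hn (by decide), h1 1, ⟨φ.trans (ψ.trans ?_)⟩⟩
    have : n = ![n 0, n 1] := by ext i; fin_cases i <;> rfl
    rw [← this] at χ
    exact χ.symm
  · rintro ⟨p, q, hpq, hq, ⟨φ⟩⟩
    obtain ⟨χ⟩ := G₂_iso p q
    refine IsHub.congr (φ.trans χ) (isHub_stdHub _ fun i => ?_)
    fin_cases i <;> simp <;> omega

theorem isHub_three_iff {V : Type*} (G : SimpleGraph V) :
    IsHub 3 G ↔ ∃ p q r : ℕ, p ≥ q ∧ q ≥ r ∧ r ≥ 1 ∧ Nonempty (G ≃g G₃ p q r) := by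
  constructor
  · rintro ⟨ι, hι, π, hπ, ⟨φ⟩⟩
    obtain ⟨n, hn, h1, ⟨ψ⟩⟩ := hub_iso_stdHub π hπ
    obtain ⟨χ⟩ := G₃_iso (n 0) (n 1) (n 2)
    refine ⟨n 0, n 1, n 2, hn (by decide), hn (by decide), h1 2, ⟨φ.trans (ψ.trans ?_)⟩⟩
    have : n = ![n 0, n 1, n 2] := by ext i; fin_cases i <;> rfl
    rw [← this] at χ
    exact χ.symm
  · rintro ⟨p, q, r, hpq, hqr, hr, ⟨φ⟩⟩
    obtain ⟨χ⟩ := G₃_iso p q r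
    refine IsHub.congr (φ.trans χ) (isHub_stdHub _ fun i => ?_)
    fin_cases i <;> simp <;> omega

theorem family_iff {V : Type u} (G : SimpleGraph V) :
    Family G ↔ Nonempty (G ≃g petersen) ∨
      (∃ p q : ℕ, p ≥ q ∧ q ≥ 1 ∧ Nonempty (G ≃g G₂ p q)) ∨
      (∃ p q r : ℕ, p ≥ q ∧ q ≥ r ∧ r ≥ 1 ∧ Nonempty (G ≃g G₃ p q r)) := by
  rw [← isHub_two_iff, ← isHub_three_iff]
  refine ⟨Family.isHub, ?_⟩
  rintro (⟨⟨φ⟩⟩ | h)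
  · exact Family.base_petersen φ
  · exact IsHub.family h

/-! ### Lists of three colours: the edges at the hub -/

section Choice

variable {ι P : Type*}

/-- Hall's theorem for the lists indexed by a finite set. -/
theorem exists_injOn_of_hall {β : Type*} [DecidableEq β] (R : Finset ι) (S : ι → Finset β)
    (h : ∀ s ⊆ R, s.card ≤ (s.biUnion S).card) :
    ∃ x : R → β, (∀ i : R, x i ∈ S i) ∧ Function.Injective x := by
  classical
  have := (Finset.all_card_le_biUnion_card_iff_exists_injective (fun i : R => S i)).1 fun s => by
    have h1 := h (s.map (Function.Embedding.subtype _)) (fun i hi => by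
      simp only [Finset.mem_map, Function.Embedding.subtype_apply] at hi
      obtain ⟨j, -, rfl⟩ := hi
      exact j.2)
    rw [Finset.card_map] at h1
    refine h1.trans (Finset.card_le_card fun c hc => ?_)
    simp only [Finset.mem_biUnion, Finset.mem_map, Function.Embedding.subtype_apply] at hc ⊢
    obtain ⟨i, ⟨j, hj, rfl⟩, hc⟩ := hc
    exact ⟨j, hj, hc⟩
  obtain ⟨x, hx, hxS⟩ := this
  exact ⟨x, hxS, hx⟩

theorem exists_injOn_choice (R : Finset ι) (S : ι → Finset ℕ)
    (h : ∀ s ⊆ R, s.card ≤ (s.biUnion S).card) :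
    ∃ x : ι → ℕ, (∀ i ∈ R, x i ∈ S i) ∧ ∀ i ∈ R, ∀ j ∈ R, i ≠ j → x i ≠ x j := by
  classical
  obtain ⟨x, hx, hinj⟩ := exists_injOn_of_hall R S h
  refine ⟨fun i => if hi : i ∈ R then x ⟨i, hi⟩ else 0, fun i hi => ?_, fun i hi j hj hij hne => ?_⟩
  · simpa [hi] using hx ⟨i, hi⟩
  · simp only [hi, hj, dif_pos] at hne
    exact hij (congrArg Subtype.val (hinj hne))

/-- Hall's theorem with every colour available twice. -/
theorem exists_choice_two (R : Finset ι) (S : ι → Finset ℕ)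
    (h : ∀ s ⊆ R, s.card ≤ 2 * (s.biUnion S).card) :
    ∃ x : ι → ℕ, (∀ i ∈ R, x i ∈ S i) ∧ ∀ c, (R.filter fun i => x i = c).card ≤ 2 := by
  classical
  obtain ⟨x, hx, hinj⟩ := exists_injOn_of_hall R (fun i => S i ×ˢ (Finset.univ : Finset (Fin 2)))
    fun s hs => by
      have : (s.biUnion fun i => S i ×ˢ (Finset.univ : Finset (Fin 2))) =
          s.biUnion S ×ˢ (Finset.univ : Finset (Fin 2)) := by
        ext ⟨c, k⟩
        simp
      rw [this, Finset.card_product]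
      simpa [mul_comm] using h s hs
  refine ⟨fun i => if hi : i ∈ R then (x ⟨i, hi⟩).1 else 0, fun i hi => ?_, fun c => ?_⟩
  · have := hx ⟨i, hi⟩
    simp only [Finset.mem_product] at this
    simpa [hi] using this.1
  · have : (R.filter fun i => (if hi : i ∈ R then (x ⟨i, hi⟩).1 else 0) = c).card ≤
        (Finset.univ : Finset (Fin 2)).card := by
      refine Finset.card_le_card_of_injOn (fun i => if hi : i ∈ R then (x ⟨i, hi⟩).2 else 0)
        (fun i _ => by simp) fun i hi j hj hij => ?_
      simp only [Finset.mem_coe, Finset.mem_filter] at hi hj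
      obtain ⟨hi, hic⟩ := hi
      obtain ⟨hj, hjc⟩ := hj
      simp only [hi, hj, dif_pos] at hic hjc hij
      exact congrArg Subtype.val (hinj (Prod.ext (hic.trans hjc.symm) hij))
    simpa using this

/-- The middle vertices in `K`, with a common colour at the hub, can be given colours at the rim
that make any two of them joined. -/
def Colorable (π : ι → P) (B : ι → Finset ℕ) (e : Sym2 P → ℕ) (K : Finset ι) : Prop :=
  ∃ bot : ι → ℕ, (∀ i ∈ K, bot i ∈ B i) ∧ ∀ i ∈ K, ∀ j ∈ K, i ≠ j → Compat π e bot i j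

theorem Colorable.mono {π : ι → P} {B : ι → Finset ℕ} {e : Sym2 P → ℕ} {K K' : Finset ι}
    (h : Colorable π B e K') (hK : K ⊆ K') : Colorable π B e K := by
  obtain ⟨bot, h1, h2⟩ := h
  exact ⟨bot, fun i hi => h1 i (hK hi), fun i hi j hj => h2 i (hK hi) j (hK hj)⟩

theorem eq_of_card_biUnion_eq {A : ι → Finset ℕ} {k : ℕ} {s : Finset ι}
    (hA : ∀ i ∈ s, k ≤ (A i).card) (h : (s.biUnion A).card ≤ k) :
    ∀ i ∈ s, A i = s.biUnion A := fun i hi =>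
  Finset.eq_of_subset_of_card_le (Finset.subset_biUnion_of_mem A hi) (h.trans (hA i hi))

end Choice

/-! ### Distributing the colours at the hub -/

section Tops

variable {ι : Type*} [Fintype ι] {P : Type*}

/-- Colours at the rim chosen class by class. -/
theorem exists_bot_of_colorable {π : ι → P} {B : ι → Finset ℕ} {e : Sym2 P → ℕ}
    {top : ι → ℕ} (hB : ∀ i, ∃ c ∈ B i, c ≠ top i)
    (h : ∀ c, Colorable π B e (Finset.univ.filter fun i => top i = c)) :
    ∃ bot : ι → ℕ, (∀ i, bot i ∈ B i) ∧ (∀ i j, i ≠ j → top i = top j → Compat π e bot i j) ∧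
      ∀ i, top i = bot i → ∃ j, j ≠ i ∧ top j = top i := by
  classical
  choose b hbB hb using h
  choose s hsB hs using hB
  have hval : ∀ i j, j ≠ i → top j = top i →
      (if ∃ j, j ≠ i ∧ top j = top i then b (top i) i else s i) = b (top i) i :=
    fun i j h1 h2 => if_pos ⟨j, h1, h2⟩
  refine ⟨fun i => if ∃ j, j ≠ i ∧ top j = top i then b (top i) i else s i, fun i => ?_,
    fun i j hij ht => ?_, fun i hi => ?_⟩
  · beta_reduce
    split_ifs
    · exact hbB _ i (by simp)
    · exact hsB i
  · have hc := hb (top i) i (by simp) j (by simp [ht]) hij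
    unfold Compat at hc ⊢
    beta_reduce
    rw [hval i j hij.symm ht.symm, hval j i hij ht, ← ht]
    exact hc
  · by_contra hne
    simp only [hne, if_false] at hi
    exact hs i hi.symm

/-- The vertices with list `T` are coloured by the three elements of `T` as `g` prescribes. The at
most two others use colours outside `T`, so they do not enter these classes and their own classes
have size at most 2. -/
theorem exists_top_of_many_equal {π : ι → P} {A B : ι → Finset ℕ} {e : Sym2 P → ℕ}
    (hA : ∀ i, (A i).card = 3) (hn : Fintype.card ι ≤ 9)
    (h2 : ∀ K : Finset ι, K.card ≤ 2 → Colorable π B e K) (T : Finset ℕ)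
    (hT : 7 ≤ (Finset.univ.filter fun i => A i = T).card)
    (hg : ∃ g : ι → Fin 3, ∀ c, Colorable π B e (Finset.univ.filter fun i => A i = T ∧ g i = c)) :
    ∃ top : ι → ℕ, (∀ i, top i ∈ A i) ∧
      ∀ c, Colorable π B e (Finset.univ.filter fun i => top i = c) := by
  obtain ⟨g, hg⟩ := hg
  have hT3 : T.card = 3 := by
    obtain ⟨i, hi⟩ : (Finset.univ.filter fun i => A i = T).Nonempty :=
      Finset.card_pos.1 (by omega)
    rw [← (Finset.mem_filter.1 hi).2, hA]
  let τ := T.orderEmbOfFin hT3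
  have hout : ∀ i, ∃ c ∈ A i, A i ≠ T → c ∉ T := by
    intro i
    by_cases hi : A i = T
    · obtain ⟨c, hc⟩ := Finset.card_pos.1 (by rw [hA i]; decide : 0 < (A i).card)
      exact ⟨c, hc, fun h => absurd hi h⟩
    · have : ¬ A i ⊆ T := fun hs => hi (Finset.eq_of_subset_of_card_le hs (by rw [hA, hT3]))
      obtain ⟨c, hc, hcT⟩ := Finset.not_subset.1 this
      exact ⟨c, hc, fun _ => hcT⟩
  choose o hoA hoT using hout
  refine ⟨fun i => if A i = T then τ (g i) else o i, fun i => ?_, fun c => ?_⟩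
  · beta_reduce
    split_ifs with hi
    · rw [hi]; exact T.orderEmbOfFin_mem hT3 _
    · exact hoA i
  · by_cases hc : c ∈ T
    · obtain ⟨k, rfl⟩ : ∃ k, τ k = c := by
        have : c ∈ Set.range τ := by
          rw [Finset.range_orderEmbOfFin]; exact hc
        exact this
      refine (hg k).mono fun i hi => ?_
      simp only [Finset.mem_filter, Finset.mem_univ, true_and] at hi ⊢
      split_ifs at hi with hAi
      · exact ⟨hAi, τ.injective hi⟩
      · exact absurd (hi ▸ T.orderEmbOfFin_mem hT3 k) (hoT i hAi)
    · refine h2 _ ?_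
      have hsub : (Finset.univ.filter fun i => (if A i = T then τ (g i) else o i) = c) ⊆
          Finset.univ.filter fun i => ¬ A i = T := by
        intro i hi
        simp only [Finset.mem_filter, Finset.mem_univ, true_and] at hi ⊢
        intro hAi
        rw [if_pos hAi] at hi
        exact hc (hi ▸ T.orderEmbOfFin_mem hT3 _)
      have h1 := Finset.card_le_card hsub
      have h3 := Finset.card_filter_add_card_filter_not (s := (Finset.univ : Finset ι))
        (fun i => A i = T)
      rw [Finset.card_univ] at h3
      exact h1.trans (by omega)

/-- Hall's condition with multiplicity two asks for at most twice as many lists as colours. Three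
colours in the union allow six equal lists, four allow eight, and five suffice for nine; the two
hypotheses exclude exactly the failures. -/
theorem exists_top_of_hall {A : ι → Finset ℕ} (hA : ∀ i, (A i).card = 3)
    (hn : Fintype.card ι ≤ 9)
    (h6 : ∀ T : Finset ℕ, (Finset.univ.filter fun i => A i = T).card ≤ 6)
    (h9 : Fintype.card ι = 9 → (Finset.univ.biUnion A).card ≠ 4) :
    ∃ top : ι → ℕ, (∀ i, top i ∈ A i) ∧
      ∀ c, (Finset.univ.filter fun i => top i = c).card ≤ 2 := by
  obtain ⟨x, hx, hc⟩ := exists_choice_two Finset.univ A fun s _ => by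
    rcases s.eq_empty_or_nonempty with rfl | ⟨i, hi⟩
    · simp
    have h3 : 3 ≤ (s.biUnion A).card := by
      rw [← hA i]; exact Finset.card_le_card (Finset.subset_biUnion_of_mem A hi)
    have hs : s.card ≤ Fintype.card ι := s.card_le_univ
    by_cases h3' : (s.biUnion A).card = 3
    · have hall := eq_of_card_biUnion_eq (A := A) (k := 3) (s := s) (fun i _ => (hA i).ge) h3'.le
      have : s ⊆ Finset.univ.filter fun i => A i = s.biUnion A := fun j hj => by
        simpa using hall j hj
      have := Finset.card_le_card this
      have := h6 (s.biUnion A)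
      omega
    by_cases h4 : (s.biUnion A).card = 4
    · by_contra hlt
      have h9' : Fintype.card ι = 9 := by omega
      have : s = Finset.univ := Finset.eq_univ_of_card s (by omega)
      exact h9 h9' (this ▸ h4)
    · omega
  exact ⟨x, fun i => hx i (Finset.mem_univ i), hc⟩

/-- Each list omits just one of the four colours, so three lists share some `α`. With `α` used up on
`K`, the six remaining lists keep at least two colours. Hall's condition with multiplicity two could
fail only for more than four equal lists, which `hout` excludes. -/
theorem exists_top_of_triple [DecidableEq ι] {A : ι → Finset ℕ} (hA : ∀ i, (A i).card = 3)
    (hn : Fintype.card ι = 9) (h4 : (Finset.univ.biUnion A).card = 4) {K : Finset ι}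
    (hK : K.card = 3) (hout : ∀ T : Finset ℕ,
      (Finset.univ.filter fun i => i ∉ K ∧ A i = T).card ≤ 4) :
    ∃ (top : ι → ℕ) (α : ℕ), (∀ i, top i ∈ A i) ∧ (∀ i, top i = α ↔ i ∈ K) ∧
      ∀ c, c ≠ α → (Finset.univ.filter fun i => top i = c).card ≤ 2 := by
  obtain ⟨α, hα⟩ : ∃ α, ∀ i ∈ K, α ∈ A i := by
    by_contra hne
    push Not at hne
    have hsub : Finset.univ.biUnion A ⊆ K.biUnion fun i => Finset.univ.biUnion A \ A i := by
      intro c hc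
      obtain ⟨i, hi, hci⟩ := hne c
      exact Finset.mem_biUnion.2 ⟨i, hi, Finset.mem_sdiff.2 ⟨hc, hci⟩⟩
    have h1 := Finset.card_le_card hsub
    have h2 : (K.biUnion fun i => Finset.univ.biUnion A \ A i).card ≤ K.card * 1 :=
      Finset.card_biUnion_le_card_mul _ _ _ fun i _ => by
        rw [Finset.card_sdiff_of_subset (Finset.subset_biUnion_of_mem A (Finset.mem_univ i)), hA,
          h4]
    omega
  obtain ⟨x, hx, hc⟩ := exists_choice_two Kᶜ (fun i => (A i).erase α) fun s hs => by
    rcases s.eq_empty_or_nonempty with rfl | ⟨i, hi⟩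
    · simp
    have hge : ∀ i, 2 ≤ ((A i).erase α).card := fun i => by
      have := Finset.pred_card_le_card_erase (s := A i) (a := α)
      rw [hA] at this
      omega
    have h2 : 2 ≤ (s.biUnion fun i => (A i).erase α).card := (hge i).trans
      (Finset.card_le_card (Finset.subset_biUnion_of_mem (fun i => (A i).erase α) hi))
    have hs6 : s.card ≤ 6 := by
      have := Finset.card_le_card hs
      rw [Finset.card_compl, hn, hK] at this
      exact this
    by_cases h2' : (s.biUnion fun i => (A i).erase α).card = 2
    · have hall := eq_of_card_biUnion_eq (A := fun i => (A i).erase α) (k := 2) (s := s)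
        (fun i _ => hge i) h2'.le
      have : s ⊆ Finset.univ.filter fun i => i ∉ K ∧
          A i = insert α (s.biUnion fun i => (A i).erase α) := fun j hj => by
        simp only [Finset.mem_filter, Finset.mem_univ, true_and]
        refine ⟨Finset.mem_compl.1 (hs hj), ?_⟩
        have hαj : α ∈ A j := by
          by_contra hαj
          have := hall j hj
          rw [← this, Finset.erase_eq_of_notMem hαj, hA] at h2'
          omega
        rw [← hall j hj, Finset.insert_erase hαj]
      have := Finset.card_le_card this
      have := hout (insert α (s.biUnion fun i => (A i).erase α))
      omega
    · omega
  refine ⟨fun i => if i ∈ K then α else x i, α, fun i => ?_, fun i => ?_, fun c hcα => ?_⟩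
  · beta_reduce
    split_ifs with hi
    · exact hα i hi
    · exact Finset.mem_of_mem_erase (hx i (by simpa using hi))
  · by_cases hi : i ∈ K
    · simp [hi]
    · simpa [hi] using Finset.ne_of_mem_erase (hx i (by simpa using hi))
  · refine (Finset.card_le_card fun i hi => ?_).trans (hc c)
    simp only [Finset.mem_filter, Finset.mem_univ, true_and] at hi ⊢
    split_ifs at hi with hiK
    · exact absurd hi.symm hcα
    · exact ⟨by simpa using hiK, hi⟩

/-- Colours at the hub all of whose classes can be coloured at the rim. -/
theorem exists_top [DecidableEq ι] {π : ι → P} {A B : ι → Finset ℕ} {e : Sym2 P → ℕ}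
    (hA : ∀ i, (A i).card = 3) (hn : Fintype.card ι ≤ 9)
    (h2 : ∀ K : Finset ι, K.card ≤ 2 → Colorable π B e K)
    (h7 : ∀ T : Finset ℕ, 7 ≤ (Finset.univ.filter fun i => A i = T).card →
      ∃ g : ι → Fin 3, ∀ c, Colorable π B e (Finset.univ.filter fun i => A i = T ∧ g i = c))
    (h9 : Fintype.card ι = 9 → (Finset.univ.biUnion A).card = 4 →
      (∀ T : Finset ℕ, (Finset.univ.filter fun i => A i = T).card ≤ 6) →
      ∃ K : Finset ι, K.card = 3 ∧ Colorable π B e K ∧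
        ∀ T : Finset ℕ, (Finset.univ.filter fun i => i ∉ K ∧ A i = T).card ≤ 4) :
    ∃ top : ι → ℕ, (∀ i, top i ∈ A i) ∧
      ∀ c, Colorable π B e (Finset.univ.filter fun i => top i = c) := by
  by_cases hT : ∃ T : Finset ℕ, 7 ≤ (Finset.univ.filter fun i => A i = T).card
  · obtain ⟨T, hT⟩ := hT
    exact exists_top_of_many_equal hA hn h2 T hT (h7 T hT)
  have h6 : ∀ T : Finset ℕ, (Finset.univ.filter fun i => A i = T).card ≤ 6 := fun T => by
    by_contra h
    exact hT ⟨T, by omega⟩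
  by_cases h94 : Fintype.card ι = 9 ∧ (Finset.univ.biUnion A).card = 4
  · obtain ⟨K, hK, hKc, hout⟩ := h9 h94.1 h94.2 h6
    obtain ⟨top, α, htop, hα, hc⟩ := exists_top_of_triple hA h94.1 h94.2 hK hout
    refine ⟨top, htop, fun c => ?_⟩
    by_cases hcα : c = α
    · subst hcα
      exact hKc.mono fun i hi => (hα i).1 (by simpa using hi)
    · exact h2 _ (hc c hcα)
  · obtain ⟨top, htop, hc⟩ := exists_top_of_hall hA hn h6 fun h h' => h94 ⟨h, h'⟩
    exact ⟨top, htop, fun c => h2 _ (hc c)⟩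

end Tops

/-! ### Lists of three colours: colouring classes at the rim -/

section Classes

variable {ι P : Type*}

/-- Three lists of three colours, with a colour removed, have distinct representatives unless they
coincide and contain that colour. -/
theorem exists_injOn_erase {B : ι → Finset ℕ} (hB : ∀ i, (B i).card = 3) (c : ℕ) {K : Finset ι}
    (hK : K.card ≤ 3) (hmono : K.card = 3 → ¬ ∃ S : Finset ℕ, c ∈ S ∧ ∀ i ∈ K, B i = S) :
    ∃ x : ι → ℕ, (∀ i ∈ K, x i ∈ (B i).erase c) ∧ ∀ i ∈ K, ∀ j ∈ K, i ≠ j → x i ≠ x j := by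
  refine exists_injOn_choice K (fun i => (B i).erase c) fun s hs => ?_
  rcases s.eq_empty_or_nonempty with rfl | ⟨i, hi⟩
  · simp
  have hge : ∀ i, 2 ≤ ((B i).erase c).card := fun i => by
    have := Finset.pred_card_le_card_erase (s := B i) (a := c)
    rw [hB] at this
    omega
  have h2 : 2 ≤ (s.biUnion fun i => (B i).erase c).card := (hge i).trans
    (Finset.card_le_card (Finset.subset_biUnion_of_mem (fun i => (B i).erase c) hi))
  have hsK := Finset.card_le_card hs
  by_contra hlt
  have hcard : K.card = 3 := by omega
  obtain rfl : s = K := Finset.eq_of_subset_of_card_le hs (by omega)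
  have hall := eq_of_card_biUnion_eq (A := fun i => (B i).erase c) (k := 2) (s := s)
    (fun i _ => hge i) (by omega)
  refine hmono hcard ⟨insert c (s.biUnion fun i => (B i).erase c), by simp, fun j hj => ?_⟩
  have hcj : c ∈ B j := by
    by_contra hcj
    have h3 := hall j hj
    rw [Finset.erase_eq_of_notMem hcj] at h3
    rw [← h3, hB] at hlt
    omega
  rw [← hall j hj, Finset.insert_erase hcj]

theorem colorable_of_erase {π : ι → P} {B : ι → Finset ℕ} {e : Sym2 P → ℕ}
    (hB : ∀ i, (B i).card = 3) (c : ℕ) {K : Finset ι} (hK : K.card ≤ 3)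
    (hmono : K.card = 3 → ¬ ∃ S : Finset ℕ, c ∈ S ∧ ∀ i ∈ K, B i = S)
    (hc : ∀ i ∈ K, ∀ j ∈ K, π i ≠ π j → e s(π i, π j) = c) : Colorable π B e K := by
  obtain ⟨x, hx, hne⟩ := exists_injOn_erase hB c hK hmono
  refine ⟨x, fun i hi => Finset.mem_of_mem_erase (hx i hi), fun i hi j hj hij =>
    ⟨hne i hi j hj hij, fun hp => ?_⟩⟩
  rw [hc i hi j hj hp]
  exact ⟨Finset.ne_of_mem_erase (hx i hi), Finset.ne_of_mem_erase (hx j hj)⟩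

/-- At most one rim edge is involved; without its colour each list still has two elements. -/
theorem colorable_of_card_le_two {π : ι → P} {B : ι → Finset ℕ} (e : Sym2 P → ℕ)
    (hB : ∀ i, (B i).card = 3) {K : Finset ι} (hK : K.card ≤ 2) : Colorable π B e K := by
  classical
  by_cases h2 : K.card = 2
  · obtain ⟨i, j, -, rfl⟩ := Finset.card_eq_two.1 h2
    refine colorable_of_erase hB (e s(π i, π j)) (by omega) (by omega) ?_
    intro a ha b hb hab
    simp only [Finset.mem_insert, Finset.mem_singleton] at ha hb
    rcases ha with rfl | rfl <;> rcases hb with rfl | rfl <;>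
      first | exact absurd rfl hab | rfl | rw [Sym2.eq_swap]
  · have h1 : K.card ≤ 1 := by omega
    refine colorable_of_erase hB 0 (by omega) (by omega) fun i hi j hj h => ?_
    exact absurd (congrArg π (Finset.card_le_one.1 h1 i hi j hj)) h

/-- No rim edge is used inside one part, so distinct representatives of at most three lists are
enough. -/
theorem colorable_of_same_part {π : ι → P} {B : ι → Finset ℕ} (e : Sym2 P → ℕ)
    (hB : ∀ i, (B i).card = 3) {K : Finset ι} (hK : K.card ≤ 3)
    (hp : ∀ i ∈ K, ∀ j ∈ K, π i = π j) : Colorable π B e K := by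
  obtain ⟨x, hx, hne⟩ := exists_injOn_choice K B fun s hs => by
    rcases s.eq_empty_or_nonempty with rfl | ⟨i, hi⟩
    · simp
    · have h1 := Finset.card_le_card hs
      have h2 := Finset.card_le_card (Finset.subset_biUnion_of_mem B hi)
      rw [hB] at h2
      omega
  exact ⟨x, hx, fun i hi j hj hij => ⟨hne i hi j hj hij, fun h => absurd (hp i hi j hj) h⟩⟩

/-- Only one rim edge is relevant when two of the vertices share a part, so the obstruction is the
one in `exists_injOn_erase`. -/
theorem colorable_two_one [DecidableEq ι] {π : ι → P} {B : ι → Finset ℕ} {e : Sym2 P → ℕ}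
    (hB : ∀ i, (B i).card = 3) {i j l : ι} (hij : π i = π j)
    (h : ¬ (B i = B j ∧ B j = B l ∧ e s(π i, π l) ∈ B l)) : Colorable π B e {i, j, l} := by
  refine colorable_of_erase hB (e s(π i, π l)) Finset.card_le_three ?_ ?_
  · rintro - ⟨S, hS, hall⟩
    have h1 := hall i (by simp)
    have h2 := hall j (by simp)
    have h3 := hall l (by simp)
    exact h ⟨h1.trans h2.symm, h2.trans h3.symm, h3 ▸ hS⟩
  · intro a ha b hb hab
    simp only [Finset.mem_insert, Finset.mem_singleton] at ha hb
    rcases ha with rfl | rfl | rfl <;> rcases hb with rfl | rfl | rfl <;>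
      first
      | exact absurd rfl hab
      | exact absurd hij hab
      | exact absurd hij.symm hab
      | rfl
      | exact congrArg e Sym2.eq_swap
      | exact hij ▸ rfl
      | exact congrArg e (Sym2.eq_swap.trans (hij ▸ rfl))

end Classes

/-! ### Three parts -/

section ThreeParts

variable {ι : Type*}

/-- The colouring of the edges of a triangle, indexed by the opposite vertices. -/
def rimColor (x : Fin 3 → ℕ) : Sym2 (Fin 3) → ℕ :=
  Sym2.lift ⟨fun p q => x (-(p + q)), fun p q => congrArg (fun r => x (-r)) (add_comm p q)⟩

theorem rimColor_eq (x : Fin 3 → ℕ) {p q r : Fin 3} (hpq : p ≠ q) (hpr : p ≠ r) (hqr : q ≠ r) :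
    rimColor x s(p, q) = x r := by
  have : -(p + q) = r := by revert p q r; decide
  rw [← this]
  rfl

/-- The pairs of adjacent vertices of the octahedron, with the numbers of remaining pairs at both
ends. -/
def octahedronBounds : List ((Fin 6 × Fin 6) × ℕ × ℕ) :=
  [((0, 1), 4, 4), ((0, 2), 3, 4), ((0, 4), 2, 4), ((0, 5), 1, 4), ((1, 2), 3, 3), ((1, 3), 2, 4),
   ((1, 5), 1, 3), ((2, 3), 2, 3), ((2, 4), 1, 3), ((3, 4), 2, 2), ((3, 5), 1, 2), ((4, 5), 1, 1)]

/-- The octahedron can be coloured from lists of three colours. -/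
theorem octahedron_list_coloring (B X : Fin 3 → Finset ℕ) (hB : ∀ r, (B r).card = 3)
    (hX : ∀ r, (X r).card = 3) :
    ∃ b x : Fin 3 → ℕ, (∀ r, b r ∈ B r) ∧ (∀ r, x r ∈ X r) ∧
      ∀ r s, r ≠ s → b r ≠ b s ∧ b r ≠ x s ∧ x r ≠ x s := by
  have hv : BoundsValid octahedronBounds := by
    simp only [octahedronBounds, BoundsValid, and_true]
    decide +kernel
  -- `2730 = 2 * (4 ^ 6 - 1) / 3` encodes six exponents equal to 2, matching the twelve edges of the
  -- octahedron.
  have hd : ∀ i, digitVec 6 2730 i = 2 := by decide +kernel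
  have hcoeff : MvPolynomial.coeff (Finsupp.equivFunOnFinite.symm (digitVec 6 2730))
      (graphPolynomial (octahedronBounds.map Prod.fst)) ≠ 0 := by
    intro h0
    have h := graphCode_eq_coeff octahedronBounds hv 2730 (by simp [hd]; rfl)
    rw [h0, Int.cast_zero, ZMod.natCast_eq_zero_iff, Nat.dvd_iff_mod_eq_zero] at h
    have hne : graphCode octahedronBounds 2731 % 7 ≠ 0 := by decide +kernel
    exact hne h
  obtain ⟨y, hy, hne⟩ := exists_list_coloring_of_coeff_ne_zero _ _ (by simp [hd]; rfl) hcoeff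
    (Fin.append B X : Fin 6 → Finset ℕ) (fun i => by
      rw [hd]
      refine Fin.addCases (m := 3) (n := 3) (fun r => ?_) (fun r => ?_) i
      · rw [Fin.append_left, hB]; decide
      · rw [Fin.append_right, hX]; decide)
  refine ⟨fun r => y (Fin.castAdd 3 r), fun r => y (Fin.natAdd 3 r), fun r => ?_, fun r => ?_, ?_⟩
  · have := hy (Fin.castAdd 3 r); rwa [Fin.append_left] at this
  · have := hy (Fin.natAdd 3 r); rwa [Fin.append_right] at this
  · have key : ∀ i j : Fin 6, (i, j) ∈ octahedronBounds.map Prod.fst ∨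
        (j, i) ∈ octahedronBounds.map Prod.fst → y i ≠ y j := by
      rintro i j (h | h)
      · exact hne _ h
      · exact (hne _ h).symm
    have hmem : ∀ r s : Fin 3, r ≠ s → ∀ i ∈ [(Fin.castAdd 3 r, Fin.castAdd 3 s),
        (Fin.castAdd 3 r, Fin.natAdd 3 s), (Fin.natAdd 3 r, Fin.natAdd 3 s)],
        i ∈ octahedronBounds.map Prod.fst ∨ i.swap ∈ octahedronBounds.map Prod.fst := by
      decide +kernel
    intro r s hrs
    exact ⟨key _ _ (hmem r s hrs _ (by simp)), key _ _ (hmem r s hrs _ (by simp)),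
      key _ _ (hmem r s hrs _ (by simp))⟩

/-- Distinct colours for the triangle, one of them prescribed. -/
theorem exists_rim_colors {X : Fin 3 → Finset ℕ} (hX : ∀ r, (X r).card = 3) (r₀ : Fin 3) {y : ℕ}
    (hy : y ∈ X r₀) : ∃ x : Fin 3 → ℕ, Function.Injective x ∧ (∀ r, x r ∈ X r) ∧ x r₀ = y := by
  obtain ⟨z, hz, hzy⟩ := exists_mem_notMem_of_card_lt (S := X (r₀ + 1)) (l := [y])
    (by simp [hX])
  obtain ⟨t, ht, hty⟩ := exists_mem_notMem_of_card_lt (S := X (r₀ + 2)) (l := [y, z])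
    (by simp [hX])
  simp only [List.mem_cons, List.not_mem_nil, or_false, not_or] at hzy hty
  have hval : ∀ r, r = r₀ ∨ r = r₀ + 1 ∨ r = r₀ + 2 := fun r => by omega
  have h1 : r₀ + 1 ≠ r₀ := by omega
  have h2 : r₀ + 2 ≠ r₀ := by omega
  have h3 : r₀ + 2 ≠ r₀ + 1 := by omega
  refine ⟨fun r => if r = r₀ then y else if r = r₀ + 1 then z else t, ?_, ?_, by simp⟩
  · intro r s hrs
    rcases hval r with rfl | rfl | rfl <;> rcases hval s with h | h | h <;> subst h <;>
      simp_all [eq_comm]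
  · intro r
    rcases hval r with rfl | rfl | rfl
    · simpa using hy
    · simpa [h1] using hz
    · simpa [h2, h3] using ht

/-- The rim edges at the vertex `r` are opposite to the other two vertices, so `b r` has to avoid `x
s` for `s ≠ r` only. With the distinctness of the `b r` and of the `x r` these are the edges of an
octahedron with antipodal pairs `b r`, `x r`. -/
theorem colorable_transversal {π : ι → Fin 3} {B : ι → Finset ℕ} {x b : Fin 3 → ℕ}
    (hb : ∀ r s, r ≠ s → b r ≠ b s ∧ b r ≠ x s) {K : Finset ι}
    (hK : ∀ i ∈ K, ∀ j ∈ K, i ≠ j → π i ≠ π j) (hbB : ∀ i ∈ K, b (π i) ∈ B i) :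
    Colorable π B (rimColor x) K := by
  refine ⟨fun i => b (π i), hbB, fun i hi j hj hij => ?_⟩
  have hp := hK i hi j hj hij
  refine ⟨(hb _ _ hp).1, fun _ => ?_⟩
  obtain ⟨r, hr1, hr2⟩ : ∃ r, π i ≠ r ∧ π j ≠ r := by
    revert hp
    generalize π i = p
    generalize π j = q
    revert p q
    decide
  rw [rimColor_eq x hp hr1 hr2]
  exact ⟨(hb _ _ hr1).2, (hb _ _ hr2).2⟩

theorem colorable_transversal_triple [DecidableEq ι] {π : ι → Fin 3} {B : ι → Finset ℕ}
    {x b : Fin 3 → ℕ} (hb : ∀ r s, r ≠ s → b r ≠ b s ∧ b r ≠ x s) {i j l : ι} (hij : π i ≠ π j)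
    (hil : π i ≠ π l) (hjl : π j ≠ π l) (hi : b (π i) ∈ B i) (hj : b (π j) ∈ B j)
    (hl : b (π l) ∈ B l) : Colorable π B (rimColor x) {i, j, l} := by
  refine colorable_transversal hb ?_ (by simp [hi, hj, hl])
  intro a ha c hc hac
  simp only [Finset.mem_insert, Finset.mem_singleton] at ha hc
  rcases ha with rfl | rfl | rfl <;> rcases hc with rfl | rfl | rfl <;>
    first | exact absurd rfl hac | assumption | (apply Ne.symm; assumption)

/-- The middle vertices can be covered by three classes that can be coloured at the rim. -/
def RimPartition (π : ι → Fin 3) (B : ι → Finset ℕ) (X : Fin 3 → Finset ℕ) : Prop :=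
  ∃ x : Fin 3 → ℕ, Function.Injective x ∧ (∀ r, x r ∈ X r) ∧
    ∃ K : Fin 3 → Finset ι, (∀ c, Colorable π B (rimColor x) (K c)) ∧ ∀ i, ∃ c, i ∈ K c

theorem RimPartition.of_three {π : ι → Fin 3} [Fintype ι] {B : ι → Finset ℕ}
    (hB : ∀ i, (B i).card = 3) {X : Fin 3 → Finset ℕ} (hX : ∀ r, (X r).card = 3)
    (h : ∀ p, (Finset.univ.filter fun i => π i = p).card ≤ 3) : RimPartition π B X := by
  obtain ⟨y, hy⟩ := Finset.card_pos.1 (by rw [hX 0]; decide : 0 < (X 0).card)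
  obtain ⟨x, hx, hxX, -⟩ := exists_rim_colors hX 0 hy
  refine ⟨x, hx, hxX, fun p => Finset.univ.filter fun i => π i = p, fun p => ?_,
    fun i => ⟨π i, by simp⟩⟩
  refine colorable_of_same_part _ hB (h p) fun i hi j hj => ?_
  simp only [Finset.mem_filter, Finset.mem_univ, true_and] at hi hj
  exact hi.trans hj.symm

/-- A transversal triple, and two classes that lie in one part each. -/
theorem RimPartition.of_transversal [DecidableEq ι] {π : ι → Fin 3} {B : ι → Finset ℕ}
    (hB : ∀ i, (B i).card = 3) {X : Fin 3 → Finset ℕ} (hX : ∀ r, (X r).card = 3) (t : Fin 3 → ι)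
    (ht : ∀ r, π (t r) = r) (K K' : Finset ι) (hK : K.card ≤ 3) (hK' : K'.card ≤ 3)
    (hKp : ∀ i ∈ K, ∀ j ∈ K, π i = π j) (hKp' : ∀ i ∈ K', ∀ j ∈ K', π i = π j)
    (hcov : ∀ i, i ∈ K ∨ i ∈ K' ∨ ∃ r, i = t r) : RimPartition π B X := by
  obtain ⟨b, x, hb, hx, hbx⟩ := octahedron_list_coloring (fun r => B (t r)) X (fun r => hB _) hX
  refine ⟨x, fun r s hrs => ?_, hx, ![K, K', {t 0, t 1, t 2}], fun c => ?_, fun i => ?_⟩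
  · by_contra hne
    exact (hbx r s hne).2.2 hrs
  · fin_cases c
    · exact colorable_of_same_part _ hB hK hKp
    · exact colorable_of_same_part _ hB hK' hKp'
    · refine colorable_transversal_triple (fun r s hrs => ⟨(hbx r s hrs).1, (hbx r s hrs).2.1⟩)
        ?_ ?_ ?_ ?_ ?_ ?_ <;> simp [ht, hb]
  · rcases hcov i with h | h | ⟨r, rfl⟩
    · exact ⟨0, h⟩
    · exact ⟨1, h⟩
    · exact ⟨2, by fin_cases r <;> simp⟩

theorem RimPartition.of_seven_one_one [Fintype ι] {π : ι → Fin 3} (hπ : Function.Surjective π)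
    {B : ι → Finset ℕ} (hB : ∀ i, (B i).card = 3) {X : Fin 3 → Finset ℕ}
    (hX : ∀ r, (X r).card = 3) (h0 : (Finset.univ.filter fun i => π i = 0).card ≤ 7)
    (h1 : ∀ r, r ≠ 0 → (Finset.univ.filter fun i => π i = r).card ≤ 1) : RimPartition π B X := by
  classical
  obtain ⟨t, ht⟩ := hπ.hasRightInverse
  set U := (Finset.univ.filter fun i => π i = 0).erase (t 0) with hU
  have hUc : U.card ≤ 6 := by
    rw [hU, Finset.card_erase_of_mem (by simp [ht 0])]
    omega
  obtain ⟨K, hKU, hKc⟩ := Finset.exists_subset_card_eq (s := U) (n := min 3 U.card) (by simp)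
  have hπU : ∀ i ∈ U, π i = 0 := fun i hi => by
    simpa using Finset.mem_of_mem_erase hi
  refine RimPartition.of_transversal hB hX t ht K (U \ K) (by omega)
    (by rw [Finset.card_sdiff_of_subset hKU]; omega)
    (fun i hi j hj => (hπU i (hKU hi)).trans (hπU j (hKU hj)).symm)
    (fun i hi j hj => (hπU i (Finset.sdiff_subset hi)).trans (hπU j (Finset.sdiff_subset hj)).symm)
    fun i => ?_
  by_cases hi : π i = 0
  · by_cases hit : i = t 0
    · exact Or.inr (Or.inr ⟨0, hit⟩)
    · have : i ∈ U := Finset.mem_erase.2 ⟨hit, by simpa using hi⟩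
      by_cases hiK : i ∈ K
      · exact Or.inl hiK
      · exact Or.inr (Or.inl (Finset.mem_sdiff.2 ⟨this, hiK⟩))
  · exact Or.inr (Or.inr ⟨π i, Finset.card_le_one.1 (h1 _ hi) _ (by simp) _ (by simp [ht (π i)])⟩)

theorem RimPartition.of_four_four_one [Fintype ι] {π : ι → Fin 3} (hπ : Function.Surjective π)
    {B : ι → Finset ℕ} (hB : ∀ i, (B i).card = 3) {X : Fin 3 → Finset ℕ}
    (hX : ∀ r, (X r).card = 3) (h0 : (Finset.univ.filter fun i => π i = 0).card ≤ 4)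
    (h1 : (Finset.univ.filter fun i => π i = 1).card ≤ 4)
    (h2 : (Finset.univ.filter fun i => π i = 2).card ≤ 1) : RimPartition π B X := by
  classical
  obtain ⟨t, ht⟩ := hπ.hasRightInverse
  have hπU : ∀ r, ∀ i ∈ (Finset.univ.filter fun i => π i = r).erase (t r), π i = r :=
    fun r i hi => by simpa using Finset.mem_of_mem_erase hi
  have hc : ∀ r, (Finset.univ.filter fun i => π i = r).card ≤ 4 →
      ((Finset.univ.filter fun i => π i = r).erase (t r)).card ≤ 3 := fun r h => by
    rw [Finset.card_erase_of_mem (by simp [ht r])]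
    omega
  refine RimPartition.of_transversal hB hX t ht _ _ (hc 0 h0) (hc 1 h1)
    (fun i hi j hj => (hπU 0 i hi).trans (hπU 0 j hj).symm)
    (fun i hi j hj => (hπU 1 i hi).trans (hπU 1 j hj).symm) fun i => ?_
  by_cases hit : i = t (π i)
  · exact Or.inr (Or.inr ⟨_, hit⟩)
  have hcase : π i = 0 ∨ π i = 1 ∨ π i = 2 := by omega
  rcases hcase with h | h | h
  · rw [h] at hit
    exact Or.inl (Finset.mem_erase.2 ⟨hit, by simpa using h⟩)
  · rw [h] at hit
    exact Or.inr (Or.inl (Finset.mem_erase.2 ⟨hit, by simpa using h⟩))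
  · rw [h] at hit
    exact absurd (Finset.card_le_one.1 h2 _ (by simpa using h) _ (by simp [ht 2])) hit

/-! ### Parts of sizes at most five, two and two -/

section FiveTwoTwo

variable [Fintype ι] [DecidableEq ι] {π : ι → Fin 3} {B : ι → Finset ℕ} {X : Fin 3 → Finset ℕ}
  {p q : Fin 3} {v v' w w' : ι}

/-- Two middle vertices of the first part are put into the classes `K` and `K'`. -/
theorem RimPartition.of_two_classes (hB : ∀ i, (B i).card = 3)
    (h5 : (Finset.univ.filter fun i => π i = 0).card ≤ 5)
    (hcov : ∀ i, π i = 0 ∨ i = v ∨ i = v' ∨ i = w ∨ i = w') {x : Fin 3 → ℕ}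
    (hx : Function.Injective x) (hxX : ∀ r, x r ∈ X r) {a b : ι} (ha : π a = 0) (hb : π b = 0)
    (hab : a ≠ b) {K K' : Finset ι} (hK : Colorable π B (rimColor x) K)
    (hK' : Colorable π B (rimColor x) K')
    (hcov' : ∀ i ∈ [a, b, v, v', w, w'], i ∈ K ∨ i ∈ K') : RimPartition π B X := by
  refine ⟨x, hx, hxX, ![((Finset.univ.filter fun i => π i = 0).erase a).erase b, K, K'],
    fun c => ?_, fun i => ?_⟩
  · fin_cases c
    · show Colorable π B (rimColor x) (((Finset.univ.filter fun i => π i = 0).erase a).erase b)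
      refine colorable_of_same_part _ hB ?_ fun i hi j hj => ?_
      · rw [Finset.card_erase_of_mem (by simp [hb, hab.symm]),
          Finset.card_erase_of_mem (by simp [ha])]
        omega
      · simp only [Finset.mem_erase, Finset.mem_filter, Finset.mem_univ, true_and] at hi hj
        exact hi.2.2.trans hj.2.2.symm
    · exact hK
    · exact hK'
  · by_cases hmem : i ∈ [a, b, v, v', w, w']
    · rcases hcov' i hmem with h | h
      · exact ⟨1, h⟩
      · exact ⟨2, h⟩
    · simp only [List.mem_cons, List.not_mem_nil, or_false, not_or] at hmem
      refine ⟨0, ?_⟩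
      have : π i = 0 := by
        rcases hcov i with h | h | h | h | h
        · exact h
        all_goals tauto
      simp [this, hmem.1, hmem.2.1]

/-- Both two-element parts are put into classes of their own, with one more vertex each. -/
theorem RimPartition.of_separate (hB : ∀ i, (B i).card = 3)
    (h5 : (Finset.univ.filter fun i => π i = 0).card ≤ 5)
    (hcov : ∀ i, π i = 0 ∨ i = v ∨ i = v' ∨ i = w ∨ i = w')
    (h0p : 0 ≠ p) (h0q : 0 ≠ q) (hpq : p ≠ q)
    (hv : π v = p) (hv' : π v' = p) (hw : π w = q) (hw' : π w' = q)
    {x : Fin 3 → ℕ}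
    (hx : Function.Injective x) (hxX : ∀ r, x r ∈ X r) {a b : ι} (ha : π a = 0) (hb : π b = 0)
    (hab : a ≠ b) (hD : ¬ (B v = B v' ∧ B v' = B a ∧ x q ∈ B a))
    (hF : ¬ (B w = B w' ∧ B w' = B b ∧ x p ∈ B b)) : RimPartition π B X := by
  refine RimPartition.of_two_classes (X := X) hB h5 hcov hx hxX ha hb hab
    (K := {v, v', a}) (K' := {w, w', b}) (colorable_two_one hB (hv.trans hv'.symm) ?_)
    (colorable_two_one hB (hw.trans hw'.symm) ?_) (by simp)
  · rw [hv, ha, rimColor_eq x h0p.symm hpq h0q]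
    exact hD
  · rw [hw, hb, rimColor_eq x h0q.symm hpq.symm h0p]
    exact hF

/-- One vertex of the part `q` joins two vertices of the first part, the other one joins the
part `p`. -/
theorem RimPartition.of_mixed (hB : ∀ i, (B i).card = 3)
    (h5 : (Finset.univ.filter fun i => π i = 0).card ≤ 5)
    (hcov : ∀ i, π i = 0 ∨ i = v ∨ i = v' ∨ i = w ∨ i = w')
    (h0p : 0 ≠ p) (h0q : 0 ≠ q) (hpq : p ≠ q)
    (hv : π v = p) (hv' : π v' = p) (hw : π w = q) (hw' : π w' = q)
    {x : Fin 3 → ℕ}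
    (hx : Function.Injective x) (hxX : ∀ r, x r ∈ X r) {a b : ι} (ha : π a = 0) (hb : π b = 0)
    (hab : a ≠ b) (hF : ¬ (B a = B b ∧ B b = B w ∧ x p ∈ B w))
    (hF' : ¬ (B v = B v' ∧ B v' = B w' ∧ x 0 ∈ B w')) : RimPartition π B X := by
  refine RimPartition.of_two_classes (X := X) hB h5 hcov hx hxX ha hb hab
    (K := {a, b, w}) (K' := {v, v', w'}) (colorable_two_one hB (ha.trans hb.symm) ?_)
    (colorable_two_one hB (hv.trans hv'.symm) ?_) (by simp)
  · rw [ha, hw, rimColor_eq x h0q h0p hpq.symm]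
    exact hF
  · rw [hv, hw', rimColor_eq x hpq h0p.symm h0q.symm]
    exact hF'

/-- All bottom lists but the last one coincide, and the last one differs. -/
theorem RimPartition.of_one_different (hB : ∀ i, (B i).card = 3) (hX : ∀ r, (X r).card = 3)
    (h5 : (Finset.univ.filter fun i => π i = 0).card ≤ 5)
    (hcov : ∀ i, π i = 0 ∨ i = v ∨ i = v' ∨ i = w ∨ i = w')
    (h0p : 0 ≠ p) (h0q : 0 ≠ q) (hpq : p ≠ q)
    (hv : π v = p) (hv' : π v' = p) (hw : π w = q) (hw' : π w' = q)
    {S : Finset ℕ} {a b : ι} (ha : π a = 0) (hb : π b = 0)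
    (hab : a ≠ b) (hBa : B a = S) (hBb : B b = S) (hBv : B v = S) (hBv' : B v' = S)
    (hBw : B w = S) (hBw' : B w' ≠ S) (hXq : X q = S) : RimPartition π B X := by
  have hS : S.card = 3 := hBa ▸ hB a
  have hpick : ∀ r, X r ≠ S → ∃ y ∈ X r, y ∉ S := fun r hr => Finset.not_subset.1 fun hs =>
    hr (Finset.eq_of_subset_of_card_le hs (by rw [hX, hS]))
  by_cases hX0 : X 0 = S
  swap
  · obtain ⟨y, hy, hyS⟩ := hpick 0 hX0
    obtain ⟨x, hx, hxX, hxy⟩ := exists_rim_colors hX 0 hy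
    -- Here `w` and `w'` exchange roles: `w'` joins `a` and `b`, where its list differs, and `w`
    -- joins `v` and `v'`, where the rim colour lies outside `S`.
    refine RimPartition.of_mixed (X := X) hB h5 (fun i => ?_) h0p h0q hpq hv hv' hw' hw hx hxX ha
      hb hab (w := w') (w' := w) ?_ ?_
    · have := hcov i; tauto
    · rintro ⟨-, h, -⟩
      exact hBw' (h.symm.trans hBb)
    · rintro ⟨-, -, h⟩
      rw [hxy, hBw] at h
      exact hyS h
  by_cases hXp : X p = S
  swap
  · obtain ⟨y, hy, hyS⟩ := hpick p hXp
    obtain ⟨x, hx, hxX, hxy⟩ := exists_rim_colors hX p hy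
    refine RimPartition.of_mixed (X := X) hB h5 hcov h0p h0q hpq hv hv' hw hw' hx hxX ha
      hb hab ?_ ?_
    · rintro ⟨-, -, h⟩
      rw [hxy, hBw] at h
      exact hyS h
    · rintro ⟨-, h, -⟩
      exact hBw' (h.symm.trans hBv')
  have hXS : ∀ r, X r = S := fun r => by
    have : r = 0 ∨ r = p ∨ r = q := by omega
    rcases this with rfl | rfl | rfl <;> assumption
  -- All rim lists equal `S`, so the rim uses each colour of `S` once. The first triple copies the
  -- colour of the opposite rim edge at each vertex; the second does the same except at `w'`.
  let s : Fin 3 → ℕ := S.orderEmbOfFin hS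
  have hs : Function.Injective s := (S.orderEmbOfFin hS).injective
  have hsS : ∀ r, s r ∈ S := S.orderEmbOfFin_mem hS
  obtain ⟨z, hz, hzs⟩ := exists_mem_notMem_of_card_lt (S := B w') (l := [s 0, s p])
    (by simp [hB])
  simp only [List.mem_cons, List.not_mem_nil, or_false, not_or] at hzs
  have hsne : ∀ r t, r ≠ t → s r ≠ s t ∧ s r ≠ s t := fun r t h =>
    ⟨fun h' => h (hs h'), fun h' => h (hs h')⟩
  have hbne : ∀ r t, r ≠ t → Function.update s q z r ≠ Function.update s q z t ∧
      Function.update s q z r ≠ s t := by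
    have hq : ∀ r, r ≠ q → r = 0 ∨ r = p := fun r hr => by omega
    intro r t hrt
    by_cases hr : r = q
    · subst hr
      rw [Function.update_self, Function.update_of_ne hrt.symm]
      rcases hq t hrt.symm with rfl | rfl
      · exact ⟨hzs.1, hzs.1⟩
      · exact ⟨hzs.2, hzs.2⟩
    · rw [Function.update_of_ne hr]
      by_cases ht : t = q
      · subst ht
        rw [Function.update_self]
        refine ⟨?_, (hsne r t hrt).1⟩
        rcases hq r hr with rfl | rfl
        · exact Ne.symm hzs.1
        · exact Ne.symm hzs.2
      · rw [Function.update_of_ne ht]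
        exact hsne r t hrt
  refine RimPartition.of_two_classes (X := X) hB h5 hcov hs (fun r => by rw [hXS]; exact hsS r) ha
    hb hab (K := {a, v, w}) (K' := {b, v', w'})
    (colorable_transversal_triple hsne ?_ ?_ ?_ ?_ ?_ ?_)
    (colorable_transversal_triple hbne ?_ ?_ ?_ ?_ ?_ ?_) (by simp)
  · rwa [ha, hv]
  · rwa [ha, hw]
  · rwa [hv, hw]
  · rw [hBa]; exact hsS _
  · rw [hBv]; exact hsS _
  · rw [hBw]; exact hsS _
  · rwa [hb, hv']
  · rwa [hb, hw']
  · rwa [hv', hw']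
  · rw [hb, Function.update_of_ne h0q, hBb]; exact hsS _
  · rw [hv', Function.update_of_ne hpq, hBv']; exact hsS _
  · rw [hw', Function.update_self]; exact hz

/-- A triple containing `w` and `w'` is never obstructed. Separate classes thus work unless the
lists of the first part, that of `v`, and `X q` all coincide. Then mixed classes work if neither `w`
nor `w'` has that list, and the rest is `RimPartition.of_one_different`. -/
theorem RimPartition.of_eq_of_ne (hB : ∀ i, (B i).card = 3) (hX : ∀ r, (X r).card = 3)
    (h3 : 3 ≤ (Finset.univ.filter fun i => π i = 0).card)
    (h5 : (Finset.univ.filter fun i => π i = 0).card ≤ 5)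
    (hcov : ∀ i, π i = 0 ∨ i = v ∨ i = v' ∨ i = w ∨ i = w')
    (h0p : 0 ≠ p) (h0q : 0 ≠ q) (hpq : p ≠ q)
    (hv : π v = p) (hv' : π v' = p) (hw : π w = q) (hw' : π w' = q)
    (hD : B v = B v') (hF : B w ≠ B w') : RimPartition π B X := by
  have hpick : ∀ (r : Fin 3) (S : Finset ℕ), S.card = 3 → X r ≠ S → ∃ y ∈ X r, y ∉ S :=
    fun r S hS hr => Finset.not_subset.1 fun hs =>
      hr (Finset.eq_of_subset_of_card_le hs (by rw [hX, hS]))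
  have hother : ∀ a, ∃ b, π b = 0 ∧ a ≠ b := fun a => by
    obtain ⟨b, hb, hba⟩ := Finset.exists_mem_ne
      (s := Finset.univ.filter fun i => π i = 0) (by omega) a
    exact ⟨b, by simpa using hb, hba.symm⟩
  obtain ⟨y, hy⟩ := Finset.card_pos.1 (by rw [hX 0]; decide : 0 < (X 0).card)
  by_cases hU : ∃ a, π a = 0 ∧ B a ≠ B v
  · obtain ⟨a, ha, haD⟩ := hU
    obtain ⟨b, hb, hab⟩ := hother a
    obtain ⟨x, hx, hxX, -⟩ := exists_rim_colors hX 0 hy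
    exact RimPartition.of_separate (X := X) hB h5 hcov h0p h0q hpq hv hv' hw hw' hx hxX ha hb hab
      (fun h => haD (hD.trans h.2.1).symm) fun h => hF h.1
  push Not at hU
  obtain ⟨a, ha⟩ : ∃ a, π a = 0 := (hother v).imp fun _ h => h.1
  obtain ⟨b, hb, hab⟩ := hother a
  by_cases hXq : X q = B v
  swap
  · obtain ⟨y, hy, hyS⟩ := hpick q _ (hB v) hXq
    obtain ⟨x, hx, hxX, hxy⟩ := exists_rim_colors hX q hy
    refine RimPartition.of_separate (X := X) hB h5 hcov h0p h0q hpq hv hv' hw hw' hx hxX ha hb hab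
      (fun h => hyS ?_) fun h => hF h.1
    rw [← hxy, ← hU a ha]
    exact h.2.2
  by_cases hw1 : B w = B v
  · exact RimPartition.of_one_different hB hX h5 hcov h0p h0q hpq hv hv' hw hw' ha hb hab
      (hU a ha) (hU b hb) rfl hD.symm hw1 (fun h => hF (hw1.trans h.symm)) hXq
  by_cases hw2 : B w' = B v
  · exact RimPartition.of_one_different hB hX h5 (fun i => by have := hcov i; tauto) h0p h0q hpq
      hv hv' hw' hw ha hb hab (hU a ha) (hU b hb) rfl hD.symm hw2 hw1 hXq
  obtain ⟨x, hx, hxX, -⟩ := exists_rim_colors hX 0 hy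
  exact RimPartition.of_mixed (X := X) hB h5 hcov h0p h0q hpq hv hv' hw hw' hx hxX ha hb hab
    (fun h => hw1 (h.2.1.symm.trans (hU b hb))) fun h => hw2 (h.2.1.symm.trans hD.symm)

/-- If the lists agree within both small parts and two lists `B a`, `B b` of the large part agree,
one colouring of the octahedron serves two transversal triples. If the lists of the large part are
distinct instead, `a` and `b` can be chosen to differ from the small parts. -/
theorem RimPartition.of_five_two_two (hB : ∀ i, (B i).card = 3) (hX : ∀ r, (X r).card = 3)
    (h3 : 3 ≤ (Finset.univ.filter fun i => π i = 0).card)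
    (h5 : (Finset.univ.filter fun i => π i = 0).card ≤ 5)
    (hcov : ∀ i, π i = 0 ∨ i = v ∨ i = v' ∨ i = w ∨ i = w')
    (h0p : 0 ≠ p) (h0q : 0 ≠ q) (hpq : p ≠ q)
    (hv : π v = p) (hv' : π v' = p) (hw : π w = q) (hw' : π w' = q) :
    RimPartition π B X := by
  have hother : ∀ a, ∃ b, π b = 0 ∧ a ≠ b := fun a => by
    obtain ⟨b, hb, hba⟩ := Finset.exists_mem_ne
      (s := Finset.univ.filter fun i => π i = 0) (by omega) a
    exact ⟨b, by simpa using hb, hba.symm⟩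
  by_cases hD : B v = B v'
  · by_cases hF : B w = B w'
    · by_cases heq : ∃ a b, π a = 0 ∧ π b = 0 ∧ a ≠ b ∧ B a = B b
      · obtain ⟨a, b, ha, hb, hab, hBab⟩ := heq
        have hrep : ∀ r, r = 0 ∨ r = p ∨ r = q := fun r => by omega
        obtain ⟨c, x, hc, hx, hcx⟩ := octahedron_list_coloring
          (fun r => if r = 0 then B a else if r = p then B v else B w) X
          (fun r => by split_ifs <;> exact hB _) hX
        have hc0 : c 0 ∈ B a := by simpa using hc 0
        have hcp : c p ∈ B v := by simpa [h0p.symm] using hc p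
        have hcq : c q ∈ B w := by simpa [h0q.symm, hpq.symm] using hc q
        have hcx' : ∀ r s, r ≠ s → c r ≠ c s ∧ c r ≠ x s := fun r s h =>
          ⟨(hcx r s h).1, (hcx r s h).2.1⟩
        refine RimPartition.of_two_classes (X := X) hB h5 hcov (x := x) (fun r s h => ?_) hx ha
          hb hab (K := {a, v, w}) (K' := {b, v', w'})
          (colorable_transversal_triple hcx' ?_ ?_ ?_ ?_ ?_ ?_)
          (colorable_transversal_triple hcx' ?_ ?_ ?_ ?_ ?_ ?_) (by simp)
        · by_contra hne
          exact (hcx r s hne).2.2 h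
        · rwa [ha, hv]
        · rwa [ha, hw]
        · rwa [hv, hw]
        · rwa [ha]
        · rwa [hv]
        · rwa [hw]
        · rwa [hb, hv']
        · rwa [hb, hw']
        · rwa [hv', hw']
        · rwa [hb, ← hBab]
        · rwa [hv', ← hD]
        · rwa [hw', ← hF]
      · push Not at heq
        have hne : ∀ (S : Finset ℕ) (c : ι), ∃ a, π a = 0 ∧ c ≠ a ∧ B a ≠ S := by
          intro S c
          have hcard : 1 < ((Finset.univ.filter fun i => π i = 0).erase c).card := by
            have := Finset.pred_card_le_card_erase
              (s := Finset.univ.filter fun i => π i = 0) (a := c)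
            omega
          obtain ⟨a, ha, b, hb, hab⟩ := Finset.one_lt_card.1 hcard
          simp only [Finset.mem_erase, Finset.mem_filter, Finset.mem_univ, true_and] at ha hb
          by_cases haS : B a = S
          · exact ⟨b, hb.2, hb.1.symm, fun h => heq a b ha.2 hb.2 hab (haS.trans h.symm)⟩
          · exact ⟨a, ha.2, ha.1.symm, haS⟩
        obtain ⟨a, ha, -, haD⟩ := hne (B v) v
        obtain ⟨b, hb, hab, hbF⟩ := hne (B w) a
        obtain ⟨y, hy⟩ := Finset.card_pos.1 (by rw [hX 0]; decide : 0 < (X 0).card)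
        obtain ⟨x, hx, hxX, -⟩ := exists_rim_colors hX 0 hy
        exact RimPartition.of_separate (X := X) hB h5 hcov h0p h0q hpq hv hv' hw hw' hx hxX ha hb
          hab (fun h => haD (hD.trans h.2.1).symm) fun h => hbF (hF.trans h.2.1).symm
    · exact RimPartition.of_eq_of_ne hB hX h3 h5 hcov h0p h0q hpq hv hv' hw hw' hD hF
  · by_cases hF : B w = B w'
    · exact RimPartition.of_eq_of_ne hB hX h3 h5 (fun i => by have := hcov i; tauto) h0q h0p
        hpq.symm hw hw' hv hv' hF hD
    · obtain ⟨a, ha, -⟩ := hother v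
      obtain ⟨b, hb, hab⟩ := hother a
      obtain ⟨y, hy⟩ := Finset.card_pos.1 (by rw [hX 0]; decide : 0 < (X 0).card)
      obtain ⟨x, hx, hxX, -⟩ := exists_rim_colors hX 0 hy
      exact RimPartition.of_separate (X := X) hB h5 hcov h0p h0q hpq hv hv' hw hw' hx hxX ha hb
        hab (fun h => hD h.1) fun h => hF h.1

end FiveTwoTwo

end ThreeParts

/-! ### Triples inside one part, and counting by parts -/

section TripleInPart

variable {ι P : Type*} [Fintype ι]

/-- Three middle vertices of one part whose removal leaves no list at the hub more than four
times. -/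
theorem exists_triple_in_part [DecidableEq ι] [DecidableEq P] {π : ι → P} {A : ι → Finset ℕ} (hn : Fintype.card ι = 9)
    (h6 : ∀ T : Finset ℕ, (Finset.univ.filter fun i => A i = T).card ≤ 6)
    (hP : ∃ p, 3 ≤ (Finset.univ.filter fun i => π i = p).card)
    (hT : ∀ T : Finset ℕ, 5 ≤ (Finset.univ.filter fun i => A i = T).card →
      ∃ p, 3 ≤ (Finset.univ.filter fun i => π i = p).card ∧
        (Finset.univ.filter fun i => A i = T).card ≤
          (Finset.univ.filter fun i => A i = T ∧ π i = p).card + 4) :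
    ∃ (K : Finset ι) (p : P), K.card = 3 ∧ (∀ i ∈ K, π i = p) ∧
      ∀ T : Finset ℕ, (Finset.univ.filter fun i => i ∉ K ∧ A i = T).card ≤ 4 := by
  by_cases h5 : ∃ T : Finset ℕ, 5 ≤ (Finset.univ.filter fun i => A i = T).card
  · obtain ⟨T, h5⟩ := h5
    obtain ⟨p, hp3, hp⟩ := hT T h5
    obtain ⟨K₀, hK₀, hK₀c⟩ := Finset.exists_subset_card_eq
      (s := Finset.univ.filter fun i => A i = T ∧ π i = p)
      (n := (Finset.univ.filter fun i => A i = T).card - 4) (by omega)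
    obtain ⟨K, hKK, hKp, hKc⟩ := Finset.exists_subsuperset_card_eq (s := K₀)
      (t := Finset.univ.filter fun i => π i = p) (n := 3)
      (fun i hi => by simpa using (Finset.mem_filter.1 (hK₀ hi)).2.2)
      (by have := h6 T; omega) hp3
    refine ⟨K, p, hKc, fun i hi => by simpa using hKp hi, fun S => ?_⟩
    by_cases hS : S = T
    · subst hS
      have h1 : (Finset.univ.filter fun i => i ∉ K ∧ A i = S) ⊆
          (Finset.univ.filter fun i => A i = S) \ K₀ := fun i hi => by
        simp only [Finset.mem_filter, Finset.mem_univ, true_and, Finset.mem_sdiff] at hi ⊢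
        exact ⟨hi.2, fun h => hi.1 (hKK h)⟩
      have h2 := Finset.card_le_card h1
      rw [Finset.card_sdiff_of_subset fun i hi => by
        simpa using (Finset.mem_filter.1 (hK₀ hi)).2.1] at h2
      omega
    · have h1 : (Finset.univ.filter fun i => i ∉ K ∧ A i = S) ⊆
          Finset.univ \ (Finset.univ.filter fun i => A i = T) := fun i hi => by
        simp only [Finset.mem_filter, Finset.mem_univ, true_and, Finset.mem_sdiff] at hi ⊢
        exact fun h => hS (hi.2.symm.trans h)
      have h2 := Finset.card_le_card h1
      rw [Finset.card_sdiff_of_subset (Finset.subset_univ _), Finset.card_univ] at h2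
      omega
  · push Not at h5
    obtain ⟨p, hp⟩ := hP
    obtain ⟨K, hKp, hKc⟩ := Finset.exists_subset_card_eq hp
    refine ⟨K, p, hKc, fun i hi => by simpa using hKp hi, fun S => ?_⟩
    have h1 : (Finset.univ.filter fun i => i ∉ K ∧ A i = S) ⊆
        (Finset.univ.filter fun i => A i = S) := fun i hi => by
      simp only [Finset.mem_filter, Finset.mem_univ, true_and] at hi ⊢
      exact hi.2
    have := Finset.card_le_card h1
    have := h5 S
    omega

theorem card_filter_and_fiber_le [DecidableEq P] (π : ι → P) (q : ι → Prop) [DecidablePred q]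
    (p : P) :
    (Finset.univ.filter fun i => q i ∧ π i = p).card ≤
      (Finset.univ.filter fun i => π i = p).card :=
  Finset.card_le_card fun i hi => by
    simp only [Finset.mem_filter, Finset.mem_univ, true_and] at hi ⊢
    exact hi.2

theorem card_filter_eq_sum_fibers {k : ℕ} (π : ι → Fin k) (q : ι → Prop) [DecidablePred q] :
    (Finset.univ.filter q).card =
      ∑ p, (Finset.univ.filter fun i => q i ∧ π i = p).card := by
  rw [Finset.card_eq_sum_card_fiberwise (f := π) (t := Finset.univ) (fun i _ => by simp)]
  simp only [Finset.filter_filter]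

theorem card_eq_sum_fibers {k : ℕ} (π : ι → Fin k) :
    Fintype.card ι = ∑ p, (Finset.univ.filter fun i => π i = p).card := by
  rw [← Finset.card_univ,
    Finset.card_eq_sum_card_fiberwise (f := π) (t := Finset.univ) (fun i _ => by simp)]

end TripleInPart

/-! ### List colourings for three parts -/

section ThreePartsColoring

variable {ι : Type*}

/-- If the direct rim edge has the colour of the edge from `i` to the rim, the path goes round the
triangle the other way; distinct rim colours make it rainbow. -/
theorem hub_three_joined {π : ι → Fin 3} (hπ : Function.Surjective π) {top bot : ι → ℕ}
    {x : Fin 3 → ℕ} (hx : Function.Injective x)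
    (hmm : ∀ i j, i ≠ j → top i = top j → Compat π (rimColor x) bot i j)
    (hsing : ∀ i, top i = bot i → ∃ j, j ≠ i ∧ top j = top i) (a b : HubVertex ι (Fin 3)) :
    Joined (hubGraph π) (hubColor top bot (rimColor x)) a b := by
  refine hub_joined hπ hmm (fun i p hp => ?_) hsing a b
  by_cases hb : bot i = rimColor x s(π i, p)
  · have third : ∀ r p : Fin 3, r ≠ p → ∃ q, q ≠ r ∧ q ≠ p := by decide
    obtain ⟨q, hq1, hq2⟩ := third _ _ hp
    refine Or.inr (Or.inl ⟨q, hq1, hq2, ?_⟩)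
    rw [hb, rimColor_eq x hp hq1.symm hq2.symm, rimColor_eq x hq1.symm hp hq2,
      rimColor_eq x hq2 hq1 hp.symm]
    simp [hx.ne hq2, hx.ne hq1, hx.ne hp.symm]
  · exact Or.inl hb

/-- The two vertices may coincide, so parts of size 1 are covered as well. -/
theorem exists_pair_of_card_le_two [Fintype ι] {π : ι → Fin 3} (hπ : Function.Surjective π)
    {p : Fin 3}
    (h : (Finset.univ.filter fun i => π i = p).card ≤ 2) :
    ∃ v v', π v = p ∧ π v' = p ∧ ∀ i, π i = p → i = v ∨ i = v' := by
  classical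
  obtain ⟨v, hv⟩ := hπ p
  by_cases hall : ∀ i, π i = p → i = v
  · exact ⟨v, v, hv, hv, fun i hi => Or.inl (hall i hi)⟩
  · push Not at hall
    obtain ⟨v', hv', hne⟩ := hall
    refine ⟨v, v', hv, hv', fun i hi => ?_⟩
    by_contra hi'
    push Not at hi'
    have h3 : ({v, v', i} : Finset ι).card = 3 :=
      Finset.card_eq_three.2 ⟨v, v', i, hne.symm, hi'.1.symm, hi'.2.symm, rfl⟩
    have hsub : ({v, v', i} : Finset ι) ⊆ Finset.univ.filter fun i => π i = p := by
      intro j hj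
      simp only [Finset.mem_insert, Finset.mem_singleton] at hj
      rcases hj with rfl | rfl | rfl <;> simpa
    have := Finset.card_le_card hsub
    omega

/-- Lists of three colours suffice for three parts of small sizes. -/
theorem hub_three_list_coloring [Fintype ι] {π : ι → Fin 3} (hπ : Function.Surjective π)
    {p q r : ℕ}
    (hp : (Finset.univ.filter fun i => π i = 0).card = p)
    (hq : (Finset.univ.filter fun i => π i = 1).card = q)
    (hr : (Finset.univ.filter fun i => π i = 2).card = r)
    (h : (p ≤ 7 ∧ q ≤ 1 ∧ r ≤ 1) ∨ (p ≤ 4 ∧ q ≤ 4 ∧ r ≤ 1) ∨ (p ≤ 3 ∧ q ≤ 3 ∧ r ≤ 3) ∨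
      (3 ≤ p ∧ p ≤ 5 ∧ q ≤ 2 ∧ r ≤ 2))
    (A B : ι → Finset ℕ) (E : Sym2 (Fin 3) → Finset ℕ) (hA : ∀ i, (A i).card = 3)
    (hB : ∀ i, (B i).card = 3) (hE : ∀ p q, p ≠ q → (E s(p, q)).card = 3) :
    ∃ (top bot : ι → ℕ) (e : Sym2 (Fin 3) → ℕ), (∀ i, top i ∈ A i) ∧ (∀ i, bot i ∈ B i) ∧
      (∀ p q, p ≠ q → e s(p, q) ∈ E s(p, q)) ∧
      ∀ a b, Joined (hubGraph π) (hubColor top bot e) a b := by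
  classical
  have hX : ∀ r : Fin 3, (E s(r + 1, r + 2)).card = 3 := fun r => hE _ _ (by omega)
  have hpart : RimPartition π B fun r => E s(r + 1, r + 2) := by
    rcases h with h | h | h | h
    · refine RimPartition.of_seven_one_one hπ hB hX (by omega) fun s hs => ?_
      have : s = 1 ∨ s = 2 := by omega
      rcases this with rfl | rfl <;> omega
    · exact RimPartition.of_four_four_one hπ hB hX (by omega) (by omega) (by omega)
    · refine RimPartition.of_three hB hX fun s => ?_
      have : s = 0 ∨ s = 1 ∨ s = 2 := by omega
      rcases this with rfl | rfl | rfl <;> omega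
    · obtain ⟨v, v', hv, hv', hvall⟩ := exists_pair_of_card_le_two hπ (p := 1) (by omega)
      obtain ⟨w, w', hw, hw', hwall⟩ := exists_pair_of_card_le_two hπ (p := 2) (by omega)
      refine RimPartition.of_five_two_two hB hX (by omega) (by omega) (fun i => ?_) (p := 1)
        (q := 2) (by decide) (by decide) (by decide) hv hv' hw hw'
      have : π i = 0 ∨ π i = 1 ∨ π i = 2 := by omega
      rcases this with h | h | h
      · exact Or.inl h
      · have := hvall i h; tauto
      · have := hwall i h; tauto
  obtain ⟨x, hx, hxX, K, hK, hcov⟩ := hpart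
  choose g hg using hcov
  have hcard := card_eq_sum_fibers π
  rw [Fin.sum_univ_three, hp, hq, hr] at hcard
  obtain ⟨top, htop, hc⟩ := exists_top (π := π) (B := B) (e := rimColor x) hA (by omega)
    (fun K hK => colorable_of_card_le_two _ hB hK)
    (fun T _ => ⟨g, fun c => (hK c).mono fun i hi => by
      simp only [Finset.mem_filter, Finset.mem_univ, true_and] at hi
      exact hi.2 ▸ hg i⟩)
    (fun h9 _ h6 => by
      obtain ⟨K, s, hKc, hKs, hout⟩ := exists_triple_in_part (π := π) h9 h6
        ⟨0, by omega⟩ fun T hT => by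
          have ht := card_filter_eq_sum_fibers π fun i => A i = T
          rw [Fin.sum_univ_three] at ht
          have h0 := card_filter_and_fiber_le π (fun i => A i = T) 0
          have h1 := card_filter_and_fiber_le π (fun i => A i = T) 1
          have h2 := card_filter_and_fiber_le π (fun i => A i = T) 2
          have hT6 := h6 T
          by_contra hno
          push Not at hno
          have n0 := hno 0
          have n1 := hno 1
          have n2 := hno 2
          omega
      exact ⟨K, hKc, colorable_of_same_part _ hB hKc.le fun i hi j hj =>
        (hKs i hi).trans (hKs j hj).symm, hout⟩)
  obtain ⟨bot, hbot, hmm, hsing⟩ := exists_bot_of_colorable (fun i =>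
    Finset.exists_mem_ne (by rw [hB]; decide) _) hc
  refine ⟨top, bot, rimColor x, htop, hbot, fun s t hst => ?_, hub_three_joined hπ hx hmm hsing⟩
  obtain ⟨y, hy1, hy2, hy⟩ : ∃ y, s ≠ y ∧ t ≠ y ∧ s(s, t) = s(y + 1, y + 2) := by
    revert s t
    decide
  rw [rimColor_eq x hst hy1 hy2, hy]
  exact hxX y

end ThreePartsColoring

/-! ### Two parts -/

section TwoParts

variable {ι : Type*}

theorem hub_two_joined {π : ι → Fin 2} (hπ : Function.Surjective π) {top bot : ι → ℕ} {e : ℕ}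
    (hmm : ∀ i j, i ≠ j → top i = top j → Compat π (fun _ => e) bot i j)
    (hmr : ∀ i, bot i ≠ e ∨ ∃ j, π j ≠ π i ∧ [top i, top j, bot j].Nodup)
    (hsing : ∀ i, top i = bot i → ∃ j, j ≠ i ∧ top j = top i) (a b : HubVertex ι (Fin 2)) :
    Joined (hubGraph π) (hubColor top bot fun _ => e) a b := by
  refine hub_joined hπ hmm (fun i p hp => ?_) hsing a b
  rcases hmr i with h | ⟨j, hj, h⟩
  · exact Or.inl h
  · exact Or.inr (Or.inr ⟨j, by omega, h⟩)

/-- A partition into three classes of at most three elements, such that three elements of a class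
with the same value under `f` are among at least seven such elements. -/
theorem exists_round_robin [Fintype ι] (hn : Fintype.card ι ≤ 9) (f : ι → ℕ) :
    ∃ g : ι → Fin 3, (∀ c, (Finset.univ.filter fun i => g i = c).card ≤ 3) ∧
      ∀ i j l, i ≠ j → i ≠ l → j ≠ l → g i = g j → g i = g l → f i = f j → f i = f l →
        7 ≤ (Finset.univ.filter fun a => f a = f i).card := by
  classical
  -- The elements are sorted by `f` and dealt out cyclically, so a class is a residue modulo 3 of
  -- the positions.
  obtain ⟨σ, hmono⟩ : ∃ σ : Fin (Fintype.card ι) ≃ ι, Monotone (f ∘ σ) :=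
    ⟨(Tuple.sort (f ∘ (Fintype.equivFin ι).symm)).trans (Fintype.equivFin ι).symm,
      Tuple.monotone_sort (f ∘ (Fintype.equivFin ι).symm)⟩
  have hlt : ∀ i, (σ.symm i).val < 9 := fun i => (σ.symm i).2.trans_le hn
  have hinj : ∀ i j, (σ.symm i).val = (σ.symm j).val → i = j := fun i j h =>
    σ.symm.injective (Fin.ext h)
  refine ⟨fun i => ⟨(σ.symm i).val % 3, Nat.mod_lt _ (by decide)⟩, fun c => ?_, ?_⟩
  · have : (Finset.univ.filter fun i =>
        (⟨(σ.symm i).val % 3, Nat.mod_lt _ (by decide)⟩ : Fin 3) = c).card ≤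
        (Finset.range 3).card := by
      refine Finset.card_le_card_of_injOn (fun i => (σ.symm i).val / 3) (fun i _ => ?_) ?_
      · have := hlt i
        simp only [Finset.coe_range, Set.mem_Iio]
        omega
      · intro i hi j hj hij
        simp only [Finset.coe_filter, Finset.mem_univ, true_and, Set.mem_ofPred_eq,
          Fin.ext_iff] at hi hj hij
        exact hinj i j (by omega)
    simpa using this
  · intro i j l hij hil hjl hgj hgl hfj hfl
    simp only [Fin.mk.injEq] at hgj hgl
    have h1 : (σ.symm i).val ≠ (σ.symm j).val := fun h => hij (hinj i j h)
    have h2 : (σ.symm i).val ≠ (σ.symm l).val := fun h => hil (hinj i l h)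
    have h3 : (σ.symm j).val ≠ (σ.symm l).val := fun h => hjl (hinj j l h)
    -- Three distinct positions with the same residue modulo 3 span at least 6. By monotonicity, `f`
    -- is constant on the seven positions in between, ends included.
    obtain ⟨a, b, ha, hb, hab⟩ : ∃ a b, f a = f i ∧ f b = f i ∧
        (σ.symm a).val + 6 ≤ (σ.symm b).val := by
      by_contra hno
      push Not at hno
      have := hno i j rfl hfj.symm
      have := hno j i hfj.symm rfl
      have := hno i l rfl hfl.symm
      have := hno l i hfl.symm rfl
      have := hno j l hfj.symm hfl.symm
      have := hno l j hfl.symm hfj.symm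
      omega
    have hbn := (σ.symm b).2
    have hle : (Finset.range 7).card ≤ (Finset.univ.filter fun a => f a = f i).card := by
      refine Finset.card_le_card_of_injOn
        (fun k => if hk : (σ.symm a).val + k < Fintype.card ι then σ ⟨(σ.symm a).val + k, hk⟩
          else i) (fun k hk => ?_) ?_
      · simp only [Finset.coe_range, Set.mem_Iio] at hk
        have hk' : (σ.symm a).val + k < Fintype.card ι := by omega
        simp only [hk', dif_pos, Finset.coe_filter, Finset.mem_univ, true_and, Set.mem_ofPred_eq]
        have hlo : f (σ (σ.symm a)) ≤ f (σ ⟨(σ.symm a).val + k, hk'⟩) :=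
          hmono (Fin.mk_le_mk.2 (Nat.le_add_right _ _))
        have hhi : f (σ ⟨(σ.symm a).val + k, hk'⟩) ≤ f (σ (σ.symm b)) :=
          hmono (Fin.le_def.2 (show (σ.symm a).val + k ≤ (σ.symm b).val by omega))
        rw [Equiv.apply_symm_apply] at hlo hhi
        omega
      · intro k hk m hm hkm
        simp only [Finset.coe_range, Set.mem_Iio] at hk hm
        have hk' : (σ.symm a).val + k < Fintype.card ι := by omega
        have hm' : (σ.symm a).val + m < Fintype.card ι := by omega
        simp only [hk', hm', dif_pos, EmbeddingLike.apply_eq_iff_eq, Fin.mk.injEq] at hkm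
        omega
    simpa using hle

theorem colorable_erase {π : ι → Fin 2} {B : ι → Finset ℕ} (hB : ∀ i, (B i).card = 3) (e : ℕ)
    {K : Finset ι} (hK : K.card ≤ 3)
    (hmono : K.card = 3 → ¬ ∃ S : Finset ℕ, e ∈ S ∧ ∀ i ∈ K, B i = S) :
    Colorable π (fun i => (B i).erase e) (fun _ => e) K := by
  obtain ⟨x, hx, hne⟩ := exists_injOn_erase hB e hK hmono
  exact ⟨x, hx, fun i hi j hj hij => ⟨hne i hi j hj hij, fun _ =>
    ⟨Finset.ne_of_mem_erase (hx i hi), Finset.ne_of_mem_erase (hx j hj)⟩⟩⟩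

theorem exists_mem_erase_ne {B : ι → Finset ℕ} (hB : ∀ i, (B i).card = 3) (e c : ℕ) (i : ι) :
    ∃ d ∈ (B i).erase e, d ≠ c := by
  obtain ⟨d, hd, hne⟩ := exists_mem_notMem_of_card_lt (S := B i) (l := [e, c]) (by simp [hB])
  simp only [List.mem_cons, List.not_mem_nil, or_false, not_or] at hne
  exact ⟨d, Finset.mem_erase.2 ⟨hne.1, hd⟩, hne.2⟩

/-- All colours at the rim are different from the colour `e` of the rim edge. -/
theorem hub_two_coloring_of_avoiding [Fintype ι] [DecidableEq ι] {π : ι → Fin 2}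
    (hπ : Function.Surjective π)
    {A B : ι → Finset ℕ} (hA : ∀ i, (A i).card = 3) (hB : ∀ i, (B i).card = 3)
    (hn : Fintype.card ι ≤ 9) {e : ℕ}
    (h7 : ∀ T S : Finset ℕ, e ∈ S →
      (Finset.univ.filter fun i => A i = T ∧ B i = S).card ≤ 6)
    (h9 : Fintype.card ι = 9 → (Finset.univ.biUnion A).card = 4 →
      (∀ T : Finset ℕ, (Finset.univ.filter fun i => A i = T).card ≤ 6) →
      ¬ ∃ S : Finset ℕ, e ∈ S ∧ ∀ i, B i = S) :
    ∃ top bot : ι → ℕ, (∀ i, top i ∈ A i) ∧ (∀ i, bot i ∈ B i) ∧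
      ∀ a b, Joined (hubGraph π) (hubColor top bot fun _ => e) a b := by
  obtain ⟨g, hg3, hg⟩ := exists_round_robin hn fun i => Encodable.encode (A i, B i)
  obtain ⟨top, htop, hc⟩ := exists_top (π := π) (B := fun i => (B i).erase e) (e := fun _ => e) hA
    hn (fun K hK => colorable_erase hB e (by omega) (by omega))
    (fun T _ => ⟨g, fun c => by
      have hsub : (Finset.univ.filter fun i => A i = T ∧ g i = c) ⊆
          Finset.univ.filter fun i => g i = c := fun i hi => by
        simp only [Finset.mem_filter, Finset.mem_univ, true_and] at hi ⊢
        exact hi.2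
      refine colorable_erase hB e ((Finset.card_le_card hsub).trans (hg3 c)) fun h3 => ?_
      rintro ⟨S, heS, hS⟩
      obtain ⟨i, j, l, hij, hil, hjl, hK⟩ := Finset.card_eq_three.1 h3
      have hmem : ∀ a ∈ ({i, j, l} : Finset ι), (A a = T ∧ g a = c) ∧ B a = S := fun a ha => by
        rw [← hK] at ha
        exact ⟨by simpa using ha, hS a ha⟩
      obtain ⟨⟨hi1, hi2⟩, hi3⟩ := hmem i (by simp)
      obtain ⟨⟨hj1, hj2⟩, hj3⟩ := hmem j (by simp)
      obtain ⟨⟨hl1, hl2⟩, hl3⟩ := hmem l (by simp)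
      have h7' := hg i j l hij hil hjl (hi2.trans hj2.symm) (hi2.trans hl2.symm)
        (by rw [hi1, hi3, hj1, hj3]) (by rw [hi1, hi3, hl1, hl3])
      have := h7 T S heS
      rw [Finset.filter_congr fun a _ => by
        rw [Encodable.encode_inj, Prod.mk.injEq, hi1, hi3]] at h7'
      omega⟩)
    (fun hn9 h4 h6 => by
      have hconst := h9 hn9 h4 h6
      -- Any triple with two elements in `M` is good for the hub lists: `M` consists of the vertices
      -- with the list occurring five or six times if there is one, and of all vertices otherwise.
      -- The third element remains free to break the coincidence of the rim lists.
      obtain ⟨M, hM2, hM⟩ : ∃ M : Finset ι, 2 ≤ M.card ∧ ∀ (T : Finset ℕ) (K : Finset ι),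
          (∃ i ∈ M, ∃ j ∈ M, i ≠ j ∧ i ∈ K ∧ j ∈ K) →
            (Finset.univ.filter fun i => i ∉ K ∧ A i = T).card ≤ 4 := by
        by_cases h5 : ∃ T : Finset ℕ, 5 ≤ (Finset.univ.filter fun i => A i = T).card
        · obtain ⟨T, h5⟩ := h5
          refine ⟨_, (by omega : 2 ≤ (Finset.univ.filter fun i => A i = T).card), ?_⟩
          rintro S K ⟨i, hi, j, hj, hij, hiK, hjK⟩
          by_cases hS : S = T
          · subst hS
            have hsub : (Finset.univ.filter fun i => i ∉ K ∧ A i = S) ⊆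
                ((Finset.univ.filter fun i => A i = S).erase i).erase j := fun a ha => by
              simp only [Finset.mem_filter, Finset.mem_univ, true_and, Finset.mem_erase] at ha ⊢
              exact ⟨fun h => ha.1 (h ▸ hjK), fun h => ha.1 (h ▸ hiK), ha.2⟩
            have h1 := Finset.card_le_card hsub
            rw [Finset.card_erase_of_mem (Finset.mem_erase.2 ⟨hij.symm, hj⟩),
              Finset.card_erase_of_mem hi] at h1
            have := h6 S
            omega
          · have h1 : (Finset.univ.filter fun i => i ∉ K ∧ A i = S) ⊆
                Finset.univ \ (Finset.univ.filter fun i => A i = T) := fun i hi => by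
              simp only [Finset.mem_filter, Finset.mem_univ, true_and, Finset.mem_sdiff] at hi ⊢
              exact fun h => hS (hi.2.symm.trans h)
            have h2 := Finset.card_le_card h1
            rw [Finset.card_sdiff_of_subset (Finset.subset_univ _), Finset.card_univ] at h2
            omega
        · push Not at h5
          refine ⟨Finset.univ, by rw [Finset.card_univ]; omega, fun T K _ => ?_⟩
          have h1 : (Finset.univ.filter fun i => i ∉ K ∧ A i = T) ⊆
              Finset.univ.filter fun i => A i = T := fun i hi => by
            simp only [Finset.mem_filter, Finset.mem_univ, true_and] at hi ⊢
            exact hi.2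
          have := Finset.card_le_card h1
          have := h5 T
          omega
      obtain ⟨i, hi, j, hj, hij⟩ := Finset.one_lt_card.1 hM2
      obtain ⟨l, hli, hlj, hl⟩ : ∃ l, l ≠ i ∧ l ≠ j ∧ ¬ (e ∈ B i ∧ B i = B j ∧ B i = B l) := by
        by_contra hall
        push Not at hall
        obtain ⟨l, -, hl⟩ := Finset.exists_mem_notMem_of_card_lt_card
          (s := ({i, j} : Finset ι)) (t := Finset.univ)
          (by rw [Finset.card_univ]; exact Finset.card_le_two.trans_lt (by omega))
        simp only [Finset.mem_insert, Finset.mem_singleton, not_or] at hl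
        have h0 := hall l hl.1 hl.2
        refine hconst ⟨B i, h0.1, fun a => ?_⟩
        by_cases hai : a = i
        · rw [hai]
        by_cases haj : a = j
        · rw [haj, h0.2.1]
        · exact (hall a hai haj).2.2.symm
      have hc3 : ({i, j, l} : Finset ι).card = 3 :=
        Finset.card_eq_three.2 ⟨i, j, l, hij, hli.symm, hlj.symm, rfl⟩
      refine ⟨{i, j, l}, hc3, colorable_erase hB e hc3.le fun _ => ?_, fun T =>
        hM T _ ⟨i, hi, j, hj, hij, by simp, by simp⟩⟩
      rintro ⟨S, heS, hS⟩
      have hi := hS i (by simp)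
      have hj := hS j (by simp)
      have hl' := hS l (by simp)
      exact hl ⟨hi ▸ heS, hi.trans hj.symm, hi.trans hl'.symm⟩)
  obtain ⟨bot, hbot, hmm, hsing⟩ := exists_bot_of_colorable
    (fun i => exists_mem_erase_ne hB e (top i) i) hc
  exact ⟨top, bot, htop, fun i => Finset.mem_of_mem_erase (hbot i), hub_two_joined hπ hmm
    (fun i => Or.inl (Finset.ne_of_mem_erase (hbot i))) hsing⟩

/-- An enumeration of every class of a function. -/
theorem exists_index [Fintype ι] {κ : Type*} [DecidableEq κ] (c : ι → κ) :
    ∃ k : ι → ℕ, (∀ i j, c i = c j → k i = k j → i = j) ∧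
      (∀ i, k i < (Finset.univ.filter fun j => c j = c i).card) ∧
      ∀ x m, m < (Finset.univ.filter fun j => c j = x).card → ∃ j, c j = x ∧ k j = m := by
  have hmem : ∀ i, i ∈ Finset.univ.filter fun j => c j = c i := fun i => by simp
  have hval : ∀ i x (h : i ∈ Finset.univ.filter fun j => c j = x),
      ((Finset.univ.filter fun j => c j = c i).equivFin ⟨i, hmem i⟩).val =
        ((Finset.univ.filter fun j => c j = x).equivFin ⟨i, h⟩).val := by
    intro i x h
    obtain rfl : c i = x := by simpa using h
    rfl
  refine ⟨fun i => ((Finset.univ.filter fun j => c j = c i).equivFin ⟨i, hmem i⟩).val,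
    fun i j hij hk => ?_, fun i => Fin.is_lt _, fun x m hm => ?_⟩
  · have hi : i ∈ Finset.univ.filter fun a => c a = c j := by simpa using hij
    beta_reduce at hk
    rw [hval i (c j) hi] at hk
    exact congrArg Subtype.val ((Finset.equivFin _).injective (Fin.ext hk))
  · obtain ⟨⟨j, hj⟩, hjm⟩ := (Finset.univ.filter fun j => c j = x).equivFin.surjective ⟨m, hm⟩
    refine ⟨j, by simpa using hj, ?_⟩
    beta_reduce
    rw [hval j x hj, hjm]

/-- A colouring of the middle vertices that satisfy `Q`, with lists `T` and `S`, together with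
colours at the hub for the other middle vertices. -/
structure PlainColoring (π : ι → Fin 2) (Q : ι → Prop) (T S : Finset ℕ) (e : ℕ)
    (top bot : ι → ℕ) : Prop where
  top_mem : ∀ i, top i ∈ T
  bot_mem : ∀ i, Q i → bot i ∈ S
  compat : ∀ i j, Q i → Q j → i ≠ j → top i = top j → Compat π (fun _ => e) bot i j
  rim : ∀ i, Q i → bot i ≠ e ∨ ∃ j, Q j ∧ π j ≠ π i ∧ [top i, top j, bot j].Nodup
  shared : ∀ i, ∃ j, Q j ∧ j ≠ i ∧ top j = top i
  rest_inj : ∀ i j, ¬ Q i → ¬ Q j → top i = top j → i = j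
  rest_compat : ∀ i j, ¬ Q i → Q j → top i = top j → π i ≠ π j → bot j ≠ e

/-- Vertices with hub list `T` but another rim list take a rim colour outside `S`, which differs
from `e` and from all plain colours. Vertices with another hub list take a hub colour outside `T`;
there are at most two of them, so their classes can avoid `e`. -/
theorem PlainColoring.extend [Fintype ι] {π : ι → Fin 2} (hπ : Function.Surjective π)
    {A B : ι → Finset ℕ}
    (hA : ∀ i, (A i).card = 3) (hB : ∀ i, (B i).card = 3) {T S : Finset ℕ} {e : ℕ} (heS : e ∈ S)
    (hT3 : T.card = 3) (hS3 : S.card = 3)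
    (h2 : (Finset.univ.filter fun i => ¬ A i = T).card ≤ 2) {top bot : ι → ℕ}
    (h : PlainColoring π (fun i => A i = T ∧ B i = S) T S e top bot) :
    ∃ top bot : ι → ℕ, (∀ i, top i ∈ A i) ∧ (∀ i, bot i ∈ B i) ∧
      ∀ a b, Joined (hubGraph π) (hubColor top bot fun _ => e) a b := by
  have hdiff : ∀ R R' : Finset ℕ, R.card = 3 → R'.card = 3 → ∃ c ∈ R, R ≠ R' → c ∉ R' := by
    intro R R' hR hR'
    by_cases hRR : R = R'
    · obtain ⟨c, hc⟩ := Finset.card_pos.1 (by omega : 0 < R.card)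
      exact ⟨c, hc, fun h => absurd hRR h⟩
    · obtain ⟨c, hc, hcR⟩ := Finset.not_subset.1 fun hs =>
        hRR (Finset.eq_of_subset_of_card_le hs (by omega))
      exact ⟨c, hc, fun _ => hcR⟩
  choose o hoA hoT using fun i => hdiff (A i) T (hA i) hT3
  choose y hyB hyS using fun i => hdiff (B i) S (hB i) hS3
  obtain ⟨x, hxB, hxmm, hxs⟩ := exists_bot_of_colorable (ι := {i // ¬ A i = T})
    (π := fun i => π i.1) (B := fun i => (B i.1).erase e) (e := fun _ => e)
    (top := fun i => o i.1) (fun i => exists_mem_erase_ne hB e _ i.1) fun c => by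
      have hc : (Finset.univ.filter fun i : {i // ¬ A i = T} => o i.1 = c).card ≤ 2 := by
        refine (Finset.card_le_univ _).trans ?_
        rw [Fintype.card_subtype]
        exact h2
      exact colorable_erase (B := fun i : {i // ¬ A i = T} => B i.1) (fun i => hB i.1) e
        (hc.trans (by decide)) (fun h => by omega)
  refine ⟨fun i => if A i = T then top i else o i,
    fun i => if hi : A i = T then (if B i = S then bot i else y i) else x ⟨i, hi⟩,
    fun i => ?_, fun i => ?_, hub_two_joined hπ ?_ ?_ ?_⟩
  · beta_reduce
    split_ifs with hi
    · rw [hi]; exact h.top_mem i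
    · exact hoA i
  · beta_reduce
    split_ifs with hi hi'
    · rw [hi']; exact h.bot_mem i ⟨hi, hi'⟩
    · exact hyB i
    · exact Finset.mem_of_mem_erase (hxB ⟨i, hi⟩)
  · have hmix : ∀ i j, A i = T → B i ≠ S → A j = T → B j = S → top i = top j →
        y i ≠ bot j ∧ (π i ≠ π j → y i ≠ e ∧ bot j ≠ e) := fun i j hi hi' hj hj' hij =>
      ⟨fun he => hyS i hi' (he ▸ h.bot_mem j ⟨hj, hj'⟩), fun hp =>
        ⟨fun he => hyS i hi' (he ▸ heS), h.rest_compat i j (fun hQ => hi' hQ.2) ⟨hj, hj'⟩ hij hp⟩⟩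
    intro i j hij ht
    by_cases hi : A i = T <;> by_cases hj : A j = T
    · simp only [hi, hj, if_true] at ht
      by_cases hi' : B i = S <;> by_cases hj' : B j = S <;>
        simp only [Compat, hi, hj, hi', hj', dif_pos, if_true, if_false]
      · exact h.compat i j ⟨hi, hi'⟩ ⟨hj, hj'⟩ hij ht
      · have := hmix j i hj hj' hi hi' ht.symm
        exact ⟨this.1.symm, fun hp => (this.2 hp.symm).symm⟩
      · exact hmix i j hi hi' hj hj' ht
      · exact absurd (h.rest_inj i j (fun hQ => hi' hQ.2) (fun hQ => hj' hQ.2) ht) hij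
    · simp only [hi, hj, if_true, if_false] at ht
      exact absurd (ht ▸ h.top_mem i) (hoT j hj)
    · simp only [hi, hj, if_true, if_false] at ht
      exact absurd (ht ▸ h.top_mem j) (hoT i hi)
    · simp only [hi, hj, if_false] at ht
      have := hxmm ⟨i, hi⟩ ⟨j, hj⟩ (fun h => hij (congrArg Subtype.val h)) ht
      simpa only [Compat, hi, hj, dif_neg, not_false_eq_true] using this
  · intro i
    by_cases hi : A i = T
    · by_cases hi' : B i = S
      · rcases h.rim i ⟨hi, hi'⟩ with hb | ⟨j, ⟨hj, hj'⟩, hp, hnd⟩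
        · left; simpa [hi, hi'] using hb
        · right; exact ⟨j, hp, by simpa [hi, hi', hj, hj'] using hnd⟩
      · left
        simp only [hi, hi', dif_pos, if_false]
        exact fun he => hyS i hi' (he ▸ heS)
    · left
      simp only [hi, dif_neg, not_false_eq_true]
      exact Finset.ne_of_mem_erase (hxB ⟨i, hi⟩)
  · intro i hi
    by_cases hAi : A i = T
    · obtain ⟨j, hj, hne, ht⟩ := h.shared i
      exact ⟨j, hne, by simp [hAi, hj.1, ht]⟩
    · simp only [hAi, dif_neg, not_false_eq_true, if_false] at hi
      obtain ⟨j, hne, ht⟩ := hxs ⟨i, hAi⟩ hi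
      exact ⟨j.1, fun h => hne (Subtype.ext h), by simpa [hAi, j.2] using ht⟩

end TwoParts

/-! ### Explicit colourings of vertices with equal lists -/

section PlainColorings

variable {ι : Type*} {π : ι → Fin 2} {Q : ι → Prop} {k : ι → ℕ} {a : Fin 2}
  {t₁ t₂ t₃ β γ e : ℕ}

/-- If `t₃` belongs to `S` it is taken as `e`. Hence `t₃` never clashes with `β` or `γ` on the
detours over the hub. -/
theorem exists_special_colors {T S : Finset ℕ} (hT : T.card = 3) (hS : S.card = 3) :
    ∃ t₁ t₂ t₃ β γ e, T = {t₁, t₂, t₃} ∧ S = {β, γ, e} ∧ t₁ ≠ t₂ ∧ t₁ ≠ t₃ ∧ t₂ ≠ t₃ ∧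
      β ≠ γ ∧ β ≠ e ∧ γ ≠ e ∧ t₃ ≠ β ∧ t₃ ≠ γ := by
  obtain ⟨t₁, t₂, t₃, h12, h13, h23, rfl⟩ := Finset.card_eq_three.1 hT
  obtain ⟨x, y, z, hxy, hxz, hyz, rfl⟩ := Finset.card_eq_three.1 hS
  by_cases hx : t₃ = x
  · refine ⟨t₁, t₂, t₃, y, z, x, rfl, ?_, h12, h13, h23, hyz, hxy.symm, hxz.symm, ?_, ?_⟩
    · ext c; simp only [Finset.mem_insert, Finset.mem_singleton]; tauto
    all_goals rw [hx]; assumption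
  by_cases hy : t₃ = y
  · refine ⟨t₁, t₂, t₃, x, z, y, rfl, ?_, h12, h13, h23, hxz, hxy, hyz.symm, hx, ?_⟩
    · ext c; simp only [Finset.mem_insert, Finset.mem_singleton]; tauto
    · rw [hy]; assumption
  · exact ⟨t₁, t₂, t₃, x, y, z, rfl, rfl, h12, h13, h23, hxy, hxz, hyz, hx, hy⟩

/-- At most six plain vertices in the part `a`, and two or three in the other one. -/
theorem PlainColoring.of_two_le (h12 : t₁ ≠ t₂) (h13 : t₁ ≠ t₃) (h23 : t₂ ≠ t₃) (hβγ : β ≠ γ)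
    (hβe : β ≠ e) (hγe : γ ≠ e) (h3β : t₃ ≠ β) (h3γ : t₃ ≠ γ)
    (hinj : ∀ i j, (Q i ↔ Q j) → π i = π j → k i = k j → i = j)
    (hU : ∀ i, Q i → π i = a → k i < 6) (hV : ∀ i, Q i → π i ≠ a → k i < 3)
    (hU' : ∀ m < 4, ∃ i, Q i ∧ π i = a ∧ k i = m) (hV' : ∀ m < 2, ∃ i, Q i ∧ π i ≠ a ∧ k i = m)
    (hW : ∀ i, ¬ Q i → π i = a → k i < 2) (hW' : ∀ i, ¬ Q i → π i ≠ a → k i < 1) :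
    PlainColoring π Q {t₁, t₂, t₃} {β, γ, e} e
      (fun i => if π i = a then (if k i % 2 = 0 then t₁ else t₂) else t₃)
      (fun i => if (if π i = a then k i / 2 else k i) = 0 then β else
        if (if π i = a then k i / 2 else k i) = 1 then γ else e) := by
  obtain ⟨u₀, hu₀, ha₀, hk₀⟩ := hU' 0 (by decide)
  obtain ⟨u₁, hu₁, ha₁, hk₁⟩ := hU' 1 (by decide)
  obtain ⟨u₂, hu₂, ha₂, hk₂⟩ := hU' 2 (by decide)
  obtain ⟨u₃, hu₃, ha₃, hk₃⟩ := hU' 3 (by decide)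
  obtain ⟨v₀, hv₀, hb₀, hl₀⟩ := hV' 0 (by decide)
  obtain ⟨v₁, hv₁, hb₁, hl₁⟩ := hV' 1 (by decide)
  have hpart : ∀ i j, π i ≠ a → π j ≠ a → π i = π j := fun i j hi hj => by omega
  refine ⟨?_, ?_, ?_, ?_, ?_, ?_, ?_⟩
  · intro i; split_ifs <;> simp
  · intro i _; split_ifs <;> simp
  · intro i j hi hj hij ht
    simp only [Compat]
    by_cases hia : π i = a <;> by_cases hja : π j = a <;>
      simp only [hia, hja, if_true, if_false] at ht ⊢
    · have hk : k i ≠ k j := fun h => hij (hinj i j (by tauto) (hia.trans hja.symm) h)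
      have := hU i hi hia
      have := hU j hj hja
      refine ⟨?_, fun h => absurd rfl h⟩
      have hlt : k i % 2 = k j % 2 := by split_ifs at ht <;> omega
      clear ht h12 h13 h23
      split_ifs <;> omega
    · split_ifs at ht <;> omega
    · split_ifs at ht <;> omega
    · have hk : k i ≠ k j := fun h => hij (hinj i j (by tauto) (hpart i j hia hja) h)
      have := hV i hi hia
      have := hV j hj hja
      refine ⟨?_, fun h => absurd (hpart i j hia hja) h⟩
      split_ifs at ht ⊢ <;> omega
  · intro i hi
    right
    by_cases hia : π i = a
    · by_cases hc : (if k i % 2 = 0 then t₁ else t₂) = β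
      · refine ⟨v₁, hv₁, by rw [hia]; exact hb₁, ?_⟩
        simp only [hia, hb₁, hl₁, hc, if_true, if_false, one_ne_zero]
        simp [h3β.symm, hβγ, h3γ]
      · refine ⟨v₀, hv₀, by rw [hia]; exact hb₀, ?_⟩
        have : (if k i % 2 = 0 then t₁ else t₂) ≠ t₃ := by split_ifs <;> assumption
        simp only [hia, hb₀, hl₀, if_true, if_false]
        simp [h3β, hc, this]
    · by_cases hc : t₁ = β
      · refine ⟨u₂, hu₂, by rw [ha₂]; exact Ne.symm hia, ?_⟩
        simp [hia, ha₂, hk₂, h13.symm, h3γ, hc ▸ hβγ]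
      · refine ⟨u₀, hu₀, by rw [ha₀]; exact Ne.symm hia, ?_⟩
        simp [hia, ha₀, hk₀, h13.symm, h3β, hc]
  · intro i
    have hne : ∀ {x y : ι}, k x ≠ k y → y ≠ x := fun h h' => h (congrArg k h'.symm)
    by_cases hia : π i = a
    · by_cases h0 : k i % 2 = 0
      · by_cases hi : k i = 0
        · exact ⟨u₂, hu₂, hne (by omega), by simp [hia, ha₂, hk₂, hi]⟩
        · exact ⟨u₀, hu₀, hne (by omega), by simp [hia, ha₀, hk₀, h0]⟩
      · by_cases hi : k i = 1
        · exact ⟨u₃, hu₃, hne (by omega), by simp [hia, ha₃, hk₃, hi]⟩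
        · exact ⟨u₁, hu₁, hne (by omega), by simp [hia, ha₁, hk₁, h0]⟩
    · by_cases hi : k i = 0
      · exact ⟨v₁, hv₁, hne (by omega), by simp [hia, hb₁]⟩
      · exact ⟨v₀, hv₀, hne (by omega), by simp [hia, hb₀]⟩
  · intro i j hi hj ht
    by_cases hia : π i = a <;> by_cases hja : π j = a <;>
      simp only [hia, hja, if_true, if_false] at ht
    · have := hW i hi hia
      have := hW j hj hja
      refine hinj i j (by tauto) (hia.trans hja.symm) ?_
      split_ifs at ht <;> omega
    · split_ifs at ht <;> omega
    · split_ifs at ht <;> omega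
    · have := hW' i hi hia
      have := hW' j hj hja
      exact hinj i j (by tauto) (hpart i j hia hja) (by omega)
  · intro i j hi hj ht hp
    by_cases hia : π i = a <;> by_cases hja : π j = a <;>
      simp only [hia, hja, if_true, if_false] at ht
    · exact absurd (hia.trans hja.symm) hp
    · split_ifs at ht <;> omega
    · split_ifs at ht <;> omega
    · exact absurd (hpart i j hia hja) hp

open scoped Classical in
/-- Six plain vertices in the part `a`, and one in the other one. -/
theorem PlainColoring.of_six_one (h12 : t₁ ≠ t₂) (h13 : t₁ ≠ t₃) (h23 : t₂ ≠ t₃) (hβγ : β ≠ γ)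
    (hβe : β ≠ e) (hγe : γ ≠ e) (h3γ : t₃ ≠ γ) (h1γ : t₁ ≠ γ)
    (hinj : ∀ i j, (Q i ↔ Q j) → π i = π j → k i = k j → i = j)
    (hQ : ∀ i, π i = a → Q i) (hU : ∀ i, π i = a → k i < 6)
    (hV : ∀ i, Q i → π i ≠ a → k i < 1) (hU' : ∀ m < 6, ∃ i, Q i ∧ π i = a ∧ k i = m)
    (hV' : ∃ i, Q i ∧ π i ≠ a) (hW : ∀ i, ¬ Q i → k i < 2) :
    PlainColoring π Q {t₁, t₂, t₃} {β, γ, e} e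
      (fun i => if π i = a then (if k i < 3 then t₁ else if k i < 5 then t₂ else t₃) else
        if k i = 0 ∧ ¬ Q i then t₂ else t₃)
      (fun i => if π i = a then (if k i = 2 then e else if k i = 1 ∨ k i = 4 then γ else β)
        else γ) := by
  obtain ⟨v, hv, hva⟩ := hV'
  have hpart : ∀ i j, π i ≠ a → π j ≠ a → π i = π j := fun i j hi hj => by omega
  refine ⟨?_, ?_, ?_, ?_, ?_, ?_, ?_⟩
  · intro i; split_ifs <;> simp
  · intro i _; split_ifs <;> simp
  · intro i j hi hj hij ht
    simp only [Compat]
    by_cases hia : π i = a <;> by_cases hja : π j = a <;>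
      simp only [hia, hja, hi, hj, if_true, if_false, not_true_eq_false, and_false] at ht ⊢
    · have hk : k i ≠ k j := fun h => hij (hinj i j (by tauto) (hia.trans hja.symm) h)
      have := hU i hia
      have := hU j hja
      refine ⟨?_, fun h => absurd rfl h⟩
      have hlt : k i < 3 ∧ k j < 3 ∨ (3 ≤ k i ∧ k i < 5 ∧ 3 ≤ k j ∧ k j < 5) := by
        split_ifs at ht <;> omega
      clear ht h12 h13 h23
      rcases hlt with hlt | hlt <;> split_ifs <;> omega
    · have := hU i hia
      split_ifs at ht ⊢ <;> omega
    · have := hU j hja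
      split_ifs at ht ⊢ <;> omega
    · have := hV i hi hia
      have := hV j hj hja
      exact absurd (hinj i j (by tauto) (hpart i j hia hja) (by omega)) hij
  · intro i hi
    by_cases hia : π i = a
    · by_cases h2 : k i = 2
      · right
        refine ⟨v, hv, by rw [hia]; exact hva, ?_⟩
        simp [hia, hva, h2, hv, h13, h1γ, h3γ]
      · left
        simp only [hia, if_true]
        split_ifs <;> assumption
    · left
      simpa only [hia, if_false] using hγe
  · intro i
    have hne : ∀ {x y : ι}, k x ≠ k y → y ≠ x := fun h h' => h (congrArg k h'.symm)
    have hsl : ∀ m < 6, k i ≠ m → ((if m < 3 then t₁ else if m < 5 then t₂ else t₃) =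
        if π i = a then (if k i < 3 then t₁ else if k i < 5 then t₂ else t₃) else
          if k i = 0 ∧ ¬ Q i then t₂ else t₃) → ∃ j, Q j ∧ j ≠ i ∧
        (if π j = a then (if k j < 3 then t₁ else if k j < 5 then t₂ else t₃) else
          if k j = 0 ∧ ¬ Q j then t₂ else t₃) =
        if π i = a then (if k i < 3 then t₁ else if k i < 5 then t₂ else t₃) else
          if k i = 0 ∧ ¬ Q i then t₂ else t₃ := by
      intro m hm hkm ht
      obtain ⟨j, hj, hja, hjk⟩ := hU' m hm
      exact ⟨j, hj, hne (by omega), by rw [← ht, if_pos hja, hjk]⟩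
    by_cases hia : π i = a
    · have := hU i hia
      by_cases h3 : k i < 3
      · by_cases h0 : k i = 0
        · exact hsl 1 (by decide) (by omega) (by simp [hia, h3])
        · exact hsl 0 (by decide) (by omega) (by simp [hia, h3])
      by_cases h5 : k i < 5
      · by_cases h0 : k i = 3
        · exact hsl 4 (by decide) (by omega) (by simp [hia, h3, h5])
        · exact hsl 3 (by decide) (by omega) (by simp [hia, h3, h5])
      · exact ⟨v, hv, fun h => hva (h ▸ hia), by simp [hva, hv, hia, h3, h5]⟩
    · by_cases h0 : k i = 0 ∧ ¬ Q i
      · exact hsl 3 (by decide) (by omega) (by simp [hia, h0])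
      · have hk : k i ≠ 5 := by
          by_cases hQi : Q i
          · have := hV i hQi hia; omega
          · have := hW i hQi; omega
        exact hsl 5 (by decide) hk (by simp only [hia, h0, if_false]; simp)
  · intro i j hi hj ht
    have hia : π i ≠ a := fun h => hi (hQ i h)
    have hja : π j ≠ a := fun h => hj (hQ j h)
    have := hW i hi
    have := hW j hj
    simp only [hia, hja, hi, hj, if_false, not_false_eq_true, and_true] at ht
    refine hinj i j (by tauto) (hpart i j hia hja) ?_
    split_ifs at ht <;> omega
  · intro i j hi hj ht hp
    have hia : π i ≠ a := fun h => hi (hQ i h)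
    by_cases hja : π j = a
    · simp only [hia, hja, if_true, if_false] at ht ⊢
      split_ifs at ht ⊢ <;> omega
    · simpa only [hja, if_false] using hγe

/-- Four plain vertices in both parts. -/
theorem PlainColoring.of_four_four (h12 : t₁ ≠ t₂) (h13 : t₁ ≠ t₃) (h23 : t₂ ≠ t₃) (hβγ : β ≠ γ)
    (hβe : β ≠ e) (hγe : γ ≠ e) (h3β : t₃ ≠ β) (h3γ : t₃ ≠ γ) (h1γ : t₁ ≠ γ) (h2β : t₂ ≠ β)
    (hinj : ∀ i j, π i = π j → k i = k j → i = j)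
    (hQ : ∀ i, Q i) (hk : ∀ i, k i < 4)
    (hU' : ∀ m < 4, ∃ i, π i = a ∧ k i = m) (hV' : ∀ m < 4, ∃ i, π i ≠ a ∧ k i = m) :
    PlainColoring π Q {t₁, t₂, t₃} {β, γ, e} e
      (fun i => if k i = 3 then t₃ else if π i = a then t₁ else t₂)
      (fun i => if k i = 2 then e else if k i = 0 ∨ (k i = 3 ∧ π i = a) then β else γ) := by
  have hpart : ∀ i j, π i ≠ a → π j ≠ a → π i = π j := fun i j hi hj => by omega
  refine ⟨?_, ?_, ?_, ?_, ?_, fun i _ hi => absurd (hQ i) hi, fun i _ hi => absurd (hQ i) hi⟩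
  · intro i; split_ifs <;> simp
  · intro i _; split_ifs <;> simp
  · intro i j _ _ hij ht
    have hki := hk i
    have hkj := hk j
    simp only [Compat]
    by_cases hia : π i = a <;> by_cases hja : π j = a <;>
      simp only [hia, hja, if_true, if_false, and_true, and_false, or_false] at ht ⊢
    · have hk : k i ≠ k j := fun h => hij (hinj i j (hia.trans hja.symm) h)
      refine ⟨?_, fun h => absurd rfl h⟩
      have hlt : k i < 3 ∧ k j < 3 := by split_ifs at ht <;> omega
      clear ht
      split_ifs <;> omega
    · have h3 : k i = 3 ∧ k j = 3 := by split_ifs at ht <;> omega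
      simp [h3.1, h3.2, hβγ, hβe, hγe]
    · have h3 : k i = 3 ∧ k j = 3 := by split_ifs at ht <;> omega
      simp [h3.1, h3.2, hβγ.symm, hβe, hγe]
    · have hk : k i ≠ k j := fun h => hij (hinj i j (hpart i j hia hja) h)
      refine ⟨?_, fun h => absurd (hpart i j hia hja) h⟩
      have hlt : k i < 3 ∧ k j < 3 := by split_ifs at ht <;> omega
      clear ht
      split_ifs <;> omega
  · intro i _
    by_cases h2 : k i = 2
    · right
      by_cases hia : π i = a
      · obtain ⟨j, hja, hjk⟩ := hV' 3 (by decide)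
        exact ⟨j, hQ j, by rw [hia]; exact hja, by simp [hia, hja, h2, hjk, h13, h1γ, h3γ]⟩
      · obtain ⟨j, hja, hjk⟩ := hU' 3 (by decide)
        exact ⟨j, hQ j, by rw [hja]; exact Ne.symm hia, by
          simp [hia, hja, h2, hjk, h23, h2β, h3β]⟩
    · left
      simp only [h2, if_false]
      split_ifs <;> assumption
  · intro i
    have hne : ∀ {x y : ι}, k x ≠ k y → y ≠ x := fun h h' => h (congrArg k h'.symm)
    have hki := hk i
    by_cases h3 : k i = 3
    · by_cases hia : π i = a
      · obtain ⟨j, hja, hjk⟩ := hV' 3 (by decide)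
        exact ⟨j, hQ j, fun h => hja (h ▸ hia), by simp [h3, hjk]⟩
      · obtain ⟨j, hja, hjk⟩ := hU' 3 (by decide)
        exact ⟨j, hQ j, fun h => hia (h ▸ hja), by simp [h3, hjk]⟩
    · obtain ⟨m, hm, hmk⟩ : ∃ m < 3, m ≠ k i := by
        by_cases h0 : k i = 0
        · exact ⟨1, by decide, by omega⟩
        · exact ⟨0, by decide, by omega⟩
      by_cases hia : π i = a
      · obtain ⟨j, hja, hjk⟩ := hU' m (by omega)
        exact ⟨j, hQ j, hne (by omega), by simp [hia, hja, h3, hjk, hm.ne]⟩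
      · obtain ⟨j, hja, hjk⟩ := hV' m (by omega)
        exact ⟨j, hQ j, hne (by omega), by simp [hia, hja, h3, hjk, hm.ne]⟩

end PlainColorings

/-! ### List colourings for two parts -/

section TwoPartsColoring

variable {ι : Type*} [Fintype ι]

/-- Many middle vertices have the same lists, and their list at the rim is the list of the rim
edge. -/
theorem hub_two_coloring_of_plain {π : ι → Fin 2} (hπ : Function.Surjective π) {p q : ℕ}
    (hp : (Finset.univ.filter fun i => π i = 0).card = p)
    (hq : (Finset.univ.filter fun i => π i = 1).card = q) (hqp : q ≤ p) (hq1 : 1 ≤ q)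
    (h : p + q ≤ 7 ∨ (p = 6 ∧ q = 2) ∨ (p = 5 ∧ q = 3) ∨ (p = 4 ∧ q = 4) ∨ (p = 6 ∧ q = 3))
    {A B : ι → Finset ℕ} (hA : ∀ i, (A i).card = 3) (hB : ∀ i, (B i).card = 3) {T S : Finset ℕ}
    (h7 : 7 ≤ (Finset.univ.filter fun i => A i = T ∧ B i = S).card) :
    ∃ e ∈ S, ∃ top bot : ι → ℕ, (∀ i, top i ∈ A i) ∧ (∀ i, bot i ∈ B i) ∧
      ∀ a b, Joined (hubGraph π) (hubColor top bot fun _ => e) a b := by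
  classical
  set Q : ι → Prop := fun i => A i = T ∧ B i = S with hQdef
  replace h7 : 7 ≤ (Finset.univ.filter Q).card := by convert h7
  obtain ⟨k, hkinj, hklt, hksurj⟩ := exists_index fun i => (decide (Q i), π i)
  obtain ⟨N, hN⟩ : ∃ N : Bool → Fin 2 → ℕ, ∀ x p,
      (Finset.univ.filter fun i => (decide (Q i), π i) = (x, p)).card = N x p := ⟨_, fun _ _ => rfl⟩
  have hNQ : ∀ p, (Finset.univ.filter fun i => Q i ∧ π i = p).card = N true p := fun p => by
    rw [← hN]; simp
  have hNnQ : ∀ p, (Finset.univ.filter fun i => ¬ Q i ∧ π i = p).card = N false p := fun p => by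
    rw [← hN]; simp
  have hfib : ∀ p, (Finset.univ.filter fun i => π i = p).card = N true p + N false p := fun p => by
    rw [← hNQ, ← hNnQ, ← Finset.card_filter_add_card_filter_not (p := Q), Finset.filter_filter,
      Finset.filter_filter]
    simp only [and_comm]
  have hk1 : ∀ i, Q i → k i < N true (π i) := fun i hi => by
    rw [← hN]; simpa [hi] using hklt i
  have hk0 : ∀ i, ¬ Q i → k i < N false (π i) := fun i hi => by
    rw [← hN]; simpa [hi] using hklt i
  have hs : ∀ p m, m < N true p → ∃ i, Q i ∧ π i = p ∧ k i = m := fun p m hm => by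
    obtain ⟨j, hj, hjm⟩ := hksurj (true, p) m (by rw [hN]; exact hm)
    simp only [Prod.mk.injEq, decide_eq_true_eq] at hj
    exact ⟨j, hj.1, hj.2, hjm⟩
  have hinj : ∀ i j, (Q i ↔ Q j) → π i = π j → k i = k j → i = j := fun i j hQ hp hk =>
    hkinj i j (by simp [hQ, hp]) hk
  have hsum := card_filter_eq_sum_fibers π Q
  rw [Fin.sum_univ_two, hNQ, hNQ] at hsum
  have hp' := (hfib 0).symm.trans hp
  have hq' := (hfib 1).symm.trans hq
  have hcard := card_eq_sum_fibers π
  rw [Fin.sum_univ_two, hp, hq] at hcard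
  obtain ⟨i₀, hi₀⟩ := Finset.card_pos.1 (by omega : 0 < (Finset.univ.filter Q).card)
  have hi₀ : Q i₀ := by simpa using hi₀
  have hT3 : T.card = 3 := by rw [← hi₀.1, hA]
  have hS3 : S.card = 3 := by rw [← hi₀.2, hB]
  have h2 : (Finset.univ.filter fun i => ¬ A i = T).card ≤ 2 := by
    have h1 := Finset.card_filter_add_card_filter_not (s := (Finset.univ : Finset ι))
      (fun i => A i = T)
    have h2 : (Finset.univ.filter Q).card ≤ (Finset.univ.filter fun i => A i = T).card :=
      Finset.card_le_card fun i hi => by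
        simp only [Finset.mem_filter, Finset.mem_univ, true_and] at hi ⊢
        exact hi.1
    rw [Finset.card_univ] at h1
    omega
  suffices hpc : ∃ e ∈ S, ∃ top bot, PlainColoring π Q T S e top bot by
    obtain ⟨e, he, top, bot, hpc⟩ := hpc
    exact ⟨e, he, hpc.extend hπ hA hB he hT3 hS3 h2⟩
  obtain ⟨t₁, t₂, t₃, β, γ, e, hT, hS, h12, h13, h23, hβγ, hβe, hγe, h3β, h3γ⟩ :=
    exists_special_colors hT3 hS3
  have hT' : T = {t₂, t₁, t₃} := hT.trans (Finset.insert_comm _ _ _)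
  have hS' : S = {γ, β, e} := hS.trans (Finset.insert_comm _ _ _)
  refine ⟨e, by simp [hS], ?_⟩
  have main : ∀ a b : Fin 2, a ≠ b → 4 ≤ N true a → N true a ≤ 6 → 2 ≤ N true b → N true b ≤ 3 →
      N false a ≤ 2 → N false b ≤ 1 → ∃ top bot, PlainColoring π Q T S e top bot := by
    intro a b hab h4 h6 h2 h3 hw hw'
    have hb : ∀ i, π i ≠ a → π i = b := fun i hi => by omega
    rw [hT, hS]
    refine ⟨_, _, PlainColoring.of_two_le (a := a) (k := k) h12 h13 h23 hβγ hβe hγe h3β h3γ hinj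
      (fun i hi ha => ?_) (fun i hi ha => ?_) (fun m hm => hs a m (by omega)) (fun m hm => ?_)
      (fun i hi ha => ?_) (fun i hi ha => ?_)⟩
    · have := hk1 i hi; rw [ha] at this; omega
    · have := hk1 i hi; rw [hb i ha] at this; omega
    · obtain ⟨i, h1, h2, h3⟩ := hs b m (by omega)
      exact ⟨i, h1, h2 ▸ hab.symm, h3⟩
    · have := hk0 i hi; rw [ha] at this; omega
    · have := hk0 i hi; rw [hb i ha] at this; omega
  -- At least seven plain vertices in parts of the admitted sizes leave only these distributions,
  -- each matching one of the three explicit colourings.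
  have hcases : (4 ≤ N true 0 ∧ N true 0 ≤ 6 ∧ 2 ≤ N true 1 ∧ N true 1 ≤ 3 ∧ N false 0 ≤ 2 ∧
      N false 1 ≤ 1) ∨ (4 ≤ N true 1 ∧ N true 1 ≤ 6 ∧ 2 ≤ N true 0 ∧ N true 0 ≤ 3 ∧
      N false 1 ≤ 2 ∧ N false 0 ≤ 1) ∨ (N true 0 = 6 ∧ N true 1 = 1 ∧ N false 0 = 0 ∧
      N false 1 ≤ 2) ∨ (N true 0 = 4 ∧ N true 1 = 4 ∧ N false 0 = 0 ∧ N false 1 = 0) := by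
    rw [hsum] at h7
    clear * - h h7 hp' hq' hqp hq1
    by_cases hv : N true 1 ≤ 1
    · exact Or.inr (Or.inr (Or.inl (by omega)))
    by_cases hv3 : N true 1 ≤ 3
    · exact Or.inl (by omega)
    by_cases hu : N true 0 ≤ 3
    · exact Or.inr (Or.inl (by omega))
    · exact Or.inr (Or.inr (Or.inr (by omega)))
  have hπ1 : ∀ i, π i ≠ 0 → π i = 1 := fun i hi => by omega
  rcases hcases with ⟨c1, c2, c3, c4, c5, c6⟩ | ⟨c1, c2, c3, c4, c5, c6⟩ | ⟨c1, c2, c3, c4⟩ |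
    ⟨c1, c2, c3, c4⟩
  · exact main 0 1 (by decide) c1 c2 c3 c4 c5 c6
  · exact main 1 0 (by decide) c1 c2 c3 c4 c5 c6
  · have hQ0 : ∀ i, π i = 0 → Q i := fun i hi => by
      by_contra hQi
      have := hk0 i hQi
      rw [hi] at this
      omega
    have six : ∀ β γ, S = {β, γ, e} → β ≠ γ → β ≠ e → γ ≠ e → t₃ ≠ γ → t₁ ≠ γ →
        ∃ top bot, PlainColoring π Q T S e top bot := by
      intro β γ hS hβγ hβe hγe h3γ h1γ
      rw [hT, hS]
      refine ⟨_, _, PlainColoring.of_six_one (a := 0) (k := k) h12 h13 h23 hβγ hβe hγe h3γ h1γ hinj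
        hQ0 (fun i hi => ?_) (fun i hi ha => ?_) (fun m hm => hs 0 m (by omega)) ?_
        (fun i hi => ?_)⟩
      · have := hk1 i (hQ0 i hi); rw [hi] at this; omega
      · have := hk1 i hi; rw [hπ1 i ha] at this; omega
      · obtain ⟨i, h1, h2, -⟩ := hs 1 0 (by omega)
        exact ⟨i, h1, by rw [h2]; decide⟩
      · have := hk0 i hi; rw [hπ1 i fun h => hi (hQ0 i h)] at this; omega
    by_cases h1γ : t₁ = γ
    · exact six γ β hS' hβγ.symm hγe hβe h3β (h1γ ▸ hβγ.symm)
    · exact six β γ hS hβγ hβe hγe h3γ h1γ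
  · have hQ : ∀ i, Q i := fun i => by
      by_contra hQi
      have := hk0 i hQi
      by_cases hi : π i = 0
      · rw [hi] at this; omega
      · rw [hπ1 i hi] at this; omega
    have hk4 : ∀ i, k i < 4 := fun i => by
      have := hk1 i (hQ i)
      by_cases hi : π i = 0
      · rw [hi] at this; omega
      · rw [hπ1 i hi] at this; omega
    have four : ∀ t₁ t₂, T = {t₁, t₂, t₃} → t₁ ≠ t₂ → t₁ ≠ t₃ → t₂ ≠ t₃ → t₁ ≠ γ → t₂ ≠ β →
        ∃ top bot, PlainColoring π Q T S e top bot := by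
      intro t₁ t₂ hT h12 h13 h23 h1γ h2β
      rw [hT, hS]
      refine ⟨_, _, PlainColoring.of_four_four (a := 0) (k := k) h12 h13 h23 hβγ hβe hγe h3β h3γ
        h1γ h2β (fun i j => hinj i j ⟨fun _ => hQ j, fun _ => hQ i⟩) hQ hk4
        (fun m hm => (hs 0 m (by omega)).imp fun i h => h.2) fun m hm => ?_⟩
      obtain ⟨i, h1, h2, h3⟩ := hs 1 m (by omega)
      exact ⟨i, by rw [h2]; decide, h3⟩
    by_cases h1γ : t₁ = γ
    · exact four t₂ t₁ hT' h12.symm h23 h13 (h1γ ▸ h12.symm) (h1γ ▸ hβγ.symm)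
    by_cases h2β : t₂ = β
    · exact four t₂ t₁ hT' h12.symm h23 h13 (h2β ▸ hβγ) (h2β ▸ h12)
    · exact four t₁ t₂ hT h12 h13 h23 h1γ h2β

/-- All lists at the rim coincide with the list of the rim edge. -/
theorem hub_two_coloring_of_constant {π : ι → Fin 2} (hπ : Function.Surjective π)
    (hp : (Finset.univ.filter fun i => π i = 0).card = 6)
    (hq : (Finset.univ.filter fun i => π i = 1).card = 3)
    {A B : ι → Finset ℕ} (hA : ∀ i, (A i).card = 3) (hB : ∀ i, (B i).card = 3) {S : Finset ℕ}
    (hS : ∀ i, B i = S) (h4 : (Finset.univ.biUnion A).card = 4)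
    (h6 : ∀ T : Finset ℕ, (Finset.univ.filter fun i => A i = T).card ≤ 6) :
    ∃ e ∈ S, ∃ top bot : ι → ℕ, (∀ i, top i ∈ A i) ∧ (∀ i, bot i ∈ B i) ∧
      ∀ a b, Joined (hubGraph π) (hubColor top bot fun _ => e) a b := by
  classical
  have hcard := card_eq_sum_fibers π
  rw [Fin.sum_univ_two, hp, hq] at hcard
  obtain ⟨K, p₀, hK3, hKp, hout⟩ := exists_triple_in_part (π := π) hcard h6 ⟨0, by omega⟩
    fun T hT => by
      have ht := card_filter_eq_sum_fibers π fun i => A i = T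
      rw [Fin.sum_univ_two] at ht
      have h1 := card_filter_and_fiber_le π (fun i => A i = T) 1
      exact ⟨0, by omega, by omega⟩
  obtain ⟨top, α, htop, hα, htwo⟩ := exists_top_of_triple hA hcard h4 hK3 hout
  obtain ⟨j₀, hj₀⟩ := hπ (p₀ + 1)
  have hj₀p : π j₀ ≠ p₀ := by omega
  have hj₀K : j₀ ∉ K := fun h => hj₀p (hKp j₀ h)
  have hS3 : S.card = 3 := by rw [← hS j₀, hB]
  -- The vertex of `K` with rim colour `e` must cross over the hub and `j₀`. Taking `e = α` whenever
  -- possible ensures that the rim colour `d ≠ e` of `j₀` differs from `α`.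
  obtain ⟨e, heS, he⟩ : ∃ e ∈ S, α ∈ S → e = α := by
    by_cases hαS : α ∈ S
    · exact ⟨α, hαS, fun _ => rfl⟩
    · obtain ⟨e, he⟩ := Finset.card_pos.1 (by omega : 0 < S.card)
      exact ⟨e, he, fun h => absurd h hαS⟩
  obtain ⟨d, hd, hdtop⟩ := exists_mem_erase_ne hB e (top j₀) j₀
  rw [hS] at hd
  have hdα : α ≠ d := fun h => by
    have hdS := Finset.mem_of_mem_erase hd
    exact Finset.ne_of_mem_erase hd (h ▸ (he (h ▸ hdS)).symm)
  -- Only `K` may use `e`; the vertex `j₀` is fixed to `d`, and all other vertices avoid `e`.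
  set B' : ι → Finset ℕ := fun i => if i ∈ K then S else if i = j₀ then {d} else S.erase e
    with hB'
  have hB'K : ∀ i ∈ K, B' i = S := fun i hi => if_pos hi
  have hB'j : B' j₀ = {d} := by simp [hB', hj₀K]
  have hB'o : ∀ i, i ∉ K → i ≠ j₀ → B' i = S.erase e := fun i hi hij => by simp [hB', hi, hij]
  have hB'e : ∀ i, i ∉ K → B' i ⊆ S.erase e := fun i hi => by
    by_cases hij : i = j₀
    · rw [hij, hB'j]; simpa using hd
    · rw [hB'o i hi hij]
  have hSe : (S.erase e).card = 2 := by rw [Finset.card_erase_of_mem heS, hS3]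
  have hB'S : ∀ i, B' i ⊆ S := fun i => by
    by_cases hi : i ∈ K
    · rw [hB'K i hi]
    · exact (hB'e i hi).trans (Finset.erase_subset _ _)
  obtain ⟨bot, hbot, hmm, hsing⟩ := exists_bot_of_colorable (π := π) (B := B') (e := fun _ => e)
    (top := top) (fun i => by
      by_cases hi : i ∈ K
      · rw [hB'K i hi]; exact Finset.exists_mem_ne (by omega) _
      by_cases hij : i = j₀
      · rw [hij, hB'j]; exact ⟨d, by simp, hdtop⟩
      · rw [hB'o i hi hij]; exact Finset.exists_mem_ne (by omega) _) fun c => by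
    by_cases hc : c = α
    · obtain ⟨b, hb, hbc⟩ := colorable_of_same_part (π := π) (B := B) (fun _ => e) hB hK3.le
        fun i hi j hj => (hKp i hi).trans (hKp j hj).symm
      have hcK : ∀ i ∈ Finset.univ.filter fun i => top i = c, i ∈ K := fun i hi =>
        (hα i).1 (hc ▸ (by simpa using hi))
      exact ⟨b, fun i hi => by rw [hB'K i (hcK i hi), ← hS i]; exact hb i (hcK i hi),
        fun i hi j hj => hbc i (hcK i hi) j (hcK j hj)⟩
    · have hcK : ∀ i ∈ Finset.univ.filter fun i => top i = c, i ∉ K := fun i hi hiK =>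
        hc (((by simpa using hi : top i = c)).symm.trans ((hα i).2 hiK))
      obtain ⟨x, hx, hne⟩ := exists_injOn_choice (Finset.univ.filter fun i => top i = c) B'
        fun s hs => by
          have h2 := (Finset.card_le_card hs).trans (htwo c hc)
          by_cases hsj : ∃ i ∈ s, i ≠ j₀
          · obtain ⟨i, hi, hij⟩ := hsj
            have := Finset.card_le_card (Finset.subset_biUnion_of_mem B' hi)
            rw [hB'o i (hcK i (hs hi)) hij, hSe] at this
            omega
          · push Not at hsj
            rcases s.eq_empty_or_nonempty with rfl | ⟨i, hi⟩
            · simp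
            · have h1 : s.card ≤ 1 := Finset.card_le_one.2 fun a ha b hb =>
                (hsj a ha).trans (hsj b hb).symm
              have := Finset.card_le_card (Finset.subset_biUnion_of_mem B' hi)
              rw [hsj i hi, hB'j, Finset.card_singleton] at this
              omega
      exact ⟨x, hx, fun i hi j hj hij => ⟨hne i hi j hj hij, fun _ =>
        ⟨Finset.ne_of_mem_erase (hB'e i (hcK i hi) (hx i hi)),
          Finset.ne_of_mem_erase (hB'e j (hcK j hj) (hx j hj))⟩⟩⟩
  refine ⟨e, heS, top, bot, htop, fun i => by rw [hS]; exact hB'S i (hbot i),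
    hub_two_joined hπ hmm (fun i => ?_) hsing⟩
  by_cases hi : i ∈ K
  · right
    have hbj : bot j₀ = d := by simpa [hB'j] using hbot j₀
    have htj : α ≠ top j₀ := fun h => hj₀K ((hα j₀).1 h.symm)
    refine ⟨j₀, by rw [hKp i hi]; exact hj₀p, ?_⟩
    rw [(hα i).2 hi, hbj]
    simp [htj, hdα, hdtop.symm]
  · exact Or.inl (Finset.ne_of_mem_erase (hB'e i hi (hbot i)))

/-- Lists of three colours suffice for two parts of small sizes. -/
theorem hub_two_list_coloring {π : ι → Fin 2} (hπ : Function.Surjective π) {p q : ℕ}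
    (hp : (Finset.univ.filter fun i => π i = 0).card = p)
    (hq : (Finset.univ.filter fun i => π i = 1).card = q) (hqp : q ≤ p) (hq1 : 1 ≤ q)
    (h : p + q ≤ 7 ∨ (p = 6 ∧ q = 2) ∨ (p = 5 ∧ q = 3) ∨ (p = 4 ∧ q = 4) ∨ (p = 6 ∧ q = 3))
    (A B : ι → Finset ℕ) (E : Sym2 (Fin 2) → Finset ℕ) (hA : ∀ i, (A i).card = 3)
    (hB : ∀ i, (B i).card = 3) (hE : ∀ p q, p ≠ q → (E s(p, q)).card = 3) :
    ∃ (top bot : ι → ℕ) (e : Sym2 (Fin 2) → ℕ), (∀ i, top i ∈ A i) ∧ (∀ i, bot i ∈ B i) ∧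
      (∀ p q, p ≠ q → e s(p, q) ∈ E s(p, q)) ∧
      ∀ a b, Joined (hubGraph π) (hubColor top bot e) a b := by
  classical
  suffices hmain : ∃ e ∈ E s(0, 1), ∃ top bot : ι → ℕ, (∀ i, top i ∈ A i) ∧ (∀ i, bot i ∈ B i) ∧
      ∀ a b, Joined (hubGraph π) (hubColor top bot fun _ => e) a b by
    obtain ⟨e, he, top, bot, htop, hbot, hj⟩ := hmain
    refine ⟨top, bot, fun _ => e, htop, hbot, fun s t hst => ?_, hj⟩
    have : s(s, t) = s(0, 1) := by revert s t; decide
    rwa [this]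
  have hE3 := hE 0 1 (by decide)
  have hcard := card_eq_sum_fibers π
  rw [Fin.sum_univ_two, hp, hq] at hcard
  by_cases hI : ∃ T, 7 ≤ (Finset.univ.filter fun i => A i = T ∧ B i = E s(0, 1)).card
  · obtain ⟨T, hT⟩ := hI
    exact hub_two_coloring_of_plain hπ hp hq hqp hq1 h hA hB hT
  by_cases hII : Fintype.card ι = 9 ∧ (Finset.univ.biUnion A).card = 4 ∧
      (∀ T : Finset ℕ, (Finset.univ.filter fun i => A i = T).card ≤ 6) ∧ ∀ i, B i = E s(0, 1)
  · obtain ⟨h9, h4, h6, hS⟩ := hII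
    exact hub_two_coloring_of_constant hπ (by omega) (by omega) hA hB hS h4 h6
  -- Among at most nine vertices only one rim list can occur seven times. If it is not the list of
  -- the rim edge, `e` is chosen outside it.
  obtain ⟨e, heE, he⟩ : ∃ e ∈ E s(0, 1), ∀ S : Finset ℕ,
      7 ≤ (Finset.univ.filter fun i => B i = S).card → e ∈ S → S = E s(0, 1) := by
    by_cases hS : ∃ S, S ≠ E s(0, 1) ∧ 7 ≤ (Finset.univ.filter fun i => B i = S).card
    · obtain ⟨S, hSE, hS7⟩ := hS
      obtain ⟨i, hi⟩ := Finset.card_pos.1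
        (by omega : 0 < (Finset.univ.filter fun i => B i = S).card)
      have hiS : B i = S := by simpa using hi
      obtain ⟨e, he, heS⟩ := Finset.not_subset.1 fun hs : E s(0, 1) ⊆ S =>
        hSE (Finset.eq_of_subset_of_card_le hs (by rw [hE3, ← hiS, hB])).symm
      refine ⟨e, he, fun R hR heR => ?_⟩
      exfalso
      have hRS : R ≠ S := fun h => heS (h ▸ heR)
      have hdisj : Disjoint (Finset.univ.filter fun i => B i = S)
          (Finset.univ.filter fun i => B i = R) := Finset.disjoint_filter.2 fun i _ h1 h2 =>
        hRS (h2.symm.trans h1)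
      have := Finset.card_le_univ ((Finset.univ.filter fun i => B i = S) ∪
        (Finset.univ.filter fun i => B i = R))
      rw [Finset.card_union_of_disjoint hdisj] at this
      omega
    · push Not at hS
      obtain ⟨e, he⟩ := Finset.card_pos.1 (by omega : 0 < (E s(0, 1)).card)
      refine ⟨e, he, fun S hS7 _ => ?_⟩
      by_contra hne
      have := hS S hne
      omega
  refine ⟨e, heE, hub_two_coloring_of_avoiding hπ hA hB (by omega) (fun T S heS => ?_) ?_⟩
  · by_contra hgt
    have hle : (Finset.univ.filter fun i => A i = T ∧ B i = S).card ≤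
        (Finset.univ.filter fun i => B i = S).card := Finset.card_le_card fun i hi => by
      simp only [Finset.mem_filter, Finset.mem_univ, true_and] at hi ⊢
      exact hi.2
    have hSE := he S (by omega) heS
    exact hI ⟨T, by rw [← hSE]; omega⟩
  · rintro h9 h4 h6 ⟨S, heS, hS⟩
    have hall : (Finset.univ.filter fun i => B i = S).card = 9 := by
      rw [Finset.filter_true_of_mem fun i _ => hS i, Finset.card_univ, h9]
    have hSE := he S (by omega) heS
    exact hII ⟨h9, h4, h6, fun i => (hS i).trans hSE⟩

end TwoPartsColoring

/-! ### The values -/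

theorem card_fiber_sigma {k : ℕ} (n : Fin k → ℕ) (p : Fin k) :
    (Finset.univ.filter fun i : Σ p : Fin k, Fin (n p) => i.1 = p).card = n p := by
  have : (Finset.univ.filter fun i : Σ p : Fin k, Fin (n p) => i.1 = p) =
      (Finset.univ : Finset (Fin (n p))).map (Function.Embedding.sigmaMk p) := by
    ext ⟨q, i⟩
    simp only [Finset.mem_filter, Finset.mem_univ, true_and, Finset.mem_map,
      Function.Embedding.sigmaMk_apply]
    constructor
    · rintro rfl
      exact ⟨i, rfl⟩
    · rintro ⟨j, h⟩
      exact (congrArg Sigma.fst h).symm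
  rw [this, Finset.card_map, Finset.card_univ, Fintype.card_fin]

theorem sigma_fst_surjective {k : ℕ} {n : Fin k → ℕ} (hn : ∀ p, 1 ≤ n p) :
    Function.Surjective (Sigma.fst : (Σ p : Fin k, Fin (n p)) → Fin k) := fun p =>
  ⟨⟨p, ⟨0, hn p⟩⟩, rfl⟩

/-- The rainbow connection number of a hub graph is at most four, also with lists. -/
theorem stdHub_values_four {k : ℕ} (hk : k ≤ 3) {n : Fin k → ℕ} (hn : ∀ p, 1 ≤ n p)
    (hlow : ∀ f : Sym2 (HubVertex (Σ p : Fin k, Fin (n p)) (Fin k)) → Fin 3,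
      ¬ ∀ a b, Joined (stdHub n) f a b) : rc (stdHub n) = 4 ∧ rcList (stdHub n) = 4 :=
  rc_eq_and_rcList_eq hlow (hub_exists_list_coloring
    (hub_four_list_coloring hk (sigma_fst_surjective hn)))

theorem G₂_values_three {p q : ℕ} (hpq : p ≥ q) (hq : q ≥ 1)
    (h : p + q ≤ 7 ∨ (p = 6 ∧ q = 2) ∨ (p = 5 ∧ q = 3) ∨ (p = 4 ∧ q = 4) ∨ (p = 6 ∧ q = 3)) :
    rc (G₂ p q) = 3 ∧ rcList (G₂ p q) = 3 := by
  obtain ⟨φ⟩ := G₂_iso p q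
  rw [rc_congr φ, rcList_congr φ]
  exact rc_eq_and_rcList_eq hub_two_not_joined_two (hub_exists_list_coloring
    (hub_two_list_coloring (sigma_fst_surjective (n := ![p, q]) (by
      intro i; fin_cases i <;> simp <;> omega)) (card_fiber_sigma ![p, q] 0)
      (card_fiber_sigma ![p, q] 1) hpq hq h))

/-- Ten or more vertices violate the bound nine, the listed sizes with sum nine violate divisibility
by 3, and `(7, 1)` violates the bound six. -/
theorem G₂_values_four {p q : ℕ} (hpq : p ≥ q) (hq : q ≥ 1)
    (h : p + q ≥ 10 ∨ (p = 7 ∧ q = 1) ∨ (p = 8 ∧ q = 1) ∨ (p = 7 ∧ q = 2) ∨ (p = 5 ∧ q = 4)) :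
    rc (G₂ p q) = 4 ∧ rcList (G₂ p q) = 4 := by
  obtain ⟨φ⟩ := G₂_iso p q
  rw [rc_congr φ, rcList_congr φ]
  refine stdHub_values_four (k := 2) (by decide) (by intro i; fin_cases i <;> simp <;> omega) ?_
  intro f hf
  have h0 : _ = p := card_fiber_sigma ![p, q] 0
  have h1 : _ = q := card_fiber_sigma ![p, q] 1
  have hcard := card_eq_sum_fibers (Sigma.fst : (Σ i : Fin 2, Fin (![p, q] i)) → Fin 2)
  rw [Fin.sum_univ_two, h0, h1] at hcard
  have h9 : Fintype.card (Σ i : Fin 2, Fin (![p, q] i)) ≤ 9 := hub_card_le_nine f hf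
  have hmod := hub_two_card_fiber_mod_three f hf
  rw [h0] at hmod
  by_cases h71 : p = 7 ∧ q = 1
  · obtain ⟨rfl, rfl⟩ := h71
    have h6 := hub_two_card_fiber_le_six (π := (Sigma.fst : (Σ i : Fin 2, Fin (![7, 1] i)) → Fin 2))
      ⟨1, (0 : Fin 1)⟩ (fun ⟨i, j⟩ => by
        constructor
        · rintro (rfl : i = 1)
          exact congrArg (Sigma.mk 1) (Subsingleton.elim (α := Fin 1) _ _)
        · intro h
          exact congrArg Sigma.fst h) f hf
    rw [h0] at h6
    omega
  · omega

theorem G₃_values_three {p q r : ℕ} (hpq : p ≥ q) (hqr : q ≥ r) (hr : r ≥ 1)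
    (h : p + q + r ≤ 8 ∨ (p = 7 ∧ q = 1 ∧ r = 1) ∨ (p = 4 ∧ q = 4 ∧ r = 1) ∨
      (p = 5 ∧ q = 2 ∧ r = 2) ∨ (p = 3 ∧ q = 3 ∧ r = 3)) :
    rc (G₃ p q r) = 3 ∧ rcList (G₃ p q r) = 3 := by
  obtain ⟨φ⟩ := G₃_iso p q r
  rw [rc_congr φ, rcList_congr φ]
  have hsurj := sigma_fst_surjective (n := ![p, q, r]) (by
    intro i; fin_cases i <;> simp <;> omega)
  refine rc_eq_and_rcList_eq (hub_three_not_joined_two hsurj) (hub_exists_list_coloring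
    (hub_three_list_coloring hsurj (card_fiber_sigma ![p, q, r] 0)
      (card_fiber_sigma ![p, q, r] 1) (card_fiber_sigma ![p, q, r] 2) ?_))
  show (p ≤ 7 ∧ q ≤ 1 ∧ r ≤ 1) ∨ (p ≤ 4 ∧ q ≤ 4 ∧ r ≤ 1) ∨ (p ≤ 3 ∧ q ≤ 3 ∧ r ≤ 3) ∨
    (3 ≤ p ∧ p ≤ 5 ∧ q ≤ 2 ∧ r ≤ 2)
  omega

theorem G₃_values_four {p q r : ℕ} (hpq : p ≥ q) (hqr : q ≥ r) (hr : r ≥ 1)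
    (h : p + q + r ≥ 10 ∨ (p = 6 ∧ q = 2 ∧ r = 1) ∨ (p = 5 ∧ q = 3 ∧ r = 1) ∨
      (p = 4 ∧ q = 3 ∧ r = 2)) :
    rc (G₃ p q r) = 4 ∧ rcList (G₃ p q r) = 4 := by
  obtain ⟨φ⟩ := G₃_iso p q r
  rw [rc_congr φ, rcList_congr φ]
  refine stdHub_values_four le_rfl (by intro i; fin_cases i <;> simp <;> omega) ?_
  intro f hf
  have h0 : _ = p := card_fiber_sigma ![p, q, r] 0
  have h1 : _ = q := card_fiber_sigma ![p, q, r] 1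
  have h2 : _ = r := card_fiber_sigma ![p, q, r] 2
  have hcard := card_eq_sum_fibers (Sigma.fst : (Σ i : Fin 3, Fin (![p, q, r] i)) → Fin 3)
  rw [Fin.sum_univ_three, h0, h1, h2] at hcard
  have h9 := hub_card_le_nine f hf
  have hmod := hub_three_card_fiber_mod_three f hf
  rw [h0, h1] at hmod
  omega

theorem values_of_iso {V W : Type*} {G : SimpleGraph V} {H : SimpleGraph W} (φ : G ≃g H)
    (h : (rc H = 3 ∧ rcList H = 3) ∨ (rc H = 4 ∧ rcList H = 4)) :
    rc G = rcList G ∧ rcList G ∈ ({3, 4} : Set ℕ) := by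
  rw [rc_congr φ, rcList_congr φ]
  rcases h with ⟨h1, h2⟩ | ⟨h1, h2⟩ <;> simp [h1, h2]

end RainbowConnection

theorem mainTheorem1 :
    -- every graph of the family has equal parameters, with value 3 or 4
    (∀ {V : Type u} (G : SimpleGraph V), RainbowConnection.Family G →
      RainbowConnection.rc G = RainbowConnection.rcList G ∧
        RainbowConnection.rcList G ∈ ({3, 4} : Set ℕ)) ∧
    -- the members of the family
    (∀ {V : Type u} (G : SimpleGraph V), RainbowConnection.Family G ↔
      Nonempty (G ≃g RainbowConnection.petersen) ∨
      (∃ p q : ℕ, p ≥ q ∧ q ≥ 1 ∧ Nonempty (G ≃g RainbowConnection.G₂ p q)) ∨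
      (∃ p q r : ℕ, p ≥ q ∧ q ≥ r ∧ r ≥ 1 ∧ Nonempty (G ≃g RainbowConnection.G₃ p q r))) ∧
    -- the values
    (RainbowConnection.rc RainbowConnection.petersen = 3 ∧
      RainbowConnection.rcList RainbowConnection.petersen = 3) ∧
    (∀ p q : ℕ, p ≥ q → q ≥ 1 →
      (p + q ≤ 7 ∨ (p, q) ∈ ({(6, 2), (5, 3), (4, 4), (6, 3)} : Set (ℕ × ℕ)) →
        RainbowConnection.rc (RainbowConnection.G₂ p q) = 3 ∧
          RainbowConnection.rcList (RainbowConnection.G₂ p q) = 3) ∧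
      (p + q ≥ 10 ∨ (p, q) ∈ ({(7, 1), (8, 1), (7, 2), (5, 4)} : Set (ℕ × ℕ)) →
        RainbowConnection.rc (RainbowConnection.G₂ p q) = 4 ∧
          RainbowConnection.rcList (RainbowConnection.G₂ p q) = 4)) ∧
    (∀ p q r : ℕ, p ≥ q → q ≥ r → r ≥ 1 →
      (p + q + r ≤ 8 ∨
          (p, q, r) ∈ ({(7, 1, 1), (4, 4, 1), (5, 2, 2), (3, 3, 3)} : Set (ℕ × ℕ × ℕ)) →
        RainbowConnection.rc (RainbowConnection.G₃ p q r) = 3 ∧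
          RainbowConnection.rcList (RainbowConnection.G₃ p q r) = 3) ∧
      (p + q + r ≥ 10 ∨
          (p, q, r) ∈ ({(6, 2, 1), (5, 3, 1), (4, 3, 2)} : Set (ℕ × ℕ × ℕ)) →
        RainbowConnection.rc (RainbowConnection.G₃ p q r) = 4 ∧
          RainbowConnection.rcList (RainbowConnection.G₃ p q r) = 4)) := by
  refine ⟨fun {V} G hG => ?_, fun {V} G => RainbowConnection.family_iff G,
    RainbowConnection.petersen_values, fun p q hpq hq => ⟨fun h => ?_, fun h => ?_⟩,
    fun p q r hpq hqr hr => ⟨fun h => ?_, fun h => ?_⟩⟩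
  · rcases (RainbowConnection.family_iff G).1 hG with
      ⟨⟨φ⟩⟩ | ⟨p, q, hpq, hq, ⟨φ⟩⟩ | ⟨p, q, r, hpq, hqr, hr, ⟨φ⟩⟩
    · exact RainbowConnection.values_of_iso φ (Or.inl RainbowConnection.petersen_values)
    · refine RainbowConnection.values_of_iso φ ?_
      by_cases h : p + q ≤ 7 ∨ (p = 6 ∧ q = 2) ∨ (p = 5 ∧ q = 3) ∨ (p = 4 ∧ q = 4) ∨
        (p = 6 ∧ q = 3)
      · exact Or.inl (RainbowConnection.G₂_values_three hpq hq h)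
      -- The two lists of sizes are complementary, so failing the first case places the pair in the
      -- second.
      · exact Or.inr (RainbowConnection.G₂_values_four hpq hq (by omega))
    · refine RainbowConnection.values_of_iso φ ?_
      by_cases h : p + q + r ≤ 8 ∨ (p = 7 ∧ q = 1 ∧ r = 1) ∨ (p = 4 ∧ q = 4 ∧ r = 1) ∨
        (p = 5 ∧ q = 2 ∧ r = 2) ∨ (p = 3 ∧ q = 3 ∧ r = 3)
      · exact Or.inl (RainbowConnection.G₃_values_three hpq hqr hr h)
      · exact Or.inr (RainbowConnection.G₃_values_four hpq hqr hr (by omega))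
  · exact RainbowConnection.G₂_values_three hpq hq (by simpa using h)
  · exact RainbowConnection.G₂_values_four hpq hq (by simpa using h)
  · exact RainbowConnection.G₃_values_three hpq hqr hr (by simpa using h)
  · exact RainbowConnection.G₃_values_four hpq hqr hr (by simpa using h)
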